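/- **Definitions.** Let $\ell_1\perp\ell_2$ be two orthogonal lines through the origin of $\mathbb{R}^2$, where $\ell_1$ makes the angle $\varphi\in[0,\pi)$ with the positive $x$-axis. For $\theta\in[0,2\pi)$ let $\mathcal{O}_\theta$ be the pair of lines obtained from $\ell_1,\ell_2$ by a counterclockwise rotation by $\theta$ about the origin. A *quadrant* with respect to $\mathcal{O}_\theta$ is an open wedge of aperture $\pi/2$, with an arbitrary vertex in the plane, whose two bounding rays are parallel to the lines of $\mathcal{O}_\theta$. A region is *$P$-free* if its interior contains no point of $P$. The *rectilinear convex hull* $\mathcal{RH}_\theta(P)$ of a finite set $P\subset\mathbb{R}^2$ is the complement in $\mathbb{R}^2$ of the union of all $P$-free quadrants with respect to $\mathcal{O}_\theta$. In particular, $\mathcal{RH}_\theta(R)$ is $B$-free if no point of $B$ lies in its interior (points of $B$ on its boundary are allowed). The model of computation is the real RAM: a machine with a memory of real numbers and a memory of integers (for counting and addressing), in which each arithmetic operation on integers or reals, each of the functions $\sin,\cos,\arctan$ on reals, each comparison and each memory access takes one unit of time. A machine of size $s$ has $s$ cells of each kind, and its integer cells hold only values in $\{0,\dots,s-1\}$;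 its size is the space it uses. **Theorem.** There are a real RAM program and functions $T(n)=O(n\log n)$ and $S(n)=O(n)$ such that the following holds for every $\varphi\in[0,\pi)$ and all disjoint finite sets $R,B\subset\mathbb{R}^2$, with $n=|R|+|B|$. Given $\varphi$ and the points of $R$ and of $B$, each set listed in an arbitrary order, the program halts after at most $T(n)$ units of time on a machine of size $S(n)$ and reports the (possibly empty) set of maximal angular intervals of $\theta$ for which $\mathcal{RH}_\theta(R)$ is $B$-free. That is, it outputs numbers $0\le a_1\le b_1<a_2\le b_2<\dots<a_m\le b_m\le 2\pi$ with $a_m<2\pi$ such that $$\{\theta\in[0,2\pi) : \mathcal{RH}_\theta(R)\text{ is }B\text{-free}\}=[0,2\pi)\cap\bigcup_{i=1}^m[a_i,b_i].$$ -/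

import Mathlib

open Real Set Filter Asymptotics

noncomputable section

/-! ## The rectilinear convex hull -/

/-- The Euclidean plane in Cartesian coordinates (only its vector space structure and its
topology matter here). -/
abbrev Plane : Type := ℝ × ℝ

/-- The unit vector that makes the angle `α` with the positive `x`-axis. -/
def unitDir (α : ℝ) : Plane := (Real.cos α, Real.sin α)

/-- The open wedge of size `π / 2` with vertex `x` that lies between the ray of direction `α` and
the ray of direction `α + π / 2`. -/
def wedge (α : ℝ) (x : Plane) : Set Plane :=
  {y | ∃ s t : ℝ, 0 < s ∧ 0 < t ∧ y = x + s • unitDir α + t • unitDir (α + π / 2)}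

/-- The quadrants with respect to the two orthogonal lines through the origin one of which has
direction `ω`: the four open wedges of size `π / 2`, at every vertex `x`, whose bounding rays are
parallel to these lines. -/
def IsQuadrant (ω : ℝ) (q : Set Plane) : Prop :=
  ∃ (x : Plane) (k : Fin 4), q = wedge (ω + (k : ℕ) * (π / 2)) x

/-- The region `A` is `P`-free: no point of `P` is in its interior. -/
def IsFree (P A : Set Plane) : Prop := ∀ p ∈ P, p ∉ interior A

/-- The rectilinear convex hull of `P` with respect to the two orthogonal lines through the origin
one of which has direction `ω`: the plane minus all `P`-free quadrants. -/
def rectHull (ω : ℝ) (P : Set Plane) : Set Plane :=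
  (⋃₀ {q | IsQuadrant ω q ∧ IsFree P q})ᶜ

/-- The angles `θ ∈ [0, 2π)` such that, after a counterclockwise rotation by `θ` of the pair of
orthogonal lines of directions `φ` and `φ + π / 2`, the rectilinear convex hull of `R` is
`B`-free. -/
def separationAngles (φ : ℝ) (R B : Set Plane) : Set ℝ :=
  {θ | θ ∈ Ico 0 (2 * π) ∧ IsFree B (rectHull (φ + θ) R)}

/-! ## The real RAM

A machine with two random access memories, one whose cells hold integers (used for counting and
for addressing) and one whose cells hold real numbers.  The only passage from real to integer
data is through comparisons of reals.  A machine of size `s` has `s` cells of each kind, and its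
integer words can only hold the values `0, …, s - 1`. -/

namespace RealRAM

/-- The contents of the two memories. -/
structure State where
  int : ℕ → ℕ
  real : ℕ → ℝ

/-- Integer expressions; subtraction is truncated at zero and division rounds down. -/
inductive IExp where
  | lit (k : ℕ)
  | load (addr : IExp)
  | add (e f : IExp)
  | sub (e f : IExp)
  | mul (e f : IExp)
  | div (e f : IExp)

/-- Real expressions: integer constants, memory access, conversion of integers, arithmetic and
trigonometric operations. -/
inductive RExp where
  | lit (k : ℤ)
  | load (addr : IExp)
  | ofInt (e : IExp)
  | add (e f : RExp)
  | sub (e f : RExp)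
  | mul (e f : RExp)
  | div (e f : RExp)
  | sin (e : RExp)
  | cos (e : RExp)
  | arctan (e : RExp)

/-- Tests. -/
inductive Test where
  | ilt (e f : IExp)
  | rlt (e f : RExp)
  | not (c : Test)
  | and (c d : Test)

/-- Programs. -/
inductive Prog where
  | skip
  | storeInt (addr : IExp) (e : IExp)
  | storeReal (addr : IExp) (e : RExp)
  | seq (p q : Prog)
  | ite (c : Test) (p q : Prog)
  | while (c : Test) (p : Prog)

/-- The value of an integer expression. -/
def IExp.eval (σ : State) : IExp → ℕ
  | lit k => k
  | load a => σ.int (a.eval σ)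
  | add e f => e.eval σ + f.eval σ
  | sub e f => e.eval σ - f.eval σ
  | mul e f => e.eval σ * f.eval σ
  | div e f => e.eval σ / f.eval σ

/-- The evaluation is legal on a machine of size `s`: all values that occur, addresses in
particular, are less than `s`, and there is no division by zero. -/
def IExp.Legal (s : ℕ) (σ : State) : IExp → Prop
  | lit k => k < s
  | load a => a.Legal s σ ∧ σ.int (a.eval σ) < s
  | add e f => e.Legal s σ ∧ f.Legal s σ ∧ e.eval σ + f.eval σ < s
  | sub e f => e.Legal s σ ∧ f.Legal s σ
  | mul e f => e.Legal s σ ∧ f.Legal s σ ∧ e.eval σ * f.eval σ < s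
  | div e f => e.Legal s σ ∧ f.Legal s σ ∧ f.eval σ ≠ 0

/-- The time to evaluate an integer expression: one unit for each operation. -/
def IExp.cost : IExp → ℕ
  | lit _ => 1
  | load a => a.cost + 1
  | add e f => e.cost + f.cost + 1
  | sub e f => e.cost + f.cost + 1
  | mul e f => e.cost + f.cost + 1
  | div e f => e.cost + f.cost + 1

/-- The value of a real expression. -/
def RExp.eval (σ : State) : RExp → ℝ
  | lit k => (k : ℝ)
  | load a => σ.real (a.eval σ)
  | ofInt e => (e.eval σ : ℝ)
  | add e f => e.eval σ + f.eval σ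
  | sub e f => e.eval σ - f.eval σ
  | mul e f => e.eval σ * f.eval σ
  | div e f => e.eval σ / f.eval σ
  | sin e => Real.sin (e.eval σ)
  | cos e => Real.cos (e.eval σ)
  | arctan e => Real.arctan (e.eval σ)

/-- The evaluation is legal on a machine of size `s`: all integer evaluations are legal, and
there is no division by zero. -/
def RExp.Legal (s : ℕ) (σ : State) : RExp → Prop
  | lit _ => True
  | load a => a.Legal s σ
  | ofInt e => e.Legal s σ
  | add e f => e.Legal s σ ∧ f.Legal s σ
  | sub e f => e.Legal s σ ∧ f.Legal s σ
  | mul e f => e.Legal s σ ∧ f.Legal s σ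
  | div e f => e.Legal s σ ∧ f.Legal s σ ∧ f.eval σ ≠ 0
  | sin e => e.Legal s σ
  | cos e => e.Legal s σ
  | arctan e => e.Legal s σ

/-- The time to evaluate a real expression: one unit for each operation. -/
def RExp.cost : RExp → ℕ
  | lit _ => 1
  | load a => a.cost + 1
  | ofInt e => e.cost + 1
  | add e f => e.cost + f.cost + 1
  | sub e f => e.cost + f.cost + 1
  | mul e f => e.cost + f.cost + 1
  | div e f => e.cost + f.cost + 1
  | sin e => e.cost + 1
  | cos e => e.cost + 1
  | arctan e => e.cost + 1

/-- The outcome of a test. -/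
def Test.Holds (σ : State) : Test → Prop
  | ilt e f => e.eval σ < f.eval σ
  | rlt e f => e.eval σ < f.eval σ
  | not c => ¬ c.Holds σ
  | and c d => c.Holds σ ∧ d.Holds σ

/-- The test is legal on a machine of size `s`; the second part of a conjunction is evaluated only
if the first one holds. -/
def Test.Legal (s : ℕ) (σ : State) : Test → Prop
  | ilt e f => e.Legal s σ ∧ f.Legal s σ
  | rlt e f => e.Legal s σ ∧ f.Legal s σ
  | not c => c.Legal s σ
  | and c d => c.Legal s σ ∧ (c.Holds σ → d.Legal s σ)

/-- The time charged for a test. -/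
def Test.cost : Test → ℕ
  | ilt e f => e.cost + f.cost + 1
  | rlt e f => e.cost + f.cost + 1
  | not c => c.cost + 1
  | and c d => c.cost + d.cost + 1

/-- `Exec s p σ t σ'`: on a machine of size `s`, the program `p` started in the state `σ` halts
after `t` units of time in the state `σ'`, and all its operations are legal. -/
inductive Exec (s : ℕ) : Prog → State → ℕ → State → Prop
  | skip (σ : State) : Exec s .skip σ 1 σ
  | storeInt (σ : State) (a e : IExp) (ha : a.Legal s σ) (he : e.Legal s σ) :
      Exec s (.storeInt a e) σ (a.cost + e.cost + 1)
        { σ with int := Function.update σ.int (a.eval σ) (e.eval σ) }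
  | storeReal (σ : State) (a : IExp) (e : RExp) (ha : a.Legal s σ) (he : e.Legal s σ) :
      Exec s (.storeReal a e) σ (a.cost + e.cost + 1)
        { σ with real := Function.update σ.real (a.eval σ) (e.eval σ) }
  | seq {p q : Prog} {σ τ υ : State} {t u : ℕ} (hp : Exec s p σ t τ) (hq : Exec s q τ u υ) :
      Exec s (.seq p q) σ (t + u) υ
  | iteTrue {c : Test} {p q : Prog} {σ τ : State} {t : ℕ} (hl : c.Legal s σ) (hc : c.Holds σ)
      (hp : Exec s p σ t τ) : Exec s (.ite c p q) σ (c.cost + t) τ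
  | iteFalse {c : Test} {p q : Prog} {σ τ : State} {t : ℕ} (hl : c.Legal s σ) (hc : ¬ c.Holds σ)
      (hq : Exec s q σ t τ) : Exec s (.ite c p q) σ (c.cost + t) τ
  | whileTrue {c : Test} {p : Prog} {σ τ υ : State} {t u : ℕ} (hl : c.Legal s σ)
      (hc : c.Holds σ) (hp : Exec s p σ t τ) (hw : Exec s (.while c p) τ u υ) :
      Exec s (.while c p) σ (c.cost + t + u) υ
  | whileFalse {c : Test} {p : Prog} {σ : State} (hl : c.Legal s σ) (hc : ¬ c.Holds σ) :
      Exec s (.while c p) σ c.cost σ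

end RealRAM

open RealRAM

/-! ## Input and output -/

/-- The real part of the input: the direction `φ` of a line, followed by the coordinates of the
red points and then of the blue points. -/
def inputReals (φ : ℝ) (r b : List Plane) : List ℝ :=
  φ :: (r ++ b).flatMap fun p => [p.1, p.2]

/-- The initial state: the integer cells `0` and `1` hold the numbers of red and blue points, the
first real cells hold `inputReals φ r b`, and all other cells hold zero. -/
def inputState (φ : ℝ) (r b : List Plane) : State where
  int := fun i => if i = 0 then r.length else if i = 1 then b.length else 0
  real := fun i => (inputReals φ r b).getD i 0

/-- The state `σ` of a machine of size `s` lists the maximal intervals of `A ⊆ [0, 2π)`: the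
integer cell `0` holds their number `m`, and the real cells `2 i` and `2 i + 1`, for `i < m`, hold
the endpoints of the `i`-th one.  These are pairwise disjoint closed intervals, possibly reduced to
a point, in increasing order; right endpoint `2π` stands for an interval `[a, 2π)`. -/
def ReportsIntervals (s : ℕ) (σ : State) (A : Set ℝ) : Prop :=
  2 * σ.int 0 ≤ s ∧
  (∀ i < σ.int 0, 0 ≤ σ.real (2 * i) ∧ σ.real (2 * i) ≤ σ.real (2 * i + 1) ∧
    σ.real (2 * i) < 2 * π ∧ σ.real (2 * i + 1) ≤ 2 * π) ∧
  (∀ i, i + 1 < σ.int 0 → σ.real (2 * i + 1) < σ.real (2 * (i + 1))) ∧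
  A = {θ | θ ∈ Ico 0 (2 * π) ∧ ∃ i < σ.int 0, θ ∈ Icc (σ.real (2 * i)) (σ.real (2 * i + 1))}

end

open RealRAM

set_option linter.constructorNameAsVariable false

/-! ## A structured language on top of the real RAM

Programs are written in a small language with named scalars and arrays, which is compiled to
real RAM programs.  All integer values are less than a bound `N`, and so are all array indices. -/

namespace Structured

/-! Geometry. A blue point `b` avoids the interior of the hull iff it lies in the closure of the
union of the free quadrants, and this holds iff one of the four quadrants with vertex `b` is free.
Indeed, if each of the four contained a red point, the same four red points would block every
quadrant that reaches a point near `b`, because membership in a wedge is an open condition on its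
vertex and wedges nest (`isFree_rectHull_iff`).

Fix `b` and the frame rotated by `φ + k π/2`. For `α` in `[0, π/2]` the quadrant of direction `α` at
`b` misses all red points when those in the right half plane have angle at most `α` and those in the
left half plane, after a reflection, have angle at most `π/2 - α`. The free `α` thus fill a closed,
possibly empty interval from `lowEnd` to `highEnd`, whose ends come from two maxima of `clipAngle`
(`freeAt_of_mem`, `mem_of_freeAt`). A turn by `π/2` permutes the quadrants, so the admissible `θ`
for `b` are the four intervals repeated with period `π/2` (`inPeriodic_iff`).

Computing the maxima. Each maximum is the direction of an upper tangent from `b` to the red points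
ahead of it. Eight passes (four frames, two reflections) each sweep the points by decreasing first
coordinate and keep a convex chain of the red points seen. Along the chain the directions from a new
point first rise weakly and then fall (`Chain.anti'`), so binary search finds the tangent point,
which is maximal among all red points seen (`Chain.max_of_tangent'`). A new red point replaces
everything on the chain beyond its tangent point (`Chain.insert`). A pass takes `O(n log n)` time,
including a sort by a tournament tree (`sort_runs`).

Assembling the answer. The inadmissible angles of a blue point are open gaps, each beginning at some
`highEnd`. Four possible beginnings and six shifts by multiples of `π/2` suffice to cover those in
`[0, 2π)`, which gives 24 intervals per blue point (`exists_mem_gap_iff`). All of them are sorted by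
left endpoint, and a linear scan writes the complement of their union (`OutInv.emit`,
`OutInv.skip`).

The machine. The program is written in a small language with named arrays whose compilation is
proved correct once, as part of a Hoare logic with time bounds and frame conditions (`Runs.of_wp`,
`Halts.seq`, `Halts.loop`). Then `program_exec` gives correctness and the explicit bounds, and
`isBigO_timeBound` and `isBigO_space` give their growth. -/

/-- Integer variables. -/
inductive IVar where
  | m | nB | nR | n | i | j | e | c | v | w | top | lo | hi | mid | p | g | k | h
  deriving DecidableEq

/-- Integer arrays. -/
inductive IArr where
  | ord | tree | stk
  deriving DecidableEq

/-- Real variables. -/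
inductive RVar where
  | phi | hp | psi | cs | sn | sg | dx | dy | x | y | l | r | nx | ok | cur
  deriving DecidableEq

/-- Real arrays; `io` is the memory region for input and output. -/
inductive RArr where
  | io | px | py | fx | fy | key | tie | ang
  deriving DecidableEq

/-- The integer cell of a variable; cell `2` is reserved. -/
def IVar.code : IVar → ℕ
  | m => 0 | nB => 1 | nR => 3 | n => 4 | i => 5 | j => 6 | e => 7 | c => 8 | v => 9 | w => 10
  | top => 11 | lo => 12 | hi => 13 | mid => 14 | p => 15 | g => 16 | k => 17 | h => 18

/-- The column of an integer array. -/
def IArr.code : IArr → ℕ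
  | ord => 0 | tree => 1 | stk => 2

/-- The row of a real variable. -/
def RVar.code : RVar → ℕ
  | phi => 0 | hp => 1 | psi => 2 | cs => 3 | sn => 4 | sg => 5 | dx => 6 | dy => 7 | x => 8
  | y => 9 | l => 10 | r => 11 | nx => 12 | ok => 13 | cur => 14

/-- The column of a real array. -/
def RArr.code : RArr → ℕ
  | io => 0 | px => 1 | py => 2 | fx => 3 | fy => 4 | key => 5 | tie => 6 | ang => 7

theorem IVar.code_inj {a b : IVar} : a.code = b.code ↔ a = b := by
  constructor
  · cases a <;> cases b <;> simp [code]
  · rintro rfl; rfl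

theorem IVar.code_lt (a : IVar) : a.code < 40 := by cases a <;> simp [code]

theorem IVar.code_ne_two (a : IVar) : a.code ≠ 2 := by cases a <;> simp [code]

theorem IArr.code_inj {a b : IArr} : a.code = b.code ↔ a = b := by
  constructor
  · cases a <;> cases b <;> simp [code]
  · rintro rfl; rfl

theorem IArr.code_lt (a : IArr) : a.code < 4 := by cases a <;> simp [code]

theorem RVar.code_inj {a b : RVar} : a.code = b.code ↔ a = b := by
  constructor
  · cases a <;> cases b <;> simp [code]
  · rintro rfl; rfl

theorem RVar.code_lt (a : RVar) : a.code < 15 := by cases a <;> simp [code]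

theorem RArr.code_inj {a b : RArr} : a.code = b.code ↔ a = b := by
  constructor
  · cases a <;> cases b <;> simp [code]
  · rintro rfl; rfl

theorem RArr.code_lt (a : RArr) : a.code < 15 := by cases a <;> simp [code]

/-- The contents of the variables and arrays. -/
structure Store where
  iv : IVar → ℕ
  ia : IArr → ℕ → ℕ
  rv : RVar → ℝ
  ra : RArr → ℕ → ℝ

namespace Store

/-- Assignment to an integer variable. -/
def setI (σ : Store) (v : IVar) (k : ℕ) : Store := { σ with iv := Function.update σ.iv v k }

/-- Assignment to an integer array cell. -/
def putI (σ : Store) (a : IArr) (i k : ℕ) : Store :=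
  { σ with ia := Function.update σ.ia a (Function.update (σ.ia a) i k) }

/-- Assignment to a real variable. -/
def setR (σ : Store) (v : RVar) (x : ℝ) : Store := { σ with rv := Function.update σ.rv v x }

/-- Assignment to a real array cell. -/
def putR (σ : Store) (a : RArr) (i : ℕ) (x : ℝ) : Store :=
  { σ with ra := Function.update σ.ra a (Function.update (σ.ra a) i x) }

variable (σ : Store) (v w : IVar) (a b : IArr) (x y : RVar) (c d : RArr) (i j k : ℕ) (u : ℝ)

theorem iv_setI : (σ.setI v k).iv w = if w = v then k else σ.iv w := by
  simp [setI, Function.update_apply]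
theorem iv_putI : (σ.putI a i k).iv = σ.iv := rfl
theorem iv_setR : (σ.setR x u).iv = σ.iv := rfl
theorem iv_putR : (σ.putR c i u).iv = σ.iv := rfl
theorem ia_setI : (σ.setI v k).ia = σ.ia := rfl
theorem ia_putI :
    (σ.putI a i k).ia b j = if b = a then (if j = i then k else σ.ia b j) else σ.ia b j := by
  by_cases h : b = a
  · subst h; simp [putI, Function.update_apply]
  · simp [putI, h]
theorem rv_setI : (σ.setI v k).rv = σ.rv := rfl
theorem rv_setR : (σ.setR x u).rv y = if y = x then u else σ.rv y := by
  simp [setR, Function.update_apply]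
theorem rv_putR : (σ.putR c i u).rv = σ.rv := rfl
theorem ra_setI : (σ.setI v k).ra = σ.ra := rfl
theorem ra_setR : (σ.setR x u).ra = σ.ra := rfl
theorem ra_putR :
    (σ.putR c i u).ra d j = if d = c then (if j = i then u else σ.ra d j) else σ.ra d j := by
  by_cases h : d = c
  · subst h; simp [putR, Function.update_apply]
  · simp [putR, h]

end Store

/-- Integer expressions. -/
inductive IE where
  | lit (k : ℕ)
  | var (v : IVar)
  | get (a : IArr) (e : IE)
  | add (e f : IE)
  | sub (e f : IE)
  | mul (e f : IE)
  | div (e f : IE)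

/-- Real expressions. -/
inductive RE where
  | lit (k : ℤ)
  | var (v : RVar)
  | get (a : RArr) (e : IE)
  | ofInt (e : IE)
  | add (e f : RE)
  | sub (e f : RE)
  | mul (e f : RE)
  | div (e f : RE)
  | sin (e : RE)
  | cos (e : RE)
  | arctan (e : RE)

/-- Tests. -/
inductive TE where
  | ilt (e f : IE)
  | rlt (e f : RE)
  | not (c : TE)
  | and (c d : TE)

/-- Commands. -/
inductive Cmd where
  | skip
  | setI (v : IVar) (e : IE)
  | putI (a : IArr) (i e : IE)
  | setR (v : RVar) (e : RE)
  | putR (a : RArr) (i : IE) (e : RE)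
  | seq (p q : Cmd)
  | ite (c : TE) (p q : Cmd)
  | loop (c : TE) (p : Cmd)

/-! ### Semantics of expressions -/

/-- The value of an integer expression. -/
def IE.eval (σ : Store) : IE → ℕ
  | lit k => k
  | var v => σ.iv v
  | get a e => σ.ia a (e.eval σ)
  | add e f => e.eval σ + f.eval σ
  | sub e f => e.eval σ - f.eval σ
  | mul e f => e.eval σ * f.eval σ
  | div e f => e.eval σ / f.eval σ

/-- All values that occur are less than `N`. -/
def IE.Legal (N : ℕ) (σ : Store) : IE → Prop
  | lit k => k < N
  | var v => σ.iv v < N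
  | get a e => e.Legal N σ ∧ σ.ia a (e.eval σ) < N
  | add e f => e.Legal N σ ∧ f.Legal N σ ∧ e.eval σ + f.eval σ < N
  | sub e f => e.Legal N σ ∧ f.Legal N σ
  | mul e f => e.Legal N σ ∧ f.Legal N σ ∧ e.eval σ * f.eval σ < N
  | div e f => e.Legal N σ ∧ f.Legal N σ ∧ f.eval σ ≠ 0

theorem IE.Legal.eval_lt {N : ℕ} {σ : Store} {e : IE} (h : e.Legal N σ) : e.eval σ < N := by
  induction e with
  | lit k => exact h
  | var v => exact h
  | get a e => exact h.2
  | add e f => exact h.2.2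
  | sub e f ihe _ => exact lt_of_le_of_lt (Nat.sub_le _ _) (ihe h.1)
  | mul e f => exact h.2.2
  | div e f ihe _ => exact lt_of_le_of_lt (Nat.div_le_self _ _) (ihe h.1)

/-- The value of a real expression. -/
noncomputable def RE.eval (σ : Store) : RE → ℝ
  | lit k => (k : ℝ)
  | var v => σ.rv v
  | get a e => σ.ra a (e.eval σ)
  | ofInt e => (e.eval σ : ℝ)
  | add e f => e.eval σ + f.eval σ
  | sub e f => e.eval σ - f.eval σ
  | mul e f => e.eval σ * f.eval σ
  | div e f => e.eval σ / f.eval σ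
  | sin e => Real.sin (e.eval σ)
  | cos e => Real.cos (e.eval σ)
  | arctan e => Real.arctan (e.eval σ)

/-- All integer values that occur are less than `N`, and there is no division by zero. -/
def RE.Legal (N : ℕ) (σ : Store) : RE → Prop
  | lit _ => True
  | var _ => True
  | get _ e => e.Legal N σ
  | ofInt e => e.Legal N σ
  | add e f => e.Legal N σ ∧ f.Legal N σ
  | sub e f => e.Legal N σ ∧ f.Legal N σ
  | mul e f => e.Legal N σ ∧ f.Legal N σ
  | div e f => e.Legal N σ ∧ f.Legal N σ ∧ f.eval σ ≠ 0
  | sin e => e.Legal N σ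
  | cos e => e.Legal N σ
  | arctan e => e.Legal N σ

/-- The outcome of a test. -/
def TE.Holds (σ : Store) : TE → Prop
  | ilt e f => e.eval σ < f.eval σ
  | rlt e f => e.eval σ < f.eval σ
  | not c => ¬ c.Holds σ
  | and c d => c.Holds σ ∧ d.Holds σ

/-- All operations in the evaluation of a test are legal. -/
def TE.Legal (N : ℕ) (σ : Store) : TE → Prop
  | ilt e f => e.Legal N σ ∧ f.Legal N σ
  | rlt e f => e.Legal N σ ∧ f.Legal N σ
  | not c => c.Legal N σ
  | and c d => c.Legal N σ ∧ d.Legal N σ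

/-! ### Compilation -/

/-- Compilation of integer expressions. -/
def IE.comp : IE → IExp
  | lit k => .lit k
  | var v => .load (.lit v.code)
  | get a e => .load (.add (.mul (.lit 4) e.comp) (.lit (40 + a.code)))
  | add e f => .add e.comp f.comp
  | sub e f => .sub e.comp f.comp
  | mul e f => .mul e.comp f.comp
  | div e f => .div e.comp f.comp

/-- The address of a cell of a real array. -/
def RArr.addr (a : RArr) (e : IE) : IExp :=
  match a with
  | io => e.comp
  | a => .add (.load (.lit 2)) (.add (.mul (.lit 16) e.comp) (.lit a.code))

/-- The address of a real variable. -/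
def RVar.addr (v : RVar) : IExp := .add (.load (.lit 2)) (.lit (16 * v.code + 15))

/-- Compilation of real expressions. -/
def RE.comp : RE → RExp
  | lit k => .lit k
  | var v => .load v.addr
  | get a e => .load (a.addr e)
  | ofInt e => .ofInt e.comp
  | add e f => .add e.comp f.comp
  | sub e f => .sub e.comp f.comp
  | mul e f => .mul e.comp f.comp
  | div e f => .div e.comp f.comp
  | sin e => .sin e.comp
  | cos e => .cos e.comp
  | arctan e => .arctan e.comp

/-- Compilation of tests. -/
def TE.comp : TE → Test
  | ilt e f => .ilt e.comp f.comp
  | rlt e f => .rlt e.comp f.comp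
  | not c => .not c.comp
  | and c d => .and c.comp d.comp

/-- Compilation of commands. -/
def Cmd.comp : Cmd → Prog
  | skip => .skip
  | setI v e => .storeInt (.lit v.code) e.comp
  | putI a i e => .storeInt (.add (.mul (.lit 4) i.comp) (.lit (40 + a.code))) e.comp
  | setR v e => .storeReal v.addr e.comp
  | putR a i e => .storeReal (a.addr i) e.comp
  | seq p q => .seq p.comp q.comp
  | ite c p q => .ite c.comp p.comp q.comp
  | loop c p => .while c.comp p.comp

/-- The store that a state of the machine represents. -/
noncomputable def view (N : ℕ) (ρ : State) : Store where
  -- Integer scalars lie below cell 40, followed by arrays interleaved with stride 4. Real cells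
  -- below `N` are for input and output; above them are 16 interleaved columns, the last of which
  -- holds the real scalars.
  iv v := ρ.int v.code
  ia a i := ρ.int (40 + 4 * i + a.code)
  rv v := ρ.real (N + 16 * v.code + 15)
  -- The value 0 from index `N` on keeps the columns disjoint: otherwise the view of `io` would
  -- overlap the other real arrays.
  ra a i := if a = .io then (if i < N then ρ.real i else 0) else ρ.real (N + 16 * i + a.code)

theorem IE.comp_eval (N : ℕ) (ρ : State) (e : IE) : e.comp.eval ρ = e.eval (view N ρ) := by
  induction e with
  | get a e ih => simp [comp, IExp.eval, eval, view, ih]; congr 1; ring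
  | _ => simp_all [comp, IExp.eval, eval, view]

/-- Indices below `N` give integer array addresses of at most `4 (N - 1) + 43`, so all addresses and
intermediate values stay below `20 N`. -/
theorem IE.comp_legal {N : ℕ} (hN : 100 ≤ N) (ρ : State) (e : IE) (h : e.Legal N (view N ρ)) :
    e.comp.Legal (20 * N) ρ := by
  induction e with
  | lit k => simp only [Legal] at h; simp only [comp, IExp.Legal]; omega
  | var v =>
    have := v.code_lt
    simp only [Legal, view] at h
    simp only [comp, IExp.Legal, IExp.eval]; omega
  | get a e ih =>
    have h1 := ih h.1
    have h2 := h.1.eval_lt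
    have h3 : ρ.int (4 * e.eval (view N ρ) + (40 + a.code)) < N := by
      have := h.2
      rw [show 4 * e.eval (view N ρ) + (40 + a.code) = 40 + 4 * e.eval (view N ρ) + a.code by ring]
      exact this
    have := a.code_lt
    simp only [comp, IExp.Legal, IExp.eval, comp_eval N]
    exact ⟨⟨⟨by omega, h1, by omega⟩, by omega, by omega⟩, by omega⟩
  | add e f ihe ihf =>
    have := h.2.2
    simp only [comp, IExp.Legal, comp_eval N]
    exact ⟨ihe h.1, ihf h.2.1, by omega⟩
  | sub e f ihe ihf => exact ⟨ihe h.1, ihf h.2⟩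
  | mul e f ihe ihf =>
    have := h.2.2
    simp only [comp, IExp.Legal, comp_eval N]
    exact ⟨ihe h.1, ihf h.2.1, by omega⟩
  | div e f ihe ihf =>
    simp only [comp, IExp.Legal, comp_eval N]
    exact ⟨ihe h.1, ihf h.2.1, h.2.2⟩

theorem RVar.addr_eval {N : ℕ} {ρ : State} (h2 : ρ.int 2 = N) (v : RVar) :
    v.addr.eval ρ = N + 16 * v.code + 15 := by
  simp only [addr, IExp.eval, h2]; ring

theorem RVar.addr_legal {N : ℕ} (hN : 100 ≤ N) {ρ : State} (h2 : ρ.int 2 = N) (v : RVar) :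
    v.addr.Legal (20 * N) ρ := by
  have := v.code_lt
  simp only [addr, IExp.Legal, IExp.eval, h2]; omega

theorem RArr.addr_eval {N : ℕ} {ρ : State} (h2 : ρ.int 2 = N) (a : RArr) (e : IE) :
    (a.addr e).eval ρ =
      if a = .io then e.eval (view N ρ) else N + 16 * e.eval (view N ρ) + a.code := by
  cases a <;> simp [addr, IExp.eval, h2, IE.comp_eval N, code] <;> ring

/-- The largest address in a column is at most `N + 16 (N - 1) + 14`, which is the reason for the
machine size `20 N`. -/
theorem RArr.addr_legal {N : ℕ} (hN : 100 ≤ N) {ρ : State} (h2 : ρ.int 2 = N) (a : RArr) (e : IE)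
    (he : e.Legal N (view N ρ)) : (a.addr e).Legal (20 * N) ρ := by
  have h1 := e.comp_legal hN ρ he
  have h3 := he.eval_lt
  cases a <;> simp only [addr, IExp.Legal, IExp.eval, h2, IE.comp_eval N, code] <;>
    first
    | exact h1
    | exact ⟨⟨by omega, by omega⟩, ⟨⟨by omega, h1, by omega⟩, by omega, by omega⟩, by omega⟩

/-- Legality matters for correctness here: for an `io` index of `N` or more, the machine would read
a cell of another column while the view gives 0. -/
theorem RE.comp_eval {N : ℕ} {ρ : State} (h2 : ρ.int 2 = N) (e : RE) (h : e.Legal N (view N ρ)) :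
    e.comp.eval ρ = e.eval (view N ρ) := by
  induction e with
  | lit k => rfl
  | var v => simp [comp, RExp.eval, RVar.addr_eval h2, eval, view]
  | get a e =>
    have : e.eval (view N ρ) < N := IE.Legal.eval_lt h
    simp only [comp, RExp.eval, RArr.addr_eval h2, eval]
    by_cases ha : a = .io <;> simp [ha, view]
    simp [view] at this
    simp [this]
  | ofInt e => simp [comp, RExp.eval, eval, IE.comp_eval N]
  | div e f ihe ihf => simp [comp, RExp.eval, eval, ihe h.1, ihf h.2.1]
  | sin e ih => simp [comp, RExp.eval, eval, ih h]
  | cos e ih => simp [comp, RExp.eval, eval, ih h]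
  | arctan e ih => simp [comp, RExp.eval, eval, ih h]
  | _ e f ihe ihf => simp [comp, RExp.eval, eval, ihe h.1, ihf h.2]

theorem RE.comp_legal {N : ℕ} (hN : 100 ≤ N) {ρ : State} (h2 : ρ.int 2 = N) (e : RE)
    (h : e.Legal N (view N ρ)) : e.comp.Legal (20 * N) ρ := by
  induction e with
  | lit k => trivial
  | var v => exact v.addr_legal hN h2
  | get a e => exact a.addr_legal hN h2 e h
  | ofInt e => exact e.comp_legal hN ρ h
  | div e f ihe ihf =>
    exact ⟨ihe h.1, ihf h.2.1, by rw [RE.comp_eval h2 f h.2.1]; exact h.2.2⟩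
  | sin e ih => exact ih h
  | cos e ih => exact ih h
  | arctan e ih => exact ih h
  | _ e f ihe ihf => exact ⟨ihe h.1, ihf h.2⟩

theorem TE.comp_holds {N : ℕ} {ρ : State} (h2 : ρ.int 2 = N) (c : TE) (h : c.Legal N (view N ρ)) :
    c.comp.Holds ρ ↔ c.Holds (view N ρ) := by
  induction c with
  | ilt e f => simp [comp, Test.Holds, Holds, IE.comp_eval N]
  | rlt e f => simp [comp, Test.Holds, Holds, RE.comp_eval h2 _ h.1, RE.comp_eval h2 _ h.2]
  | not c ih => simp [comp, Test.Holds, Holds, ih h]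
  | and c d ihc ihd => simp [comp, Test.Holds, Holds, ihc h.1, ihd h.2]

theorem TE.comp_legal {N : ℕ} (hN : 100 ≤ N) {ρ : State} (h2 : ρ.int 2 = N) (c : TE)
    (h : c.Legal N (view N ρ)) : c.comp.Legal (20 * N) ρ := by
  induction c with
  | ilt e f => exact ⟨e.comp_legal hN ρ h.1, f.comp_legal hN ρ h.2⟩
  | rlt e f => exact ⟨e.comp_legal hN h2 h.1, f.comp_legal hN h2 h.2⟩
  | not c ih => exact ih h
  | and c d ihc ihd => exact ⟨ihc h.1, fun _ => ihd h.2⟩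

/-! ### Effect of the stores -/

theorem view_setI {N : ℕ} (ρ : State) (v : IVar) (k : ℕ) :
    view N { ρ with int := Function.update ρ.int v.code k } = (view N ρ).setI v k := by
  have := v.code_lt
  simp only [view, Store.setI, Store.mk.injEq, and_true]
  refine ⟨?_, ?_⟩
  · ext w
    by_cases h : w = v
    · simp [h]
    · simp [h, IVar.code_inj]
  · ext a i
    rw [Function.update_of_ne (by omega)]

theorem view_putI {N : ℕ} (ρ : State) (a : IArr) (i k : ℕ) :
    view N { ρ with int := Function.update ρ.int (4 * i + (40 + a.code)) k } =
      (view N ρ).putI a i k := by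
  have ha := a.code_lt
  simp only [view, Store.putI, Store.mk.injEq, and_true]
  refine ⟨?_, ?_⟩
  · ext w
    have := w.code_lt
    rw [Function.update_of_ne (by omega)]
  · ext b j
    have hb := b.code_lt
    by_cases h : b = a
    · subst h
      by_cases hj : j = i
      · subst hj; simp [Function.update_apply]; omega
      · simp [Function.update_apply, hj]; omega
    · have : b.code ≠ a.code := fun h' => h (IArr.code_inj.1 h')
      rw [Function.update_of_ne h, Function.update_of_ne (by omega)]

theorem view_setR {N : ℕ} (ρ : State) (v : RVar) (x : ℝ) :
    view N { ρ with real := Function.update ρ.real (N + 16 * v.code + 15) x } =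
      (view N ρ).setR v x := by
  simp only [view, Store.setR, Store.mk.injEq, true_and]
  refine ⟨?_, ?_⟩
  · ext w
    by_cases h : w = v
    · simp [h]
    · have : w.code ≠ v.code := fun h' => h (RVar.code_inj.1 h')
      rw [Function.update_of_ne h, Function.update_of_ne (by omega)]
  · ext a i
    have ha := a.code_lt
    split_ifs
    · rw [Function.update_of_ne (by omega)]
    · rfl
    · rw [Function.update_of_ne (by omega)]

theorem view_putR {N : ℕ} (ρ : State) (a : RArr) (i : ℕ) (hi : i < N) (x : ℝ) :
    view N { ρ with real := Function.update ρ.real (if a = .io then i else N + 16 * i + a.code) x } =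
      (view N ρ).putR a i x := by
  have ha := a.code_lt
  simp only [view, Store.putR, Store.mk.injEq, true_and]
  refine ⟨?_, ?_⟩
  · ext w
    rw [Function.update_of_ne]
    split_ifs <;> omega
  · ext b j
    have hb := b.code_lt
    by_cases h : b = a
    · subst h
      rw [Function.update_self]
      by_cases hj : j = i
      · subst hj; split_ifs <;> simp
      · rw [Function.update_of_ne hj]
        split_ifs
        · rw [Function.update_of_ne hj]
        · rfl
        · rw [Function.update_of_ne (by omega)]
    · have : b.code ≠ a.code := fun h' => h (RArr.code_inj.1 h')
      rw [Function.update_of_ne h]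
      split_ifs with h1 h2 h3
      · exact absurd (h1.trans h3.symm) h
      · rw [Function.update_of_ne (by omega)]
      · rfl
      · rw [Function.update_of_ne (by omega)]
      · rw [Function.update_of_ne (by omega)]

/-! ### Program logic -/

/-- The command assigns to the integer variable. -/
def Cmd.setsI (v : IVar) : Cmd → Bool
  | setI w _ => w = v
  | seq p q => p.setsI v || q.setsI v
  | ite _ p q => p.setsI v || q.setsI v
  | loop _ p => p.setsI v
  | _ => false

/-- The command assigns to the integer array. -/
def Cmd.putsI (a : IArr) : Cmd → Bool
  | putI b _ _ => b = a
  | seq p q => p.putsI a || q.putsI a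
  | ite _ p q => p.putsI a || q.putsI a
  | loop _ p => p.putsI a
  | _ => false

/-- The command assigns to the real variable. -/
def Cmd.setsR (v : RVar) : Cmd → Bool
  | setR w _ => w = v
  | seq p q => p.setsR v || q.setsR v
  | ite _ p q => p.setsR v || q.setsR v
  | loop _ p => p.setsR v
  | _ => false

/-- The command assigns to the real array. -/
def Cmd.putsR (a : RArr) : Cmd → Bool
  | putR b _ _ => b = a
  | seq p q => p.putsR a || q.putsR a
  | ite _ p q => p.putsR a || q.putsR a
  | loop _ p => p.putsR a
  | _ => false

/-- The stores agree on everything to which the command does not assign. -/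
structure Frame (p : Cmd) (σ τ : Store) : Prop where
  iv : ∀ v, p.setsI v = false → τ.iv v = σ.iv v
  ia : ∀ a, p.putsI a = false → τ.ia a = σ.ia a
  rv : ∀ v, p.setsR v = false → τ.rv v = σ.rv v
  ra : ∀ a, p.putsR a = false → τ.ra a = σ.ra a

theorem Frame.refl (p : Cmd) (σ : Store) : Frame p σ σ :=
  ⟨fun _ _ => rfl, fun _ _ => rfl, fun _ _ => rfl, fun _ _ => rfl⟩

theorem Frame.trans {p : Cmd} {σ τ υ : Store} (h : Frame p σ τ) (h' : Frame p τ υ) :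
    Frame p σ υ :=
  ⟨fun v hv => (h'.iv v hv).trans (h.iv v hv), fun v hv => (h'.ia v hv).trans (h.ia v hv),
    fun v hv => (h'.rv v hv).trans (h.rv v hv), fun v hv => (h'.ra v hv).trans (h.ra v hv)⟩

theorem Frame.mono {p q : Cmd} {σ τ : Store} (h : Frame p σ τ)
    (h1 : ∀ v, q.setsI v = false → p.setsI v = false)
    (h2 : ∀ v, q.putsI v = false → p.putsI v = false)
    (h3 : ∀ v, q.setsR v = false → p.setsR v = false)
    (h4 : ∀ v, q.putsR v = false → p.putsR v = false) : Frame q σ τ :=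
  ⟨fun v hv => h.iv v (h1 v hv), fun v hv => h.ia v (h2 v hv),
    fun v hv => h.rv v (h3 v hv), fun v hv => h.ra v (h4 v hv)⟩

theorem Frame.seq_left {p q : Cmd} {σ τ : Store} (h : Frame p σ τ) : Frame (.seq p q) σ τ := by
  apply h.mono <;> intro v hv <;>
    simp only [Cmd.setsI, Cmd.putsI, Cmd.setsR, Cmd.putsR, Bool.or_eq_false_iff] at hv <;>
    exact hv.1

theorem Frame.seq_right {p q : Cmd} {σ τ : Store} (h : Frame q σ τ) : Frame (.seq p q) σ τ := by
  apply h.mono <;> intro v hv <;>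
    simp only [Cmd.setsI, Cmd.putsI, Cmd.setsR, Cmd.putsR, Bool.or_eq_false_iff] at hv <;>
    exact hv.2

theorem Frame.ite_left {c : TE} {p q : Cmd} {σ τ : Store} (h : Frame p σ τ) :
    Frame (.ite c p q) σ τ := by
  apply h.mono <;> intro v hv <;>
    simp only [Cmd.setsI, Cmd.putsI, Cmd.setsR, Cmd.putsR, Bool.or_eq_false_iff] at hv <;>
    exact hv.1

theorem Frame.ite_right {c : TE} {p q : Cmd} {σ τ : Store} (h : Frame q σ τ) :
    Frame (.ite c p q) σ τ := by
  apply h.mono <;> intro v hv <;>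
    simp only [Cmd.setsI, Cmd.putsI, Cmd.setsR, Cmd.putsR, Bool.or_eq_false_iff] at hv <;>
    exact hv.2

theorem Frame.loop {c : TE} {p : Cmd} {σ τ : Store} (h : Frame p σ τ) :
    Frame (.loop c p) σ τ := by
  apply h.mono <;> intro v hv <;>
    simpa only [Cmd.setsI, Cmd.putsI, Cmd.setsR, Cmd.putsR] using hv

/-- The command, started in the store `σ` on a machine with bound `N`, halts within time `t` in a
store that satisfies `Q`. -/
def Runs (N : ℕ) (p : Cmd) (σ : Store) (t : ℕ) (Q : Store → Prop) : Prop :=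
  100 ≤ N → ∀ ρ : State, ρ.int 2 = N → view N ρ = σ →
    ∃ (t' : ℕ) (ρ' : State), t' ≤ t ∧ Exec (20 * N) p.comp ρ t' ρ' ∧ ρ'.int 2 = N ∧
      Frame p σ (view N ρ') ∧ Q (view N ρ')

/-- The new postcondition may use the frame. Since the sets of assigned names are computed from the
syntax, later claims that a name is unchanged are discharged by `rfl`. -/
theorem Runs.conseq {N : ℕ} {p : Cmd} {σ : Store} {t u : ℕ} {Q Q' : Store → Prop}
    (h : Runs N p σ t Q) (htu : t ≤ u) (hQ : ∀ τ, Frame p σ τ → Q τ → Q' τ) :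
    Runs N p σ u Q' := by
  intro hN ρ h2 hv
  obtain ⟨t', ρ', ht, he, h2', hF, hQ'⟩ := h hN ρ h2 hv
  exact ⟨t', ρ', ht.trans htu, he, h2', hF, hQ _ hF hQ'⟩

theorem Runs.mono {N : ℕ} {p : Cmd} {σ : Store} {t u : ℕ} {Q : Store → Prop}
    (h : Runs N p σ t Q) (htu : t ≤ u) : Runs N p σ u Q :=
  h.conseq htu fun _ _ h => h

theorem Runs.seq {N : ℕ} {p q : Cmd} {σ : Store} {t u : ℕ} {Q : Store → Prop}
    (h : Runs N p σ t fun τ => Frame p σ τ → Runs N q τ u Q) : Runs N (.seq p q) σ (t + u) Q := by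
  intro hN ρ h2 hv
  obtain ⟨t1, ρ1, ht1, he1, h21, hF1, hQ1⟩ := h hN ρ h2 hv
  obtain ⟨t2, ρ2, ht2, he2, h22, hF2, hQ2⟩ := hQ1 hF1 hN ρ1 h21 rfl
  exact ⟨t1 + t2, ρ2, by omega, .seq he1 he2, h22, hF1.seq_left.trans hF2.seq_right, hQ2⟩

theorem Runs.ite {N : ℕ} {c : TE} {p q : Cmd} {σ : Store} {t : ℕ} {Q : Store → Prop}
    (hl : c.Legal N σ) (hp : c.Holds σ → Runs N p σ t Q) (hq : ¬ c.Holds σ → Runs N q σ t Q) :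
    Runs N (.ite c p q) σ (c.comp.cost + t) Q := by
  intro hN ρ h2 hv
  subst hv
  by_cases hc : c.Holds (view N ρ)
  · obtain ⟨t1, ρ1, ht1, he1, h21, hF1, hQ1⟩ := hp hc hN ρ h2 rfl
    exact ⟨_, ρ1, by omega, .iteTrue (c.comp_legal hN h2 hl) ((c.comp_holds h2 hl).2 hc) he1, h21,
      hF1.ite_left, hQ1⟩
  · obtain ⟨t1, ρ1, ht1, he1, h21, hF1, hQ1⟩ := hq hc hN ρ h2 rfl
    exact ⟨_, ρ1, by omega,
      .iteFalse (c.comp_legal hN h2 hl) (fun h => hc ((c.comp_holds h2 hl).1 h)) he1, h21,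
      hF1.ite_right, hQ1⟩

/-- The first argument of the invariant bounds the number of remaining iterations; at 0 the test
must fail. The extra factor 1 pays for the final failing test. -/
theorem Runs.loop {N : ℕ} {c : TE} {p : Cmd} {σ : Store} {t : ℕ} {Q : Store → Prop}
    (I : ℕ → Store → Prop) (k : ℕ) (h0 : I k σ)
    (hstep : ∀ k τ, Frame (.loop c p) σ τ → I k τ → c.Legal N τ ∧
      (c.Holds τ → ∃ k', k = k' + 1 ∧ Runs N p τ t (I k')) ∧ (¬ c.Holds τ → Q τ)) :
    Runs N (.loop c p) σ ((k + 1) * (c.comp.cost + t)) Q := by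
  suffices H : ∀ k τ, Frame (.loop c p) σ τ → I k τ →
      Runs N (.loop c p) τ ((k + 1) * (c.comp.cost + t)) Q from H k σ (Frame.refl _ _) h0
  intro k
  induction k with
  | zero =>
    intro τ hF hI hN ρ h2 hv
    subst hv
    obtain ⟨hl, h1, h3⟩ := hstep 0 _ hF hI
    have hc : ¬ c.Holds (view N ρ) := fun h => by obtain ⟨k', hk, -⟩ := h1 h; omega
    exact ⟨_, ρ, by simp, .whileFalse (c.comp_legal hN h2 hl)
      (fun h => hc ((c.comp_holds h2 hl).1 h)), h2, Frame.refl _ _, h3 hc⟩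
  | succ k ih =>
    intro τ hF hI hN ρ h2 hv
    subst hv
    obtain ⟨hl, h1, h3⟩ := hstep _ _ hF hI
    by_cases hc : c.Holds (view N ρ)
    · obtain ⟨k', hk, hr⟩ := h1 hc
      obtain rfl : k = k' := by omega
      obtain ⟨t1, ρ1, ht1, he1, h21, hF1, hQ1⟩ := hr hN ρ h2 rfl
      obtain ⟨t2, ρ2, ht2, he2, h22, hF2, hQ2⟩ := ih _ (hF.trans hF1.loop) hQ1 hN ρ1 h21 rfl
      refine ⟨_, ρ2, ?_, .whileTrue (c.comp_legal hN h2 hl) ((c.comp_holds h2 hl).2 hc) he1 he2,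
        h22, hF1.loop.trans hF2, hQ2⟩
      rw [add_mul, one_mul]; omega
    · refine ⟨_, ρ, ?_, .whileFalse (c.comp_legal hN h2 hl)
        (fun h => hc ((c.comp_holds h2 hl).1 h)), h2, Frame.refl _ _, h3 hc⟩
      rw [add_mul (k + 1)]; omega

/-- The time for one pass through a program, in which all loops and branches are executed once. -/
def _root_.RealRAM.Prog.cost : Prog → ℕ
  | .skip => 1
  | .storeInt a e => a.cost + e.cost + 1
  | .storeReal a e => a.cost + e.cost + 1
  | .seq p q => p.cost + q.cost
  | .ite c p q => c.cost + (p.cost + q.cost)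
  | .while c p => c.cost + p.cost

/-- The weakest precondition of a command without loops. -/
def Cmd.wp (N : ℕ) : Cmd → (Store → Prop) → Store → Prop
  | skip, Q, σ => Q σ
  | setI v e, Q, σ => e.Legal N σ ∧ Q (σ.setI v (e.eval σ))
  | putI a i e, Q, σ => i.Legal N σ ∧ e.Legal N σ ∧ Q (σ.putI a (i.eval σ) (e.eval σ))
  | setR v e, Q, σ => e.Legal N σ ∧ Q (σ.setR v (e.eval σ))
  | putR a i e, Q, σ => i.Legal N σ ∧ e.Legal N σ ∧ Q (σ.putR a (i.eval σ) (e.eval σ))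
  | seq p q, Q, σ => p.wp N (q.wp N Q) σ
  | ite c p q, Q, σ => c.Legal N σ ∧ (c.Holds σ → p.wp N Q σ) ∧ (¬ c.Holds σ → q.wp N Q σ)
  | loop _ _, _, _ => False

/-- Without loops, the static cost, which charges both branches of each conditional, bounds the
running time in every state. -/
theorem Runs.of_wp {N : ℕ} {p : Cmd} {σ : Store} {Q : Store → Prop} (h : p.wp N Q σ) :
    Runs N p σ p.comp.cost Q := by
  induction p generalizing σ Q with
  | skip =>
    rintro hN ρ h2 rfl
    exact ⟨1, ρ, le_rfl, .skip ρ, h2, Frame.refl _ _, h⟩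
  | setI v e =>
    rintro hN ρ h2 rfl
    have hv := v.code_lt
    refine ⟨_, _, le_rfl, .storeInt ρ (.lit v.code) e.comp (by simp only [IExp.Legal]; omega)
      (e.comp_legal hN ρ h.1), ?_, ?_, ?_⟩
    · simp only [IExp.eval]; rw [Function.update_of_ne v.code_ne_two.symm, h2]
    all_goals
      simp only [IExp.eval, IE.comp_eval N, view_setI]
    · refine ⟨fun w hw => ?_, fun _ _ => rfl, fun _ _ => rfl, fun _ _ => rfl⟩
      simp only [Cmd.setsI, decide_eq_false_iff_not] at hw
      simp [Store.setI, Ne.symm hw]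
    · exact h.2
  | putI a i e =>
    rintro hN ρ h2 rfl
    have ha := a.code_lt
    have h3 := h.1.eval_lt
    refine ⟨_, _, le_rfl, .storeInt ρ _ e.comp ?_ (e.comp_legal hN ρ h.2.1), ?_, ?_, ?_⟩
    · simp only [IExp.Legal, IExp.eval, IE.comp_eval N]
      exact ⟨⟨by omega, i.comp_legal hN ρ h.1, by omega⟩, by omega, by omega⟩
    · simp only [IExp.eval]; rw [Function.update_of_ne (by omega), h2]
    all_goals
      simp only [IExp.eval, IE.comp_eval N, view_putI]
    · refine ⟨fun _ _ => rfl, fun w hw => ?_, fun _ _ => rfl, fun _ _ => rfl⟩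
      simp only [Cmd.putsI, decide_eq_false_iff_not] at hw
      simp [Store.putI, Ne.symm hw]
    · exact h.2.2
  | setR v e =>
    rintro hN ρ h2 rfl
    refine ⟨_, _, le_rfl, .storeReal ρ _ _ (v.addr_legal hN h2)
      (e.comp_legal hN h2 h.1), h2, ?_, ?_⟩
    all_goals
      simp only [RVar.addr_eval h2, RE.comp_eval h2 _ h.1, view_setR]
    · refine ⟨fun _ _ => rfl, fun _ _ => rfl, fun w hw => ?_, fun _ _ => rfl⟩
      simp only [Cmd.setsR, decide_eq_false_iff_not] at hw
      simp [Store.setR, Ne.symm hw]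
    · exact h.2
  | putR a i e =>
    rintro hN ρ h2 rfl
    refine ⟨_, _, le_rfl, .storeReal ρ _ _ (a.addr_legal hN h2 i h.1)
      (e.comp_legal hN h2 h.2.1), h2, ?_, ?_⟩
    all_goals
      simp only [RArr.addr_eval h2, RE.comp_eval h2 _ h.2.1, view_putR _ _ _ h.1.eval_lt]
    · refine ⟨fun _ _ => rfl, fun _ _ => rfl, fun _ _ => rfl, fun w hw => ?_⟩
      simp only [Cmd.putsR, decide_eq_false_iff_not] at hw
      simp [Store.putR, Ne.symm hw]
    · exact h.2.2
  | seq p q ihp ihq => exact Runs.seq ((ihp h).conseq le_rfl fun τ _ hτ _ => ihq hτ)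
  | ite c p q ihp ihq =>
    exact Runs.ite h.1 (fun hc => (ihp (h.2.1 hc)).mono (Nat.le_add_right _ _))
      (fun hc => (ihq (h.2.2 hc)).mono (Nat.le_add_left _ _))
  | loop c p => exact h.elim

/-! ### Running times as multiples of the program length -/

/-- Sequential composition of a list of commands. -/
def Cmd.block : List Cmd → Cmd
  | [] => .skip
  | [p] => p
  | p :: q :: l => .seq p (block (q :: l))

/-- The command runs with the values `0, …, c - 1` of the variable `v`. -/
def Cmd.for (v c : IVar) (p : Cmd) : Cmd :=
  .seq (.setI v (.lit 0))
    (.loop (.ilt (.var v) (.var c)) (.seq p (.setI v (.add (.var v) (.lit 1)))))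

/-- The command halts, after a number of steps that is at most `M` times its length, in a store
that satisfies `Q`. -/
def Halts (N : ℕ) (p : Cmd) (σ : Store) (M : ℕ) (Q : Store → Prop) : Prop :=
  Runs N p σ (p.comp.cost * M) Q

theorem Halts.conseq {N : ℕ} {p : Cmd} {σ : Store} {L M : ℕ} {Q Q' : Store → Prop}
    (h : Halts N p σ L Q) (hLM : L ≤ M) (hQ : ∀ τ, Frame p σ τ → Q τ → Q' τ) :
    Halts N p σ M Q' :=
  Runs.conseq h (Nat.mul_le_mul_left _ hLM) hQ

theorem Halts.of_wp {N : ℕ} {p : Cmd} {σ : Store} {Q : Store → Prop} {M : ℕ} (hM : 1 ≤ M)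
    (h : p.wp N Q σ) : Halts N p σ M Q :=
  (Runs.of_wp h).mono (Nat.le_mul_of_pos_right _ hM)

/-- The factor `M` does not grow under composition: the lengths of the two parts add up, and each is
multiplied by the same `M`. Constants are thus absorbed into the length of the program. -/
theorem Halts.seq {N : ℕ} {p q : Cmd} {σ : Store} {M : ℕ} {Q R : Store → Prop}
    (h : Halts N p σ M R) (h' : ∀ τ, Frame p σ τ → R τ → Halts N q τ M Q) :
    Halts N (.seq p q) σ M Q := by
  rw [Halts, Cmd.comp, Prog.cost, add_mul]
  exact Runs.seq (h.conseq le_rfl fun τ hF hR _ => h' τ hF hR)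

theorem Halts.ite {N : ℕ} {c : TE} {p q : Cmd} {σ : Store} {M : ℕ} (hM : 1 ≤ M)
    {Q : Store → Prop} (hl : c.Legal N σ) (hp : c.Holds σ → Halts N p σ M Q)
    (hq : ¬ c.Holds σ → Halts N q σ M Q) : Halts N (.ite c p q) σ M Q := by
  refine (Runs.ite (t := (p.comp.cost + q.comp.cost) * M) hl
    (fun h => (hp h).mono (by gcongr; omega)) (fun h => (hq h).mono (by gcongr; omega))).mono ?_
  rw [Cmd.comp, Prog.cost, add_mul c.comp.cost]
  exact Nat.add_le_add_right (Nat.le_mul_of_pos_right _ hM) _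

theorem Halts.loop {N : ℕ} {c : TE} {p : Cmd} {σ : Store} {L M : ℕ} {Q : Store → Prop}
    (I : ℕ → Store → Prop) (k : ℕ) (hL : 1 ≤ L) (hM : (k + 1) * L ≤ M) (h0 : I k σ)
    (hstep : ∀ k τ, Frame (.loop c p) σ τ → I k τ → c.Legal N τ ∧
      (c.Holds τ → ∃ k', k = k' + 1 ∧ Halts N p τ L (I k')) ∧ (¬ c.Holds τ → Q τ)) :
    Halts N (.loop c p) σ M Q := by
  refine (Runs.loop I k h0 hstep).mono ?_
  calc (k + 1) * (c.comp.cost + p.comp.cost * L)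
      ≤ (k + 1) * (c.comp.cost * L + p.comp.cost * L) := by
        gcongr; exact Nat.le_mul_of_pos_right _ hL
    _ = (c.comp.cost + p.comp.cost) * ((k + 1) * L) := by ring
    _ ≤ _ := Nat.mul_le_mul_left _ hM

/-- The invariant is required after the counter has been updated, hence the `setI` in the
hypotheses. The body may assign neither to the counter nor to its limit. -/
theorem Halts.for {N : ℕ} {v c : IVar} {p : Cmd} {σ : Store} {b L M : ℕ}
    (I : ℕ → Store → Prop) (hL : 1 ≤ L) (hM : (b + 1) * L ≤ M)
    (hvc : v ≠ c) (hv : p.setsI v = false) (hc : p.setsI c = false) (hb : σ.iv c = b)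
    (hbN : b < N) (h0 : I 0 (σ.setI v 0))
    (hstep : ∀ k < b, ∀ τ, Frame (.for v c p) σ τ → τ.iv v = k → I k τ →
      Halts N p τ L fun τ' => I (k + 1) (τ'.setI v (k + 1))) :
    Halts N (.for v c p) σ M (I b) := by
  have hM1 : 1 ≤ M := (Nat.mul_pos (by omega) hL).trans_le hM
  have hvσ : Frame (.for v c p) σ (σ.setI v 0) := by
    refine ⟨fun w hw => ?_, fun _ _ => rfl, fun _ _ => rfl, fun _ _ => rfl⟩
    simp only [Cmd.for, Cmd.setsI, Bool.or_eq_false_iff, decide_eq_false_iff_not] at hw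
    simp [Store.setI, Ne.symm hw.1]
  refine Halts.seq (R := fun τ => τ = σ.setI v 0)
    (Halts.of_wp hM1 ⟨by simp only [IE.Legal]; omega, rfl⟩) ?_
  rintro _ - rfl
  refine Halts.loop (fun k τ => k ≤ b ∧ τ.iv v = b - k ∧ I (b - k) τ) b hL hM ?_ ?_
  · simp [Store.iv_setI, h0]
  · rintro k τ hF ⟨hk, hvk, hI⟩
    have hcb : τ.iv c = b := by
      rw [hF.iv c (by simp [Cmd.setsI, hc, hvc]), Store.iv_setI, if_neg hvc.symm, hb]
    simp only [TE.Legal, IE.Legal, TE.Holds, IE.eval, hvk, hcb]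
    refine ⟨by omega, fun h => ⟨k - 1, by omega, ?_⟩, fun h => ?_⟩
    · refine Halts.seq (hstep (b - k) h τ (hvσ.trans hF.seq_right) hvk hI) ?_
      intro τ' hF' hI'
      have hv' : τ'.iv v = b - k := by rw [hF'.iv v hv, hvk]
      have e : b - (k - 1) = b - k + 1 := by omega
      refine Halts.of_wp hL ⟨by simp only [IE.Legal, IE.eval, hv']; omega, ?_⟩
      simp only [IE.eval, hv', e]
      exact ⟨by omega, by simp [Store.iv_setI], hI'⟩
    · obtain rfl : k = 0 := by omega
      simpa using hI

/-! ### Sorting with a tournament tree -/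

/-- Lexicographic comparison of the indices `a` and `b` by the keys `K`, `T`. -/
def LexLT (K T : ℕ → ℝ) (a b : ℕ) : Prop := K a < K b ∨ K a = K b ∧ T a < T b

/-- The negation of a lexicographic comparison is a total preorder. Working with the negation lets
the tournament handle equal keys. -/
theorem LexLT.not_trans {K T : ℕ → ℝ} {a b c : ℕ} (h : ¬ LexLT K T b a) (h' : ¬ LexLT K T c b) :
    ¬ LexLT K T c a := by
  simp only [LexLT, not_or, not_and, not_lt] at *
  refine ⟨h.1.trans h'.1, fun e => ?_⟩
  have e1 : K b = K a := le_antisymm (e ▸ h'.1) h.1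
  exact (h.2 e1).trans (h'.2 (e.trans e1.symm))

theorem LexLT.asymm {K T : ℕ → ℝ} {a b : ℕ} (h : LexLT K T a b) : ¬ LexLT K T b a := by
  simp only [LexLT, not_or, not_and, not_lt] at *
  rcases h with h | ⟨h, h'⟩
  · exact ⟨h.le, fun e => absurd h (by rw [e]; exact lt_irrefl _)⟩
  · exact ⟨h.le, fun _ => h'.le⟩

/-- The entries of `o` below `c` are a permutation of the numbers below `c` that sorts the keys. -/
structure Sorts (K T : ℕ → ℝ) (c : ℕ) (o : ℕ → ℕ) : Prop where
  lt : ∀ i < c, o i < c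
  inj : ∀ i < c, ∀ j < c, o i = o j → i = j
  sorted : ∀ i j, i < j → j < c → ¬ LexLT K T (o j) (o i)

theorem Sorts.surj {K T : ℕ → ℝ} {c : ℕ} {o : ℕ → ℕ} (h : Sorts K T c o) {w : ℕ} (hw : w < c) :
    ∃ i < c, o i = w := by
  have := Finset.surj_on_of_inj_on_of_card_le (s := Finset.range c) (t := Finset.range c)
    (fun i _ => o i) (fun i hi => by simpa using h.lt i (by simpa using hi))
    (fun i j hi hj e => h.inj i (by simpa using hi) j (by simpa using hj) e) le_rfl w (by simpa)
  obtain ⟨i, hi, e⟩ := this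
  exact ⟨i, by simpa using hi, e.symm⟩

open Classical in
/-- The winner of a comparison, where numbers that are at least `c` always lose. -/
noncomputable def better (K T : ℕ → ℝ) (c a b : ℕ) : ℕ :=
  if b < c ∧ (a < c → LexLT K T b a) then b else a

/-- `a` does not lose against `b`. -/
def Beats (K T : ℕ → ℝ) (c a b : ℕ) : Prop := b < c → a < c ∧ ¬ LexLT K T b a

theorem better_eq (K T : ℕ → ℝ) (c a b : ℕ) : better K T c a b = a ∨ better K T c a b = b := by
  unfold better; split_ifs <;> simp

theorem better_le {K T : ℕ → ℝ} {c a b n : ℕ} (ha : a ≤ n) (hb : b ≤ n) :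
    better K T c a b ≤ n := by
  rcases better_eq K T c a b with h | h <;> rw [h] <;> assumption

theorem Beats.refl (K T : ℕ → ℝ) (c a : ℕ) : Beats K T c a a :=
  fun h => ⟨h, by simp [LexLT]⟩

theorem Beats.trans {K T : ℕ → ℝ} {c a b d : ℕ} (h : Beats K T c a b) (h' : Beats K T c b d) :
    Beats K T c a d :=
  fun hd => ⟨(h (h' hd).1).1, LexLT.not_trans (h (h' hd).1).2 (h' hd).2⟩

theorem better_beats_left (K T : ℕ → ℝ) (c a b : ℕ) : Beats K T c (better K T c a b) a := by
  unfold better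
  split_ifs with h
  · exact fun ha => ⟨h.1, (h.2 ha).asymm⟩
  · exact Beats.refl _ _ _ _

theorem better_beats_right (K T : ℕ → ℝ) (c a b : ℕ) : Beats K T c (better K T c a b) b := by
  unfold better
  split_ifs with h
  · exact Beats.refl _ _ _ _
  · intro hb
    push Not at h
    exact h hb

/-- The node `u` of the tournament tree holds the winner among its children. -/
def NodeOK (K T : ℕ → ℝ) (c : ℕ) (tr : ℕ → ℕ) (u : ℕ) : Prop :=
  tr u = better K T c (tr (2 * u)) (tr (2 * u + 1))

/-- Strong induction along the path to the root: the parent `u / 2` beats `u`, and beating is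
transitive. -/
theorem root_beats {K T : ℕ → ℝ} {c : ℕ} {tr : ℕ → ℕ}
    (h : ∀ u, 1 ≤ u → u < c → NodeOK K T c tr u) (u : ℕ) (h1 : 1 ≤ u) (h2 : u < 2 * c) :
    Beats K T c (tr 1) (tr u) := by
  induction u using Nat.strong_induction_on with
  | _ u ih =>
    rcases Nat.lt_or_ge u 2 with h3 | h3
    · obtain rfl : u = 1 := by omega
      exact Beats.refl _ _ _ _
    · refine (ih (u / 2) (by omega) (by omega) (by omega)).trans ?_
      rw [h (u / 2) (by omega) (by omega)]
      rcases Nat.even_or_odd' u with ⟨w, hw | hw⟩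
      · rw [show u / 2 = w by omega, ← hw]; exact better_beats_left _ _ _ _ _
      · rw [show u / 2 = w by omega, ← hw]; exact better_beats_right _ _ _ _ _

/-- Each internal node copies one of its children, so its value can be traced down to a leaf `c +
w`. -/
theorem exists_leaf {K T : ℕ → ℝ} {c : ℕ} {tr : ℕ → ℕ}
    (h : ∀ u, 1 ≤ u → u < c → NodeOK K T c tr u) (u : ℕ) (h1 : 1 ≤ u) (h2 : u < 2 * c) :
    ∃ w < c, tr u = tr (c + w) := by
  induction hk : 2 * c - u using Nat.strong_induction_on generalizing u with
  | _ k ih =>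
    rcases Nat.lt_or_ge u c with h3 | h3
    · rw [h u h1 h3]
      rcases better_eq K T c (tr (2 * u)) (tr (2 * u + 1)) with e | e <;> rw [e]
      · exact ih _ (by omega) _ (by omega) (by omega) rfl
      · exact ih _ (by omega) _ (by omega) (by omega) rfl
    · exact ⟨u - c, by omega, by rw [show c + (u - c) = u by omega]⟩

/-- The root of a tournament tree is a minimal remaining index. -/
theorem root_spec {K T : ℕ → ℝ} {c : ℕ} {tr : ℕ → ℕ}
    (h : ∀ u, 1 ≤ u → u < c → NodeOK K T c tr u) (hleaf : ∀ w < c, tr (c + w) = w ∨ tr (c + w) = c)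
    (hex : ∃ w < c, tr (c + w) = w) :
    tr 1 < c ∧ tr (c + tr 1) = tr 1 ∧ ∀ w < c, tr (c + w) = w → ¬ LexLT K T w (tr 1) := by
  obtain ⟨w, hw, hw'⟩ := hex
  have h1 := root_beats h (c + w) (by omega) (by omega)
  rw [hw'] at h1
  obtain ⟨h2, -⟩ := h1 hw
  refine ⟨h2, ?_, fun x hx hx' => ?_⟩
  · obtain ⟨y, hy, e⟩ := exists_leaf h 1 le_rfl (by omega)
    rcases hleaf y hy with h3 | h3
    · rw [h3] at e; rw [e, h3]
    · omega
  · have h1 := root_beats h (c + x) (by omega) (by omega)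
    rw [hx'] at h1
    exact (h1 hx).2

/-- Compare the indices held by two variables. -/
def lexTest (a b : IVar) : TE :=
  .not (.and (.not (.rlt (.get .key (.var a)) (.get .key (.var b))))
    (.not (.and (.not (.rlt (.get .key (.var b)) (.get .key (.var a))))
      (.rlt (.get .tie (.var a)) (.get .tie (.var b))))))

theorem lexTest_holds (σ : Store) (a b : IVar) :
    (lexTest a b).Holds σ ↔ LexLT (σ.ra .key) (σ.ra .tie) (σ.iv a) (σ.iv b) := by
  simp only [lexTest, TE.Holds, RE.eval, IE.eval, LexLT]
  rcases lt_trichotomy (σ.ra .key (σ.iv a)) (σ.ra .key (σ.iv b)) with h | h | h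
  · simp [h]
  · simp [h]
  · simp [h, h.not_gt, h.ne']

/-- Recompute the node `v` of the tournament tree. -/
def combine : Cmd := .block [
  .setI .w (.get .tree (.mul (.lit 2) (.var .v))),
  .setI .h (.get .tree (.add (.mul (.lit 2) (.var .v)) (.lit 1))),
  .ite (.ilt (.var .h) (.var .c))
    (.ite (.ilt (.var .w) (.var .c))
      (.ite (lexTest .h .w) (.setI .w (.var .h)) .skip)
      (.setI .w (.var .h)))
    .skip,
  .putI .tree (.var .v) (.var .w)]

theorem combine_runs {N : ℕ} {σ : Store} {c u : ℕ} (hc : σ.iv .c = c) (hu : σ.iv .v = u)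
    (huc : u < c) (hcN : 2 * c + 2 < N) (h1 : σ.ia .tree (2 * u) ≤ c)
    (h2 : σ.ia .tree (2 * u + 1) ≤ c) :
    Halts N combine σ 1 fun τ =>
      τ.ia .tree = Function.update (σ.ia .tree) u
        (better (σ.ra .key) (σ.ra .tie) c (σ.ia .tree (2 * u)) (σ.ia .tree (2 * u + 1))) := by
  have key : ∀ x, x = better (σ.ra .key) (σ.ra .tie) c (σ.ia .tree (2 * u))
      (σ.ia .tree (2 * u + 1)) → (fun i => if i = u then x else σ.ia .tree i) =
      Function.update (σ.ia .tree) u (better (σ.ra .key) (σ.ra .tie) c (σ.ia .tree (2 * u))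
      (σ.ia .tree (2 * u + 1))) := by
    rintro x rfl; ext i; simp [Function.update_apply]
  apply Halts.of_wp le_rfl
  simp only [combine, Cmd.block, Cmd.wp, lexTest_holds]
  simp only [lexTest, TE.Legal, TE.Holds, RE.Legal, IE.Legal, IE.eval, Store.iv_setI,
    Store.ia_setI, Store.ra_setI, hc, hu, reduceCtorEq, if_true, if_false]
  refine ⟨by omega, by omega, by omega, fun h3 => ⟨by omega, fun h4 => ⟨by omega, fun h5 => ?_,
    fun h5 => ?_⟩, fun h4 => ?_⟩, fun h3 => ?_⟩
  · refine ⟨by omega, by omega, by omega, ?_⟩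
    rw [← key _ (by rw [better, if_pos ⟨h3, fun _ => h5⟩])]
    ext i; simp [Store.ia_putI, Store.ia_setI]
  · refine ⟨by omega, by omega, ?_⟩
    rw [← key _ (by rw [better, if_neg fun h => h5 (h.2 h4)])]
    ext i; simp [Store.ia_putI, Store.ia_setI]
  · refine ⟨by omega, by omega, by omega, ?_⟩
    rw [← key _ (by rw [better, if_pos ⟨h3, fun h => absurd h h4⟩])]
    ext i; simp [Store.ia_putI, Store.ia_setI]
  · refine ⟨by omega, by omega, ?_⟩
    rw [← key _ (by rw [better, if_neg fun h => h3 h.1])]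
    ext i; simp [Store.ia_putI, Store.ia_setI]

/-- Recompute all nodes from `v` up to the root. -/
def combineUp : Cmd := .loop (.ilt (.lit 0) (.var .v))
  (.seq combine (.setI .v (.div (.var .v) (.lit 2))))

/-- Only the node `v` may be wrong. Repairing it leaves its parent as the only suspect, so the error
moves up to index 0, outside the tree, after at most `L` halvings. -/
theorem combineUp_runs {N : ℕ} {σ : Store} {c L : ℕ} (hc : σ.iv .c = c) (hu : σ.iv .v < c)
    (hL : c < 2 ^ L) (hcN : 2 * c + 2 < N) (hle : ∀ u, 1 ≤ u → u < 2 * c → σ.ia .tree u ≤ c)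
    (hok : ∀ u, 1 ≤ u → u < c → u ≠ σ.iv .v →
      NodeOK (σ.ra .key) (σ.ra .tie) c (σ.ia .tree) u) :
    Halts N combineUp σ (L + 1) fun τ =>
      (∀ u, 1 ≤ u → u < 2 * c → τ.ia .tree u ≤ c) ∧ (∀ u, c ≤ u → τ.ia .tree u = σ.ia .tree u) ∧
      ∀ u, 1 ≤ u → u < c → NodeOK (σ.ra .key) (σ.ra .tie) c (τ.ia .tree) u := by
  refine Halts.loop (fun k τ => τ.iv .v < c ∧ τ.iv .v < 2 ^ k ∧
    (∀ u, 1 ≤ u → u < 2 * c → τ.ia .tree u ≤ c) ∧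
    (∀ u, c ≤ u → τ.ia .tree u = σ.ia .tree u) ∧ ∀ u, 1 ≤ u → u < c → u ≠ τ.iv .v →
      NodeOK (σ.ra .key) (σ.ra .tie) c (τ.ia .tree) u) L le_rfl (mul_one _).le
    ⟨hu, hu.trans hL, hle, fun _ _ => rfl, hok⟩ ?_
  rintro k τ hF ⟨h1, h2, h3, h4, h5⟩
  simp only [TE.Legal, IE.Legal, TE.Holds, IE.eval]
  refine ⟨by omega, fun hv => ?_, fun hv => ⟨h3, h4, fun u hu1 hu2 => h5 u hu1 hu2 (by omega)⟩⟩
  -- The count cannot be 0, because `0 < v < 2 ^ 0` is impossible.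
  obtain ⟨k, rfl⟩ : ∃ k', k = k' + 1 :=
    ⟨k - 1, by rcases k with _ | k <;> simp at h2 ⊢; omega⟩
  refine ⟨k, rfl, Halts.seq (combine_runs (u := τ.iv .v) ((hF.iv .c rfl).trans hc) rfl h1 hcN
    (h3 _ (by omega) (by omega)) (h3 _ (by omega) (by omega))) ?_⟩
  intro υ hFυ hυ
  have hv' : υ.iv .v = τ.iv .v := hFυ.iv .v rfl
  refine Halts.of_wp le_rfl ⟨by simp only [IE.Legal, IE.eval, hv']; omega, ?_⟩
  simp only [IE.eval, hv', Store.ia_setI, Store.iv_setI, if_true, hυ]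
  rw [hF.ra .key rfl, hF.ra .tie rfl]
  refine ⟨by omega, by rw [pow_succ] at h2; omega, fun u hu' hu => ?_, fun u hu => ?_,
    fun u hu1 hu2 hu3 => ?_⟩
  · rw [Function.update_apply]
    split_ifs
    · exact better_le (h3 _ (by omega) (by omega)) (h3 _ (by omega) (by omega))
    · exact h3 u hu' hu
  · rw [Function.update_of_ne (by omega), h4 u hu]
  · rw [NodeOK, Function.update_of_ne (by omega : 2 * u ≠ τ.iv .v),
      Function.update_of_ne (by omega : 2 * u + 1 ≠ τ.iv .v)]
    by_cases hu4 : u = τ.iv .v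
    · rw [hu4, Function.update_self]
    · rw [Function.update_of_ne hu4]; exact h5 u hu1 hu2 hu4

/-- Recompute all nodes of the tournament tree. -/
def combineAll : Cmd := .loop (.ilt (.lit 0) (.var .v))
  (.seq combine (.setI .v (.sub (.var .v) (.lit 1))))

theorem combineAll_runs {N : ℕ} {σ : Store} {c : ℕ} (hc : σ.iv .c = c) (hu : σ.iv .v = c - 1)
    (hcN : 2 * c + 2 < N) (hle : ∀ u, c ≤ u → u < 2 * c → σ.ia .tree u ≤ c) :
    Halts N combineAll σ (c + 1) fun τ =>
      (∀ u, 1 ≤ u → u < 2 * c → τ.ia .tree u ≤ c) ∧ (∀ u, c ≤ u → τ.ia .tree u = σ.ia .tree u) ∧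
      ∀ u, 1 ≤ u → u < c → NodeOK (σ.ra .key) (σ.ra .tie) c (τ.ia .tree) u := by
  refine Halts.loop (fun k τ => τ.iv .v = k ∧ k ≤ c - 1 ∧ (∀ u, k < u → u < 2 * c → τ.ia .tree u ≤ c) ∧
    (∀ u, c ≤ u → τ.ia .tree u = σ.ia .tree u) ∧ ∀ u, k < u → u < c →
      NodeOK (σ.ra .key) (σ.ra .tie) c (τ.ia .tree) u) (c - 1) le_rfl (by omega)
    ⟨hu, le_rfl, fun u h1 h2 => hle u (by omega) h2, fun _ _ => rfl, fun u h1 h2 => by omega⟩ ?_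
  rintro k τ hF ⟨h1, h2, h3, h4, h5⟩
  simp only [TE.Legal, IE.Legal, TE.Holds, IE.eval, h1]
  refine ⟨by omega, fun hv => ?_, fun hv => ⟨fun u hu => h3 u (by omega), h4, fun u hu1 hu2 => h5 u (by omega) hu2⟩⟩
  obtain ⟨k, rfl⟩ : ∃ k', k = k' + 1 := ⟨k - 1, by omega⟩
  refine ⟨k, rfl, Halts.seq (combine_runs (u := k + 1) ((hF.iv .c rfl).trans hc) h1 (by omega) hcN
    (h3 _ (by omega) (by omega)) (h3 _ (by omega) (by omega))) ?_⟩
  intro υ hFυ hυ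
  have hv' : υ.iv .v = k + 1 := (hFυ.iv .v rfl).trans h1
  refine Halts.of_wp le_rfl ⟨by simp only [IE.Legal, hv']; omega, ?_⟩
  simp only [IE.eval, hv', Store.ia_setI, Store.iv_setI, if_true, hυ]
  rw [hF.ra .key rfl, hF.ra .tie rfl]
  refine ⟨by omega, by omega, fun u hu' hu => ?_, fun u hu => ?_, fun u hu1 hu2 => ?_⟩
  · rw [Function.update_apply]
    split_ifs
    · exact better_le (h3 _ (by omega) (by omega)) (h3 _ (by omega) (by omega))
    · exact h3 u (by omega) hu
  · rw [Function.update_of_ne (by omega), h4 u hu]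
  · rw [NodeOK, Function.update_of_ne (by omega : 2 * u ≠ k + 1),
      Function.update_of_ne (by omega : 2 * u + 1 ≠ k + 1)]
    by_cases hu4 : u = k + 1
    · rw [hu4, Function.update_self]
    · rw [Function.update_of_ne hu4]; exact h5 u (by omega) hu2

/-- Move the winner of the tournament to the output and remove it from the tree. -/
def extractRoot : Cmd := .block [
  .setI .w (.get .tree (.lit 1)),
  .putI .ord (.var .e) (.var .w),
  .setI .v (.add (.var .c) (.var .w)),
  .putI .tree (.var .v) (.var .c),
  .setI .v (.div (.var .v) (.lit 2))]

/-- Sort the indices below `c` by the arrays `key` and `tie`. -/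
def sort : Cmd := .block [
  .for .i .c (.putI .tree (.add (.var .c) (.var .i)) (.var .i)),
  .setI .v (.sub (.var .c) (.lit 1)),
  combineAll,
  .for .e .c (.seq extractRoot combineUp)]

/-- The state of the tournament sort after `e` extractions. -/
structure SortInv (K T : ℕ → ℝ) (c e : ℕ) (o tr : ℕ → ℕ) : Prop where
  lt : ∀ i < e, o i < c
  inj : ∀ i < e, ∀ j < e, o i = o j → i = j
  sorted : ∀ i j, i < j → j < e → ¬ LexLT K T (o j) (o i)
  leaf : ∀ w < c, (tr (c + w) = w ∧ ∀ i < e, o i ≠ w) ∨ (tr (c + w) = c ∧ ∃ i < e, o i = w)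
  rest : ∀ i < e, ∀ w < c, (∀ i' < e, o i' ≠ w) → ¬ LexLT K T w (o i)
  node : ∀ u, 1 ≤ u → u < c → NodeOK K T c tr u
  le : ∀ u, 1 ≤ u → u < 2 * c → tr u ≤ c

/-- Fewer than `c` indices have been extracted, so by the pigeonhole principle some leaf still
competes; then `root_spec` identifies the root as a minimum of the rest. -/
theorem SortInv.root {K T : ℕ → ℝ} {c e : ℕ} {o tr : ℕ → ℕ} (h : SortInv K T c e o tr)
    (he : e < c) : tr 1 < c ∧ (∀ i < e, o i ≠ tr 1) ∧
      ∀ w < c, (∀ i < e, o i ≠ w) → ¬ LexLT K T w (tr 1) := by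
  have hex : ∃ w < c, tr (c + w) = w := by
    by_contra! hcon
    have : (Finset.range c) ⊆ (Finset.range e).image o := by
      intro w hw
      rw [Finset.mem_range] at hw
      obtain ⟨-, i, hi, hi'⟩ := (h.leaf w hw).resolve_left fun h' => hcon w hw h'.1
      exact Finset.mem_image.2 ⟨i, by simpa using hi, hi'⟩
    have := (Finset.card_le_card this).trans Finset.card_image_le
    simp at this
    omega
  obtain ⟨h1, h2, h3⟩ := root_spec h.node (fun w hw => (h.leaf w hw).imp And.left And.left) hex
  refine ⟨h1, ?_, fun w hw hw' => h3 w hw ?_⟩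
  · rcases h.leaf _ h1 with h4 | h4
    · exact h4.2
    · omega
  · rcases h.leaf w hw with h4 | ⟨-, i, hi, h4⟩
    · exact h4.1
    · exact absurd h4 (hw' i hi)

/-- Overwriting the leaf of the winner by `c` makes it lose all later comparisons. The field `rest`
of the invariant is what keeps the output sorted when the next minimum is appended. -/
theorem SortInv.step {K T : ℕ → ℝ} {c e : ℕ} {o tr tr' : ℕ → ℕ} (h : SortInv K T c e o tr)
    (he : e < c) (hleaf : ∀ u, c ≤ u → tr' u = if u = c + tr 1 then c else tr u)
    (hnode : ∀ u, 1 ≤ u → u < c → NodeOK K T c tr' u) (hle : ∀ u, 1 ≤ u → u < 2 * c → tr' u ≤ c) :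
    SortInv K T c (e + 1) (Function.update o e (tr 1)) tr' := by
  obtain ⟨h1, h2, h3⟩ := h.root he
  have ho : ∀ i < e, Function.update o e (tr 1) i = o i := fun i hi =>
    Function.update_of_ne (by omega) _ _
  have hcases : ∀ i < e + 1, i < e ∨ i = e := fun i hi => by omega
  refine ⟨fun i hi => ?_, fun i hi j hj hij => ?_, fun i j hij hj => ?_, fun w hw => ?_,
    fun i hi w hw hw' => ?_, hnode, hle⟩
  · rcases hcases i hi with hi | rfl
    · rw [ho i hi]; exact h.lt i hi
    · rwa [Function.update_self]
  · rcases hcases i hi with hi | rfl <;> rcases hcases j hj with hj | rfl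
    · rw [ho i hi, ho j hj] at hij; exact h.inj i hi j hj hij
    · rw [ho i hi, Function.update_self] at hij; exact absurd hij (h2 i hi)
    · rw [ho j hj, Function.update_self] at hij; exact absurd hij.symm (h2 j hj)
    · rfl
  · rcases hcases j hj with hj | rfl
    · rw [ho i (by omega), ho j hj]; exact h.sorted i j hij hj
    · rw [ho i hij, Function.update_self]; exact h.rest i hij _ h1 h2
  · rw [hleaf _ (by omega)]
    by_cases hwr : w = tr 1
    · refine .inr ⟨by rw [if_pos (by omega)], e, by omega, by rw [hwr, Function.update_self]⟩
    · rw [if_neg (by omega)]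
      refine (h.leaf w hw).imp (fun h4 => ⟨h4.1, fun i hi => ?_⟩)
        (fun ⟨h4, i, hi, h5⟩ => ⟨h4, i, by omega, by rw [ho i hi, h5]⟩)
      rcases hcases i hi with hi | rfl
      · rw [ho i hi]; exact h4.2 i hi
      · rw [Function.update_self]; exact Ne.symm hwr
  · have hw'' : ∀ i < e, o i ≠ w := fun i hi => by rw [← ho i hi]; exact hw' i (by omega)
    rcases hcases i hi with hi | rfl
    · rw [ho i hi]; exact h.rest i hi w hw hw''
    · rw [Function.update_self]; exact h3 w hw hw''

/-- Building the tree is linear, and each of the `c` extractions repairs one path of at most `L`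
nodes. -/
theorem sort_runs {N : ℕ} {σ : Store} {c L : ℕ} (hc : σ.iv .c = c) (hN : 2 * c + 2 < N)
    (hL : c < 2 ^ L) : Halts N sort σ ((c + 1) * (L + 1)) fun τ =>
      Sorts (σ.ra .key) (σ.ra .tie) c (τ.ia .ord) := by
  have hM : 1 ≤ (c + 1) * (L + 1) := Nat.mul_pos (by omega) (by omega)
  have hM' : c + 1 ≤ (c + 1) * (L + 1) := Nat.le_mul_of_pos_right _ (by omega)
  simp only [sort, Cmd.block]
  refine Halts.seq (Halts.for (L := 1) (M := (c + 1) * (L + 1)) (b := c) (v := .i) (c := .c)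
    (fun k τ => ∀ w < k, τ.ia .tree (c + w) = w) le_rfl (by simp) (by simp) (by rfl) (by rfl) hc
    (by omega) (by simp) ?_) fun τ₁ hF₁ h₁ => ?_
  · intro k hk τ hF hv hI
    have hcτ : τ.iv .c = c := (hF.iv .c rfl).trans hc
    apply Halts.of_wp le_rfl
    simp only [Cmd.wp, IE.Legal, IE.eval, hv, hcτ, Store.ia_setI, Store.ia_putI, if_true]
    refine ⟨by omega, by omega, fun w hw => ?_⟩
    split_ifs with h
    · omega
    · exact hI w (by omega)
  have hc₁ : τ₁.iv .c = c := (hF₁.iv .c rfl).trans hc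
  refine Halts.seq (Halts.of_wp (Q := fun τ => τ.iv .v = c - 1) hM ?_) fun τ₂ hF₂ h₂ => ?_
  · simp [Cmd.wp, IE.Legal, IE.eval, hc₁, Store.iv_setI]
    omega
  have hc₂ : τ₂.iv .c = c := (hF₂.iv .c rfl).trans hc₁
  have hleaf : ∀ w < c, τ₂.ia .tree (c + w) = w := by rw [hF₂.ia .tree rfl]; exact h₁
  have hleaf' : ∀ u, c ≤ u → u < 2 * c → τ₂.ia .tree u ≤ c := fun u hu hu' => by
    have := hleaf (u - c) (by omega)
    rw [show c + (u - c) = u by omega] at this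
    omega
  refine Halts.seq ((combineAll_runs (c := c) hc₂ h₂ hN hleaf').conseq hM'
    fun _ _ h => h) fun τ₃ hF₃ ⟨h3, h4, h5⟩ => ?_
  have hc₃ : τ₃.iv .c = c := (hF₃.iv .c rfl).trans hc₂
  have hk : τ₂.ra .key = σ.ra .key := (hF₂.ra .key rfl).trans (hF₁.ra .key rfl)
  have ht : τ₂.ra .tie = σ.ra .tie := (hF₂.ra .tie rfl).trans (hF₁.ra .tie rfl)
  rw [hk, ht] at h5
  refine Halts.conseq (Halts.for (L := L + 1) (M := (c + 1) * (L + 1)) (b := c)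
    (v := .e) (c := .c) (fun k τ => SortInv (σ.ra .key) (σ.ra .tie) c k (τ.ia .ord) (τ.ia .tree))
    (by omega) le_rfl (by simp) (by rfl) (by rfl) hc₃ (by omega) ?_ ?_) le_rfl
    fun τ hF h => ⟨h.lt, h.inj, h.sorted⟩
  · exact ⟨by simp, by simp, by simp, fun w hw => .inl ⟨(h4 _ (by omega)).trans (hleaf w hw),
      by simp⟩, by simp, h5, h3⟩
  · intro k hk' τ hF hv hI
    have hcτ : τ.iv .c = c := (hF.iv .c rfl).trans hc₃
    have hkτ : τ.ra .key = σ.ra .key := (hF.ra .key rfl).trans ((hF₃.ra .key rfl).trans hk)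
    have htτ : τ.ra .tie = σ.ra .tie := (hF.ra .tie rfl).trans ((hF₃.ra .tie rfl).trans ht)
    have hr := (hI.root hk').1
    refine Halts.seq (Halts.of_wp (Q := fun υ => υ.iv .v = (c + τ.ia .tree 1) / 2 ∧
      υ.ia .ord = Function.update (τ.ia .ord) k (τ.ia .tree 1) ∧
      υ.ia .tree = Function.update (τ.ia .tree) (c + τ.ia .tree 1) c) (by omega) ?_)
      fun υ hFυ ⟨hυ1, hυ2, hυ3⟩ => ?_
    · simp only [extractRoot, Cmd.block, Cmd.wp, IE.Legal, IE.eval, Store.iv_setI, Store.ia_setI,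
        Store.iv_putI, hcτ, hv, if_true, reduceCtorEq, if_false, true_and]
      refine ⟨⟨by omega, by omega⟩, by omega, by omega, by omega, by omega, by omega, by omega,
        ?_, ?_⟩
      · ext i; simp [Store.ia_putI, Store.ia_setI, Function.update_apply]
      · ext i; simp [Store.ia_putI, Store.ia_setI, Function.update_apply]
    · have hcυ : υ.iv .c = c := (hFυ.iv .c rfl).trans hcτ
      refine (combineUp_runs (c := c) hcυ (by omega) hL hN ?_ ?_).conseq le_rfl ?_
      · intro u hu1 hu2
        rw [hυ3, Function.update_apply]
        split_ifs
        · exact le_rfl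
        · exact hI.le u hu1 hu2
      · intro u hu1 hu2 hu3
        rw [hFυ.ra .key rfl, hFυ.ra .tie rfl, hkτ, htτ, hυ3, NodeOK,
          Function.update_of_ne (by omega), Function.update_of_ne (by omega),
          Function.update_of_ne (by omega)]
        exact hI.node u hu1 hu2
      · intro ω hFω ⟨hω1, hω2, hω3⟩
        rw [hFυ.ra .key rfl, hFυ.ra .tie rfl, hkτ, htτ] at hω3
        simp only [Store.ia_setI]
        rw [hFω.ia .ord rfl, hυ2]
        refine hI.step hk' (fun u hu => ?_) hω3 hω1
        rw [hω2 u hu, hυ3, Function.update_apply]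

/-! ### Tangents to a convex chain -/

/-- The cross product of plane vectors. -/
def cross (u v : ℝ × ℝ) : ℝ := u.1 * v.2 - u.2 * v.1

/-- The vectors of a half plane that contains one of its two bounding rays, selected by the sign
of `τ`. -/
def Ahead (τ : ℝ) (v : ℝ × ℝ) : Prop := 0 < v.1 ∨ v.1 = 0 ∧ 0 < τ * v.2

theorem Ahead.nonneg {τ : ℝ} {v : ℝ × ℝ} (h : Ahead τ v) : 0 ≤ v.1 :=
  h.elim le_of_lt fun h => h.1.ge

theorem Ahead.add {τ : ℝ} {u v : ℝ × ℝ} (hu : Ahead τ u) (hv : Ahead τ v) : Ahead τ (u + v) := by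
  simp only [Ahead, Prod.fst_add, Prod.snd_add] at *
  rcases hu with hu | ⟨hu, hu'⟩ <;> rcases hv with hv | ⟨hv, hv'⟩
  · left; linarith
  · left; linarith
  · left; linarith
  · right; constructor <;> linarith

theorem cross_swap (u v : ℝ × ℝ) : cross v u = -cross u v := by simp only [cross]; ring

theorem cross_self (u : ℝ × ℝ) : cross u u = 0 := by simp only [cross]; ring

/-- Within a half plane that contains just one bounding ray, directions are linearly preordered by
the sign of the cross product. If `v.1 > 0` this is the identity `v.1 (u × w) = u.1 (v × w) + w.1 (u
× v)`; if `v` is on the bounding ray, the sign of `τ` decides. -/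
theorem Ahead.cross_trans {τ : ℝ} {u v w : ℝ × ℝ} (hu : Ahead τ u) (hv : Ahead τ v)
    (hw : Ahead τ w) (h : 0 ≤ cross u v) (h' : 0 ≤ cross v w) : 0 ≤ cross u w := by
  have hu0 := hu.nonneg
  have hw0 := hw.nonneg
  rcases hv with hv | ⟨hv, hv'⟩
  · have e : v.1 * cross u w = u.1 * cross v w + w.1 * cross u v := by simp only [cross]; ring
    have : 0 ≤ v.1 * cross u w := by rw [e]; positivity
    exact nonneg_of_mul_nonneg_right this hv
  · simp only [cross, hv, mul_zero, sub_zero, zero_mul, zero_sub] at *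
    rcases hu with hu | ⟨hu, hu'⟩
    · have h2 : 0 ≤ v.2 := nonneg_of_mul_nonneg_right h hu
      have h2' : 0 < v.2 := h2.lt_of_ne (by rintro e; rw [← e] at hv'; simp at hv')
      have hτ : 0 < τ := pos_of_mul_pos_left hv' h2
      rcases hw with hw | ⟨hw, hw'⟩
      · nlinarith
      · have := pos_of_mul_pos_right hw' hτ.le
        rw [hw]; nlinarith
    · rw [hu]
      rcases lt_or_ge 0 v.2 with h2 | h2
      · have : w.1 = 0 := by nlinarith
        rw [this]; simp
      · have hτ : τ < 0 := by
          by_contra hτ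
          nlinarith
        have : u.2 < 0 := by
          by_contra hh
          nlinarith
        nlinarith

/-- The points `q 0, …, q (m - 1)` form a convex chain, and seen from any point that has the set
`S` ahead of it, one of them has a maximal direction among the points of `S`. -/
structure Chain (τ : ℝ) (S : Set (ℝ × ℝ)) (q : ℕ → ℝ × ℝ) (m : ℕ) : Prop where
  mem : ∀ i < m, q i ∈ S
  desc : ∀ i, i + 1 < m → Ahead τ (q i - q (i + 1))
  convex : ∀ i, i + 2 < m → 0 ≤ cross (q i - q (i + 1)) (q (i + 1) - q (i + 2))
  dom : ∀ s ∈ S, ∀ z, (∀ s' ∈ S, Ahead τ (s' - z)) → ∃ i < m, 0 ≤ cross (s - z) (q i - z)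

namespace Chain

variable {τ : ℝ} {S : Set (ℝ × ℝ)} {q : ℕ → ℝ × ℝ} {m : ℕ}

theorem ahead (h : Chain τ S q m) (i j : ℕ) (hij : i < j) (hj : j < m) : Ahead τ (q i - q j) := by
  induction j with
  | zero => omega
  | succ j ih =>
    rcases Nat.lt_or_ge i j with h1 | h1
    · have := (ih h1 (by omega)).add (h.desc j hj)
      simpa using this
    · obtain rfl : i = j := by omega
      exact h.desc i hj

/-- Ascent propagates backwards: convexity turns the edge `q i - q (i + 1)` no further than the next
edge, which in turn is no further than `q (i + 2) - z`. Hence the positions of ascent form an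
initial segment, which makes binary search possible. -/
theorem anti (h : Chain τ S q m) {z : ℝ × ℝ} (hz : ∀ s ∈ S, Ahead τ (s - z)) {i : ℕ}
    (hi : i + 2 < m) (hQ : 0 ≤ cross (q (i + 1) - z) (q (i + 2) - z)) :
    0 ≤ cross (q i - z) (q (i + 1) - z) := by
  have h1 := hz _ (h.mem (i + 2) hi)
  have h2 := h.desc (i + 1) hi
  have h3 : 0 ≤ cross (q (i + 1) - q (i + 2)) (q (i + 2) - z) := by
    simp only [cross, Prod.fst_sub, Prod.snd_sub] at *; nlinarith
  have h4 := (h.desc i (by omega)).cross_trans h2 h1 (h.convex i hi) h3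
  have h5 := h.convex i hi
  simp only [cross, Prod.fst_sub, Prod.snd_sub] at *; nlinarith

theorem anti' (h : Chain τ S q m) {z : ℝ × ℝ} (hz : ∀ s ∈ S, Ahead τ (s - z)) {i j : ℕ}
    (hij : i ≤ j) (hj : j + 1 < m) (hQ : 0 ≤ cross (q j - z) (q (j + 1) - z)) :
    0 ≤ cross (q i - z) (q (i + 1) - z) := by
  induction j with
  | zero => obtain rfl : i = 0 := by omega
            exact hQ
  | succ j ih =>
    rcases Nat.lt_or_ge i (j + 1) with h1 | h1
    · exact ih (by omega) (by omega) (h.anti hz hj hQ)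
    · obtain rfl : i = j + 1 := by omega
      exact hQ

/-- The position `p` is the tangent point of the chain as seen from `z`. -/
structure Tangent (z : ℝ × ℝ) (q : ℕ → ℝ × ℝ) (m p : ℕ) : Prop where
  lt : p < m
  below : ∀ i < p, 0 ≤ cross (q i - z) (q (i + 1) - z)
  above : p + 1 < m → ¬ 0 ≤ cross (q p - z) (q (p + 1) - z)

/-- By `anti'` the directions seen from `z` descend at every position after `p`, so the chain is
unimodal with its peak at `p`. -/
theorem max_of_tangent (h : Chain τ S q m) {z : ℝ × ℝ} (hz : ∀ s ∈ S, Ahead τ (s - z)) {p : ℕ}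
    (hp : Tangent z q m p) (i : ℕ) (hi : i < m) : 0 ≤ cross (q i - z) (q p - z) := by
  have hA : ∀ i < m, Ahead τ (q i - z) := fun i hi => hz _ (h.mem i hi)
  rcases Nat.lt_or_ge p i with hpi | hpi
  · induction i with
    | zero => omega
    | succ i ih =>
      have h1 : 0 ≤ cross (q (i + 1) - z) (q i - z) := by
        have := not_le.1 fun hQ => hp.above (by omega) (h.anti' hz (by omega : p ≤ i) hi hQ)
        rw [cross_swap]; linarith
      rcases Nat.lt_or_ge p i with h2 | h2
      · exact (hA _ hi).cross_trans (hA i (by omega)) (hA p hp.lt) h1 (ih (by omega) h2)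
      · obtain rfl : p = i := by omega
        exact h1
  · induction hd : p - i generalizing i with
    | zero =>
      obtain rfl : p = i := by omega
      rw [cross_self]
    | succ d ih =>
      exact (hA _ hi).cross_trans (hA (i + 1) (by have := hp.lt; omega)) (hA p hp.lt)
        (hp.below i (by omega)) (ih (i + 1) (by have := hp.lt; omega) (by omega) (by omega))

theorem max_of_tangent' (h : Chain τ S q m) {z : ℝ × ℝ} (hz : ∀ s ∈ S, Ahead τ (s - z)) {p : ℕ}
    (hp : Tangent z q m p) (s : ℝ × ℝ) (hs : s ∈ S) : 0 ≤ cross (s - z) (q p - z) := by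
  obtain ⟨i, hi, h1⟩ := h.dom s hs z hz
  exact (hz s hs).cross_trans (hz _ (h.mem i hi)) (hz _ (h.mem p hp.lt)) h1
    (h.max_of_tangent hz hp i hi)

theorem empty (τ : ℝ) (q : ℕ → ℝ × ℝ) : Chain τ ∅ q 0 :=
  ⟨by simp, by simp, by simp, by simp⟩

theorem singleton (τ : ℝ) (q : ℕ → ℝ × ℝ) : Chain τ {q 0} q 1 :=
  ⟨by simp, by simp, by simp, fun s hs z _ => ⟨0, by simp, by
    rw [mem_singleton_iff.1 hs, cross_self]⟩⟩

/-- Convexity at the joint is the tangent condition just before `p`. The discarded points `q i` with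
`p < i` are superfluous: from any point `y` behind everything, a discarded point is beaten by `z` or
by `q p`, since it lies weakly below the line from `z` to `q p`. -/
theorem insert (h : Chain τ S q m) {z : ℝ × ℝ} (hz : ∀ s ∈ S, Ahead τ (s - z)) {p : ℕ}
    (hp : Tangent z q m p) :
    Chain τ (Insert.insert z S) (Function.update q (p + 1) z) (p + 2) := by
  have hq : ∀ i ≤ p, Function.update q (p + 1) z i = q i := fun i hi =>
    Function.update_of_ne (by omega) _ _
  have hqz : Function.update q (p + 1) z (p + 1) = z := Function.update_self _ _ _
  have hpm := hp.lt
  refine ⟨fun i hi => ?_, fun i hi => ?_, fun i hi => ?_, fun s hs y hy => ?_⟩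
  · rcases Nat.lt_or_ge i (p + 1) with h1 | h1
    · rw [hq i (by omega)]; exact .inr (h.mem i (by omega))
    · obtain rfl : i = p + 1 := by omega
      rw [hqz]; exact .inl rfl
  · rw [hq i (by omega)]
    rcases Nat.lt_or_ge i p with h1 | h1
    · rw [hq (i + 1) (by omega)]; exact h.desc i (by omega)
    · obtain rfl : i = p := by omega
      rw [hqz]; exact hz _ (h.mem i hpm)
  · rw [hq i (by omega), hq (i + 1) (by omega)]
    rcases Nat.lt_or_ge (i + 1) p with h1 | h1
    · rw [hq (i + 2) (by omega)]; exact h.convex i (by omega)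
    · obtain rfl : p = i + 1 := by omega
      rw [hqz]
      have := hp.below i (by omega)
      simp only [cross, Prod.fst_sub, Prod.snd_sub] at *; nlinarith
  · rcases hs with rfl | hs
    · exact ⟨p + 1, by omega, by rw [hqz, cross_self]⟩
    · have hyS : ∀ s' ∈ S, Ahead τ (s' - y) := fun s' hs' => hy s' (.inr hs')
      have ha := hy z (.inl rfl)
      obtain ⟨i, hi, h1⟩ := h.dom s hs y hyS
      rcases Nat.lt_or_ge p i with h2 | h2
      · have hv := hyS _ (h.mem p hpm)
        have hu := hyS _ (h.mem i hi)
        have hs' := hyS s hs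
        by_cases h3 : 0 ≤ cross (q i - y) (z - y)
        · exact ⟨p + 1, by omega, by rw [hqz]; exact hs'.cross_trans hu ha h1 h3⟩
        · refine ⟨p, by omega, ?_⟩
          rw [hq p le_rfl]
          refine hs'.cross_trans hu hv h1 ?_
          have h4 := h.max_of_tangent hz hp i hi
          have hw := h.ahead p i h2 hi
          have hui := hz _ (h.mem i hi)
          by_contra h5
          -- the direction of `q i - z` exceeds that of `z - y`, which exceeds that of `q p - q i`
          have h6 : 0 ≤ cross (q i - z) (q p - q i) := by
            simp only [cross, Prod.fst_sub, Prod.snd_sub] at *; nlinarith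
          have h7 : 0 ≤ cross (q p - q i) (z - y) := by
            simp only [cross, Prod.fst_sub, Prod.snd_sub] at *; nlinarith
          have h8 := hui.cross_trans hw ha h6 h7
          apply h3
          simp only [cross, Prod.fst_sub, Prod.snd_sub] at *; nlinarith
      · exact ⟨i, by omega, by rw [hq i h2]; exact h1⟩

end Chain

/-! ### The angle of a vector, clipped to `[0, π / 2]` -/

open Classical in
/-- The angle between the first axis and the vector `d`, which lies in the right half plane,
clipped to `[0, π / 2]`. -/
noncomputable def clipAngle (d : ℝ × ℝ) : ℝ :=
  if 0 < d.1 then max 0 (arctan (d.2 / d.1)) else if 0 < d.2 then π / 2 else 0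

theorem clipAngle_nonneg (d : ℝ × ℝ) : 0 ≤ clipAngle d := by
  unfold clipAngle
  split_ifs
  · exact le_max_left _ _
  · positivity
  · exact le_rfl

theorem clipAngle_le (d : ℝ × ℝ) : clipAngle d ≤ π / 2 := by
  have := Real.pi_pos
  unfold clipAngle
  split_ifs
  · exact max_le (by positivity) (arctan_lt_pi_div_two _).le
  · exact le_rfl
  · positivity

/-- Off the bounding ray this is monotonicity of the slope; on the ray the clipped angle is 0 or `π
/ 2`. So the tangent point also maximizes the clipped angle. -/
theorem clipAngle_mono {τ : ℝ} {u v : ℝ × ℝ} (hu : Ahead τ u) (hv : Ahead τ v)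
    (h : 0 ≤ cross u v) : clipAngle u ≤ clipAngle v := by
  rcases hu with hu | ⟨hu, hu'⟩
  · rcases hv with hv | ⟨hv, hv'⟩
    · simp only [clipAngle, if_pos hu, if_pos hv]
      refine max_le_max le_rfl (arctan_strictMono.monotone ?_)
      rw [div_le_div_iff₀ hu hv]
      simp only [cross] at h; linarith
    · have h2 : 0 < v.2 := by
        simp only [cross, hv, mul_zero, sub_zero] at h
        refine (nonneg_of_mul_nonneg_right h hu).lt_of_ne fun e => ?_
        rw [← e] at hv'; simp at hv'
      rw [show clipAngle v = π / 2 by simp [clipAngle, hv, h2]]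
      exact clipAngle_le u
  · by_cases h2 : 0 < u.2
    · have h3 : v.1 = 0 := by
        simp only [cross, hu, zero_mul, zero_sub] at h
        have := Ahead.nonneg hv
        nlinarith
      have hτ : 0 < τ := pos_of_mul_pos_left hu' h2.le
      have h4 : 0 < v.2 := by
        rcases hv with hv | ⟨-, hv⟩
        · linarith
        · exact pos_of_mul_pos_right hv hτ.le
      rw [show clipAngle v = π / 2 by simp [clipAngle, h3, h4]]
      exact clipAngle_le u
    · rw [show clipAngle u = 0 by simp [clipAngle, hu, h2]]
      exact clipAngle_nonneg v

/-- This is the comparison of the slope `d.2 / d.1` with `tan α`, cleared of denominators so that it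
also covers `d.1 = 0` and `α = π / 2`. Clipping makes vectors with `d.2 ≤ 0` impose no condition. -/
theorem clipAngle_le_iff {d : ℝ × ℝ} {α : ℝ} (hd : 0 ≤ d.1) (h0 : 0 ≤ α) (h1 : α ≤ π / 2) :
    clipAngle d ≤ α ↔ (0 < d.2 → d.2 * cos α ≤ d.1 * sin α) := by
  have hπ := Real.pi_pos
  rcases hd.eq_or_lt with h | h
  · by_cases h2 : 0 < d.2
    · simp only [clipAngle, ← h, lt_irrefl, if_false, if_true, h2, true_imp_iff, zero_mul]
      constructor
      · intro h3
        rw [le_antisymm h1 h3]; simp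
      · intro h3
        by_contra h4
        have := cos_pos_of_mem_Ioo ⟨by linarith, by linarith⟩ (x := α)
        nlinarith
    · simp [clipAngle, ← h, h2, h0]
  · simp only [clipAngle, if_pos h, max_le_iff, h0, true_and]
    rcases h1.eq_or_lt with h3 | h3
    · simp [h3, h.le, (arctan_lt_pi_div_two _).le]
    · have hc : 0 < cos α := cos_pos_of_mem_Ioo ⟨by linarith, h3⟩
      have hs : 0 ≤ sin α := sin_nonneg_of_nonneg_of_le_pi h0 (by linarith)
      rw [← arctan_tan (x := α) (by linarith) h3, arctan_strictMono.le_iff_le,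
        arctan_tan (x := α) (by linarith) h3, tan_eq_sin_div_cos, div_le_div_iff₀ h hc]
      constructor
      · intro h4 _; linarith
      · intro h4
        by_cases h5 : 0 < d.2
        · linarith [h4 h5]
        · push Not at h5
          nlinarith [mul_nonneg hs h.le]

/-! ### Maximal directions of red points -/

/-- The point with index `i`, in the current coordinate frame. -/
def Store.pt (σ : Store) (i : ℕ) : ℝ × ℝ := (σ.ra .fx i, σ.ra .fy i)

theorem Store.pt_congr {σ τ : Store} (hx : τ.ra .fx = σ.ra .fx) (hy : τ.ra .fy = σ.ra .fy) :
    τ.pt = σ.pt := by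
  ext i <;> simp [pt, hx, hy]

/-- The points of the stack. -/
def Store.chain (σ : Store) (i : ℕ) : ℝ × ℝ := σ.pt (σ.ia .stk i)

/-- The test whether the direction from the point `p` to the point `h` is less than to `w`. -/
def turnTest : TE :=
  .rlt (.sub
    (.mul (.sub (.get .fx (.var .w)) (.get .fx (.var .p)))
      (.sub (.get .fy (.var .h)) (.get .fy (.var .p))))
    (.mul (.sub (.get .fy (.var .w)) (.get .fy (.var .p)))
      (.sub (.get .fx (.var .h)) (.get .fx (.var .p))))) (.lit 0)

theorem turnTest_holds (σ : Store) :
    turnTest.Holds σ ↔ ¬ 0 ≤ cross (σ.pt (σ.iv .w) - σ.pt (σ.iv .p))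
      (σ.pt (σ.iv .h) - σ.pt (σ.iv .p)) := by
  simp [turnTest, TE.Holds, RE.eval, IE.eval, cross, Store.pt]

/-- Binary search for the tangent point of the chain on the stack. -/
def search : Cmd := .block [
  .setI .lo (.lit 0),
  .setI .hi (.sub (.var .top) (.lit 1)),
  .loop (.ilt (.var .lo) (.var .hi)) (.block [
    .setI .mid (.div (.add (.var .lo) (.var .hi)) (.lit 2)),
    .setI .w (.get .stk (.var .mid)),
    .setI .h (.get .stk (.add (.var .mid) (.lit 1))),
    .ite turnTest (.setI .hi (.var .mid)) (.setI .lo (.add (.var .mid) (.lit 1)))])]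

theorem search_runs {N : ℕ} {σ : Store} {t L : ℕ} {ε : ℝ} {S : Set (ℝ × ℝ)}
    (ht : σ.iv .top = t) (ht0 : 0 < t) (hL : t < 2 ^ L) (htN : 2 * t + 2 < N)
    (hpN : σ.iv .p < N) (hstk : ∀ i < t, σ.ia .stk i < N)
    (hch : Chain ε S σ.chain t) (hz : ∀ s ∈ S, Ahead ε (s - σ.pt (σ.iv .p))) :
    Halts N search σ (L + 1) fun τ => Chain.Tangent (σ.pt (σ.iv .p)) σ.chain t (τ.iv .lo) := by
  simp only [search, Cmd.block]
  refine Halts.seq (Halts.of_wp (Q := fun τ => τ.iv .lo = 0) (by omega) ?_) fun τ₁ hF₁ h₁ => ?_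
  · simp [Cmd.wp, IE.Legal, IE.eval, Store.iv_setI]; omega
  have ht₁ := (hF₁.iv .top rfl).trans ht
  refine Halts.seq (Halts.of_wp (Q := fun τ => τ.iv .hi = t - 1) (by omega) ?_)
    fun τ₂ hF₂ h₂ => ?_
  · simp [Cmd.wp, IE.Legal, IE.eval, Store.iv_setI, ht₁]; omega
  set z := σ.pt (σ.iv .p) with hzdef
  have hp₂ : τ₂.iv .p = σ.iv .p := (hF₂.iv .p rfl).trans (hF₁.iv .p rfl)
  have hs₂ : τ₂.ia .stk = σ.ia .stk := (hF₂.ia .stk rfl).trans (hF₁.ia .stk rfl)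
  have hpt₂ : τ₂.pt = σ.pt := Store.pt_congr ((hF₂.ra .fx rfl).trans (hF₁.ra .fx rfl))
    ((hF₂.ra .fy rfl).trans (hF₁.ra .fy rfl))
  -- Positions below `lo` are ascents and position `hi` is not, unless `hi` is the end of the chain.
  -- The width `hi - lo` is below `2 ^ k` and is halved each time.
  refine Halts.loop (L := 1) (fun k τ => τ.iv .lo ≤ τ.iv .hi ∧ τ.iv .hi < t ∧
    τ.iv .hi - τ.iv .lo < 2 ^ k ∧
    (∀ i < τ.iv .lo, 0 ≤ cross (σ.chain i - z) (σ.chain (i + 1) - z)) ∧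
    (τ.iv .hi + 1 < t → ¬ 0 ≤ cross (σ.chain (τ.iv .hi) - z) (σ.chain (τ.iv .hi + 1) - z)))
    L le_rfl (by omega) ?_ ?_
  · rw [h₂, (hF₂.iv .lo rfl).trans h₁]
    exact ⟨by omega, by omega, by omega, by simp, fun h => by omega⟩
  · rintro k τ hF ⟨h1, h2, h3, h4, h5⟩
    have hp : τ.iv .p = σ.iv .p := (hF.iv .p rfl).trans hp₂
    have hs : τ.ia .stk = σ.ia .stk := (hF.ia .stk rfl).trans hs₂
    have hpt : τ.pt = σ.pt := (Store.pt_congr (hF.ra .fx rfl) (hF.ra .fy rfl)).trans hpt₂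
    simp only [TE.Legal, IE.Legal, TE.Holds, IE.eval]
    refine ⟨by omega, fun hlt => ?_, fun hlt => ?_⟩
    · obtain ⟨k, rfl⟩ : ∃ k', k = k' + 1 :=
        ⟨k - 1, by rcases k with _ | k <;> simp at h3 ⊢; omega⟩
      refine ⟨k, rfl, Halts.of_wp le_rfl ?_⟩
      have hm1 := hstk ((τ.iv .lo + τ.iv .hi) / 2) (by omega)
      have hm2 := hstk ((τ.iv .lo + τ.iv .hi) / 2 + 1) (by omega)
      rw [pow_succ] at h3
      set mid := (τ.iv .lo + τ.iv .hi) / 2 with hmid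
      simp only [Cmd.wp, turnTest_holds]
      simp only [turnTest, TE.Legal, RE.Legal, IE.Legal, IE.eval, Store.iv_setI, Store.ia_setI,
        reduceCtorEq, if_true, if_false, hp, hs, ← hmid]
      have e : ∀ (τ' : Store), τ'.ra = τ.ra → τ'.pt = σ.pt := fun τ' h =>
        (Store.pt_congr (by rw [h]) (by rw [h])).trans hpt
      simp only [e (((τ.setI .mid mid).setI .w (σ.ia .stk mid)).setI .h (σ.ia .stk (mid + 1))) rfl]
      refine ⟨by omega, by omega, by omega, ⟨⟨⟨⟨hm1, hpN⟩, hm2, hpN⟩, ⟨hm1, hpN⟩, hm2, hpN⟩,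
        trivial⟩, fun hQ => ⟨by omega, by omega, by omega, by omega, h4, fun _ => hQ⟩,
        fun hQ => ⟨by omega, by omega, by omega, by omega, fun i hi => ?_, h5⟩⟩
      exact hch.anti' hz (by omega : i ≤ mid) (by omega) (not_not.1 hQ)
    · have e : τ.iv .hi = τ.iv .lo := by omega
      rw [e] at h2 h5
      exact ⟨h2, h4, h5⟩

/-- Put the point `p` on the stack, after the tangent point. -/
def push : Cmd :=
  .ite (.ilt (.lit 0) (.var .top))
    (.block [.putI .stk (.add (.var .lo) (.lit 1)) (.var .p),
      .setI .top (.add (.var .lo) (.lit 2))])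
    (.block [.putI .stk (.lit 0) (.var .p), .setI .top (.lit 1)])

/-- Record the clipped angle of the direction from `p` to the tangent point. -/
def record : Cmd := .block [
  .ite (.ilt (.lit 0) (.var .top))
    (.block [
      .setI .w (.get .stk (.var .lo)),
      .setR .dx (.sub (.get .fx (.var .w)) (.get .fx (.var .p))),
      .setR .dy (.sub (.get .fy (.var .w)) (.get .fy (.var .p))),
      .ite (.rlt (.lit 0) (.var .dx))
        (.block [
          .setR .x (.arctan (.div (.var .dy) (.var .dx))),
          .ite (.rlt (.var .x) (.lit 0)) (.setR .x (.lit 0)) .skip])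
        (.ite (.rlt (.lit 0) (.var .dy)) (.setR .x (.var .hp)) (.setR .x (.lit 0)))])
    (.setR .x (.lit 0)),
  .putR .ang (.add (.mul (.lit 8) (.var .p)) (.var .g)) (.var .x)]

/-- The value 0 for an empty chain is the maximum over no directions, because clipped angles start
at 0. -/
theorem record_runs {N : ℕ} {σ : Store} (hhp : σ.rv .hp = π / 2)
    (hN : 8 * σ.iv .p + σ.iv .g < N) (hN' : σ.iv .top < N) (hN2 : 8 < N)
    (hlo : 0 < σ.iv .top → σ.iv .lo < N)
    (hw : 0 < σ.iv .top → σ.ia .stk (σ.iv .lo) < N) :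
    Halts N record σ 1 fun τ => τ.ra .ang = Function.update (σ.ra .ang) (8 * σ.iv .p + σ.iv .g)
      (if 0 < σ.iv .top then clipAngle (σ.chain (σ.iv .lo) - σ.pt (σ.iv .p)) else 0) := by
  apply Halts.of_wp le_rfl
  simp only [record, Cmd.block, Cmd.wp, TE.Legal, TE.Holds, RE.Legal, IE.Legal, RE.eval, IE.eval,
    Store.iv_setI, Store.iv_setR, Store.rv_setR, Store.ra_setR, Store.rv_setI, Store.ra_setI,
    reduceCtorEq, if_true, if_false, Int.cast_zero, Store.chain, Store.pt, clipAngle]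
  have hang : ∀ (τ : Store) (x y : ℝ), τ.ra .ang = σ.ra .ang → x = y →
      (τ.putR .ang (8 * σ.iv .p + σ.iv .g) x).ra .ang =
      Function.update (σ.ra .ang) (8 * σ.iv .p + σ.iv .g) y := by
    rintro τ x _ h rfl; ext i; simp [Store.ra_putR, h, Function.update_apply]
  refine ⟨by omega, fun h => ⟨⟨hlo h, hw h⟩, ⟨hw h, by omega⟩, ⟨hw h, by omega⟩, by simp, fun h1 =>
    ⟨⟨trivial, trivial, h1.ne'⟩, by simp, fun h2 => ⟨trivial, by omega, trivial, ?_⟩,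
    fun h2 => ⟨by omega, trivial, ?_⟩⟩, fun h1 => ⟨by simp, fun h2 => ⟨trivial, by omega, trivial,
    ?_⟩, fun h2 => ⟨trivial, by omega, trivial, ?_⟩⟩⟩, fun h => ⟨trivial, by omega, trivial, ?_⟩⟩
  · refine hang _ _ _ rfl ?_
    simp only [Prod.fst_sub, Prod.snd_sub, h, h1, if_true]
    rw [max_eq_left h2.le]
  · refine hang _ _ _ rfl ?_
    simp only [Prod.fst_sub, Prod.snd_sub, h, h1, if_true]
    rw [max_eq_right (not_lt.1 h2)]
  · refine hang _ _ _ rfl ?_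
    simp only [Prod.fst_sub, Prod.snd_sub, h, h1, h2, hhp, if_true, if_false]
  · refine hang _ _ _ rfl ?_
    simp only [Prod.fst_sub, Prod.snd_sub, h, h1, h2, if_true, if_false]
  · refine hang _ _ _ rfl ?_
    simp only [h, if_false]

/-! ### The sweep over the sorted points -/

/-- Process the point with index `p`. -/
def sweepStep : Cmd := .block [
  .setI .p (.get .ord (.var .e)),
  .ite (.ilt (.lit 0) (.var .top)) search .skip,
  .ite (.ilt (.var .p) (.var .nR)) push record]

/-- Process all points in sorted order. -/
def sweep : Cmd := .block [.setI .top (.lit 0), .for .e .n sweepStep]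

/-- The number `a` is the maximal clipped angle of the directions from the point with index `p` to
the points ahead with indices less than `k`. -/
def IsMaxAngle (P : ℕ → ℝ × ℝ) (ε : ℝ) (k p : ℕ) (a : ℝ) : Prop :=
  0 ≤ a ∧ a ≤ π / 2 ∧ ∀ α, 0 ≤ α →
    (a ≤ α ↔ ∀ r < k, Ahead ε (P r - P p) → clipAngle (P r - P p) ≤ α)

/-- Discarding the end of the chain takes constant time: only `top` is lowered, and the stale cells
beyond it are never read. -/
theorem push_runs {N : ℕ} {σ : Store} {t : ℕ} (ht : σ.iv .top = t) (hp : σ.iv .p < N)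
    (htN : t + 2 < N) (hlo : 0 < t → σ.iv .lo < t) :
    Halts N push σ 1 fun τ => if 0 < t then
      τ.ia .stk = Function.update (σ.ia .stk) (σ.iv .lo + 1) (σ.iv .p) ∧
        τ.iv .top = σ.iv .lo + 2
      else τ.ia .stk = Function.update (σ.ia .stk) 0 (σ.iv .p) ∧ τ.iv .top = 1 := by
  apply Halts.of_wp le_rfl
  simp only [push, Cmd.block, Cmd.wp, TE.Legal, TE.Holds, IE.Legal, IE.eval,
    Store.iv_setI, Store.ia_setI, Store.iv_putI, if_true, ht]
  refine ⟨by omega, fun h => ⟨by omega, hp, by omega, ?_⟩, fun h => ⟨by omega, hp, by omega, ?_⟩⟩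
  · rw [if_pos h]
    refine ⟨?_, trivial⟩
    ext i; simp [Store.ia_putI, Function.update_apply]
  · rw [if_neg h]
    refine ⟨?_, trivial⟩
    ext i; simp [Store.ia_putI, Function.update_apply]

/-- The points with index less than `k` among the first `e` points in the order `o`. -/
def seen (P : ℕ → ℝ × ℝ) (o : ℕ → ℕ) (k e : ℕ) : Set (ℝ × ℝ) :=
  {z | ∃ i < e, o i < k ∧ z = P (o i)}

theorem seen_succ_of_lt (P : ℕ → ℝ × ℝ) (o : ℕ → ℕ) {k e : ℕ} (h : o e < k) :
    seen P o k (e + 1) = Insert.insert (P (o e)) (seen P o k e) := by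
  ext z
  constructor
  · rintro ⟨i, hi, h1, rfl⟩
    rcases Nat.lt_or_ge i e with h2 | h2
    · exact .inr ⟨i, h2, h1, rfl⟩
    · obtain rfl : i = e := by omega
      exact .inl rfl
  · rintro (rfl | ⟨i, hi, h1, rfl⟩)
    · exact ⟨e, by omega, h, rfl⟩
    · exact ⟨i, by omega, h1, rfl⟩

theorem seen_succ_of_ge (P : ℕ → ℝ × ℝ) (o : ℕ → ℕ) {k e : ℕ} (h : k ≤ o e) :
    seen P o k (e + 1) = seen P o k e := by
  ext z
  constructor
  · rintro ⟨i, hi, h1, rfl⟩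
    rcases Nat.lt_or_ge i e with h2 | h2
    · exact ⟨i, h2, h1, rfl⟩
    · obtain rfl : i = e := by omega
      omega
  · rintro ⟨i, hi, h1, rfl⟩
    exact ⟨i, by omega, h1, rfl⟩

/-- The order `o` lists the points such that all points ahead of a point precede it. -/
structure AheadOrder (P : ℕ → ℝ × ℝ) (ε : ℝ) (n : ℕ) (o : ℕ → ℕ) : Prop where
  lt : ∀ i < n, o i < n
  inj : ∀ i < n, ∀ j < n, o i = o j → i = j
  surj : ∀ w < n, ∃ i < n, o i = w
  ahead : ∀ i j, i < j → j < n → Ahead ε (P (o i) - P (o j))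
  of_ahead : ∀ i < n, ∀ j < n, Ahead ε (P (o i) - P (o j)) → i < j

/-- With keys `-x` and `s y`, lexicographic comparison is the relation `Ahead (-s)` on differences.
As the points are distinct, no two are tied, so the sorted order is strict. -/
theorem Sorts.aheadOrder {K T : ℕ → ℝ} {n : ℕ} {o : ℕ → ℕ} (h : Sorts K T n o)
    {P : ℕ → ℝ × ℝ} {s : ℝ} (hs : s ≠ 0) (hK : ∀ i < n, K i = -(P i).1)
    (hT : ∀ i < n, T i = s * (P i).2) (hP : ∀ i < n, ∀ j < n, P i = P j → i = j) :
    AheadOrder P (-s) n o := by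
  have key : ∀ a < n, ∀ b < n, Ahead (-s) (P a - P b) ↔ LexLT K T a b := by
    intro a ha b hb
    simp only [Ahead, LexLT, hK a ha, hK b hb, hT a ha, hT b hb, Prod.fst_sub, Prod.snd_sub]
    refine or_congr ⟨fun h => by linarith, fun h => by linarith⟩
      (and_congr ⟨fun h => by linarith, fun h => by linarith⟩
      ⟨fun h => by linarith, fun h => by linarith⟩)
  refine ⟨h.lt, h.inj, fun w hw => h.surj hw, fun i j hij hj => ?_, fun i hi j hj hij => ?_⟩
  · have hi := h.lt i (by omega)
    have hj' := h.lt j hj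
    rw [key _ hi _ hj']
    have h1 := h.sorted i j hij hj
    by_contra h2
    have h3 : P (o i) ≠ P (o j) := fun e => by
      have := h.inj i (by omega) j hj (hP _ hi _ hj' e); omega
    simp only [LexLT, not_or, not_and, not_lt, hK _ hi, hK _ hj', hT _ hi, hT _ hj'] at h1 h2
    have e1 : (P (o i)).1 = (P (o j)).1 := by linarith [h1.1, h2.1]
    have e2 : s * (P (o i)).2 = s * (P (o j)).2 :=
      le_antisymm (h1.2 (by rw [e1])) (h2.2 (by rw [e1]))
    exact h3 (Prod.ext e1 (mul_left_cancel₀ hs e2))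
  · rw [key _ (h.lt i hi) _ (h.lt j hj)] at hij
    by_contra h1
    rcases Nat.lt_or_ge j i with h2 | h2
    · exact h.sorted j i h2 hi hij
    · obtain rfl : i = j := by omega
      exact hij.asymm hij

/-- The state of the sweep after `e` points. -/
structure SweepInv (P : ℕ → ℝ × ℝ) (ε : ℝ) (o : ℕ → ℕ) (n k g e : ℕ) (A : ℕ → ℝ) (τ : Store) :
    Prop where
  top : τ.iv .top ≤ e
  stk : ∀ i < τ.iv .top, τ.ia .stk i < n
  chain : Chain ε (seen P o k e) (fun i => P (τ.ia .stk i)) (τ.iv .top)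
  empty : τ.iv .top = 0 → seen P o k e = ∅
  ang : ∀ i < e, k ≤ o i → IsMaxAngle P ε k (o i) (τ.ra .ang (8 * o i + g))
  other : ∀ j, j % 8 ≠ g → τ.ra .ang j = A j

/-- In the sweep order the points ahead of the current one are exactly its predecessors, so a
maximum over the red points seen is a maximum over all red points ahead. -/
theorem isMaxAngle_of_seen {P : ℕ → ℝ × ℝ} {ε : ℝ} {o : ℕ → ℕ} {n k e : ℕ}
    (ho : AheadOrder P ε n o) (hk : k ≤ n) (he : e < n) {a : ℝ} (h0 : 0 ≤ a) (h1 : a ≤ π / 2)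
    (h : ∀ α, 0 ≤ α → (a ≤ α ↔ ∀ s ∈ seen P o k e, clipAngle (s - P (o e)) ≤ α)) :
    IsMaxAngle P ε k (o e) a := by
  refine ⟨h0, h1, fun α hα => (h α hα).trans ⟨fun H r hr hA => ?_, ?_⟩⟩
  · obtain ⟨i, hi, rfl⟩ := ho.surj r (by omega)
    exact H _ ⟨i, ho.of_ahead i hi e he hA, hr, rfl⟩
  · rintro H _ ⟨i, hi, h2, rfl⟩
    exact H _ h2 (ho.ahead i e hi he)

/-- The tangent search serves both colours: a red point is put on the chain after its tangent point,
while a blue point records the tangent angle and leaves the chain alone. -/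
theorem sweepStep_runs {N : ℕ} {τ : Store} {P : ℕ → ℝ × ℝ} {ε : ℝ} {o : ℕ → ℕ} {n k g e L : ℕ}
    {A : ℕ → ℝ} (hI : SweepInv P ε o n k g e A τ) (ho : AheadOrder P ε n o) (hk : k ≤ n)
    (he : e < n) (hL : n < 2 ^ L) (hN : 8 * n + 20 < N) (hP : τ.pt = P) (ho' : τ.ia .ord = o)
    (hev : τ.iv .e = e) (hkv : τ.iv .nR = k) (hgv : τ.iv .g = g) (hg : g < 8)
    (hhp : τ.rv .hp = π / 2) :
    Halts N sweepStep τ (L + 1) fun υ => SweepInv P ε o n k g (e + 1) A υ := by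
  have hoe := ho.lt e he
  have htop := hI.top
  have hz : ∀ s ∈ seen P o k e, Ahead ε (s - P (o e)) := by
    rintro _ ⟨i, hi, h, rfl⟩; exact ho.ahead i e hi he
  simp only [sweepStep, Cmd.block]
  refine Halts.seq (Halts.of_wp (Q := fun υ => υ.iv .p = o e) (by omega) ?_) fun τ₁ hF₁ h₁ => ?_
  · simp [Cmd.wp, IE.Legal, IE.eval, Store.iv_setI, hev, ho']; omega
  have hP₁ : τ₁.pt = P := (Store.pt_congr (hF₁.ra .fx rfl) (hF₁.ra .fy rfl)).trans hP
  have ht₁ : τ₁.iv .top = τ.iv .top := hF₁.iv .top rfl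
  have hs₁ : τ₁.ia .stk = τ.ia .stk := hF₁.ia .stk rfl
  have hc₁ : τ₁.chain = fun i => P (τ.ia .stk i) := by ext i <;> simp [Store.chain, hP₁, hs₁]
  refine Halts.seq (R := fun υ => 0 < τ.iv .top →
      Chain.Tangent (P (o e)) (fun i => P (τ.ia .stk i)) (τ.iv .top) (υ.iv .lo))
    (Halts.ite (by omega) ⟨by simp only [IE.Legal]; omega, by simp only [IE.Legal]; omega⟩ ?_ ?_)
    fun τ₂ hF₂ h₂ => ?_
  · intro ht
    simp only [TE.Holds, IE.eval, ht₁] at ht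
    refine (search_runs ht₁ ht (ε := ε) (S := seen P o k e) (by omega : τ.iv .top < 2 ^ L)
      (by omega) (by omega) (fun i hi => ?_) ?_ ?_).conseq le_rfl fun υ _ h _ => ?_
    · rw [hs₁]; have := hI.stk i hi; omega
    · rw [hc₁]; exact hI.chain
    · rw [hP₁, h₁]; exact hz
    · rwa [hP₁, h₁, hc₁] at h
  · intro ht
    exact Halts.of_wp (by omega) fun h => absurd h (by simpa [TE.Holds, IE.eval, ht₁] using ht)
  have hp₂ : τ₂.iv .p = o e := (hF₂.iv .p rfl).trans h₁
  have hk₂ : τ₂.iv .nR = k := (hF₂.iv .nR rfl).trans ((hF₁.iv .nR rfl).trans hkv)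
  have hg₂ : τ₂.iv .g = g := (hF₂.iv .g rfl).trans ((hF₁.iv .g rfl).trans hgv)
  have ht₂ : τ₂.iv .top = τ.iv .top := (hF₂.iv .top rfl).trans ht₁
  have hs₂ : τ₂.ia .stk = τ.ia .stk := (hF₂.ia .stk rfl).trans hs₁
  have ha₂ : τ₂.ra .ang = τ.ra .ang := (hF₂.ra .ang rfl).trans (hF₁.ra .ang rfl)
  have hP₂ : τ₂.pt = P := (Store.pt_congr (hF₂.ra .fx rfl) (hF₂.ra .fy rfl)).trans hP₁
  have hhp₂ : τ₂.rv .hp = π / 2 := (hF₂.rv .hp rfl).trans ((hF₁.rv .hp rfl).trans hhp)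
  refine Halts.ite (by omega)
    ⟨by simp only [IE.Legal]; omega, by simp only [IE.Legal]; omega⟩ ?_ ?_
  · intro hlt
    simp only [TE.Holds, IE.eval, hp₂, hk₂] at hlt
    refine (push_runs ht₂ (by omega) (by omega) fun h => (h₂ h).lt).conseq (by omega)
      fun υ hFυ h => ?_
    have hang : υ.ra .ang = τ.ra .ang := (hFυ.ra .ang rfl).trans ha₂
    have hseen := seen_succ_of_lt P o hlt
    split_ifs at h with h0
    · obtain ⟨h3, h4⟩ := h
      rw [hs₂, hp₂] at h3
      have hT := h₂ h0
      have hlt' := hT.lt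
      refine ⟨by omega, fun i hi => ?_, ?_, fun h5 => by omega, fun i hi hki => ?_,
        fun j hj => by rw [hang]; exact hI.other j hj⟩
      · rw [h3, Function.update_apply]
        split_ifs
        · exact hoe
        · exact hI.stk i (by omega)
      · rw [hseen, h4, h3]
        have := hI.chain.insert hz hT
        convert this using 1
        ext i <;> simp only [Function.update_apply] <;> split_ifs <;> rfl
      · rw [hang]
        rcases Nat.lt_or_ge i e with h6 | h6
        · exact hI.ang i h6 hki
        · obtain rfl : i = e := by omega
          omega
    · obtain ⟨h3, h4⟩ := h
      rw [hs₂, hp₂] at h3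
      have hem := hI.empty (by omega)
      refine ⟨by omega, fun i hi => ?_, ?_, fun h5 => by omega, fun i hi hki => ?_,
        fun j hj => by rw [hang]; exact hI.other j hj⟩
      · obtain rfl : i = 0 := by omega
        rw [h3, Function.update_self]; exact hoe
      · rw [hseen, h4, h3, hem]
        have := Chain.singleton ε fun i => P (Function.update (τ.ia .stk) 0 (o e) i)
        rwa [Function.update_self, ← insert_empty_eq] at this
      · rw [hang]
        rcases Nat.lt_or_ge i e with h6 | h6
        · exact hI.ang i h6 hki
        · obtain rfl : i = e := by omega
          omega
  · intro hlt
    simp only [TE.Holds, IE.eval, hp₂, hk₂, not_lt] at hlt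
    have hseen := seen_succ_of_ge P o hlt
    refine (record_runs hhp₂ (by omega) (by omega) (by omega) (fun h => ?_) (fun h => ?_)).conseq
      (by omega) fun υ hFυ h => ?_
    · have := (h₂ (by omega)).lt; omega
    · rw [hs₂]; have := hI.stk _ (h₂ (by omega)).lt; omega
    rw [hp₂, hg₂, ht₂, ha₂, Store.chain, hP₂, hs₂] at h
    have htυ : υ.iv .top = τ.iv .top := (hFυ.iv .top rfl).trans ht₂
    have hsυ : υ.ia .stk = τ.ia .stk := (hFυ.ia .stk rfl).trans hs₂
    refine ⟨by omega, by rw [htυ, hsυ]; exact hI.stk, by rw [htυ, hsυ, hseen]; exact hI.chain,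
      by rw [htυ, hseen]; exact hI.empty, fun i hi hki => ?_, fun j hj => ?_⟩
    · rw [h]
      rcases Nat.lt_or_ge i e with h6 | h6
      · rw [Function.update_of_ne]
        · exact hI.ang i h6 hki
        · intro h7
          have := ho.inj i (by omega) e he (by omega)
          omega
      · obtain rfl : i = e := by omega
        rw [Function.update_self]
        split_ifs with h0
        · have hT := h₂ h0
          refine isMaxAngle_of_seen ho hk he (clipAngle_nonneg _) (clipAngle_le _) fun α hα =>
            ⟨fun h8 s hs => ?_, fun h8 => h8 _ (hI.chain.mem _ hT.lt)⟩
          exact (clipAngle_mono (hz s hs) (hz _ (hI.chain.mem _ hT.lt))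
            (hI.chain.max_of_tangent' hz hT s hs)).trans h8
        · refine isMaxAngle_of_seen ho hk he le_rfl (by positivity) fun α hα => ?_
          rw [hI.empty (by omega)]
          simp [hα]
    · rw [h, Function.update_of_ne (by omega)]
      exact hI.other j hj

theorem sweep_runs {N : ℕ} {σ : Store} {ε : ℝ} {n k g L : ℕ}
    (ho : AheadOrder σ.pt ε n (σ.ia .ord)) (hk : k ≤ n) (hL : n < 2 ^ L) (hN : 8 * n + 20 < N)
    (hnv : σ.iv .n = n) (hkv : σ.iv .nR = k) (hgv : σ.iv .g = g) (hg : g < 8)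
    (hhp : σ.rv .hp = π / 2) :
    Halts N sweep σ ((n + 1) * (L + 1)) fun τ =>
      (∀ p < n, k ≤ p → IsMaxAngle σ.pt ε k p (τ.ra .ang (8 * p + g))) ∧
      ∀ j, j % 8 ≠ g → τ.ra .ang j = σ.ra .ang j := by
  have hM : 1 ≤ (n + 1) * (L + 1) := Nat.mul_pos (by omega) (by omega)
  simp only [sweep, Cmd.block]
  refine Halts.seq (Halts.of_wp (Q := fun υ => υ.iv .top = 0) hM ?_) fun τ₁ hF₁ h₁ => ?_
  · simp [Cmd.wp, IE.Legal, IE.eval, Store.iv_setI]; omega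
  have hP₁ : τ₁.pt = σ.pt := Store.pt_congr (hF₁.ra .fx rfl) (hF₁.ra .fy rfl)
  refine Halts.conseq (Halts.for (L := L + 1) (b := n) (v := .e) (c := .n)
    (fun e τ => SweepInv σ.pt ε (σ.ia .ord) n k g e (σ.ra .ang) τ) (by omega) le_rfl (by simp)
    (by rfl) (by rfl) ((hF₁.iv .n rfl).trans hnv) (by omega) ?_ ?_) le_rfl fun τ hF h => ?_
  · refine ⟨by simp [Store.iv_setI, h₁], by simp [Store.iv_setI, h₁], ?_, fun _ => ?_, by simp,
      fun j _ => by rw [Store.ra_setI, hF₁.ra .ang rfl]⟩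
    · rw [show seen σ.pt (σ.ia .ord) k 0 = ∅ by simp [seen]]
      simp only [Store.iv_setI, reduceCtorEq, if_false, h₁]
      exact Chain.empty _ _
    · simp [seen]
  · intro e he τ hF hev hI
    refine (sweepStep_runs hI ho hk he hL hN
      ((Store.pt_congr (hF.ra .fx rfl) (hF.ra .fy rfl)).trans hP₁)
      ((hF.ia .ord rfl).trans (hF₁.ia .ord rfl)) hev
      ((hF.iv .nR rfl).trans ((hF₁.iv .nR rfl).trans hkv))
      ((hF.iv .g rfl).trans ((hF₁.iv .g rfl).trans hgv)) hg
      ((hF.rv .hp rfl).trans ((hF₁.rv .hp rfl).trans hhp))).conseq le_rfl fun υ hFυ h => ?_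
    exact ⟨by simpa [Store.iv_setI] using h.top, by simpa [Store.iv_setI, Store.ia_setI] using h.stk,
      by simpa [Store.iv_setI, Store.ia_setI] using h.chain, by simpa [Store.iv_setI] using h.empty, h.ang,
      h.other⟩
  · refine ⟨fun p hp hkp => ?_, h.other⟩
    obtain ⟨i, hi, rfl⟩ := ho.surj p hp
    exact h.ang i hi hkp

/-! ### Rotated and reflected frames, and the eight passes -/

/-- The coordinates of `p` after a clockwise rotation by `ψ` and a dilation by `s` of the first
axis. -/
noncomputable def frameVec (ψ s : ℝ) (p : ℝ × ℝ) : ℝ × ℝ :=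
  (s * (p.1 * cos ψ + p.2 * sin ψ), p.2 * cos ψ - p.1 * sin ψ)

/-- Inverting the rotation with `sin² + cos² = 1` recovers both coordinates. Distinct points thus
stay distinct, as the sweep order requires. -/
theorem frameVec_inj {ψ s : ℝ} (hs : s ≠ 0) {p q : ℝ × ℝ} (h : frameVec ψ s p = frameVec ψ s q) :
    p = q := by
  simp only [frameVec, Prod.mk.injEq] at h
  have h1 := mul_left_cancel₀ hs h.1
  have h2 := h.2
  have h3 := sin_sq_add_cos_sq ψ
  ext
  · linear_combination (-p.1 + q.1) * h3 + cos ψ * h1 - sin ψ * h2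
  · linear_combination (-p.2 + q.2) * h3 + sin ψ * h1 + cos ψ * h2

/-- The input point with index `i`. -/
def Store.pts (σ : Store) (i : ℕ) : ℝ × ℝ := (σ.ra .px i, σ.ra .py i)

/-- The sign that belongs to the number of a pass. -/
def passSign (g : ℕ) : ℝ := 1 - 2 * ((g - 2 * (g / 2) : ℕ) : ℝ)

theorem passSign_even (k : ℕ) : passSign (2 * k) = 1 := by
  simp [passSign]

theorem passSign_odd (k : ℕ) : passSign (2 * k + 1) = -1 := by
  rw [passSign, show (2 * k + 1) / 2 = k by omega, show 2 * k + 1 - 2 * k = 1 by omega]; norm_num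

theorem passSign_ne (g : ℕ) : passSign g ≠ 0 := by
  rcases Nat.even_or_odd' g with ⟨k, rfl | rfl⟩
  · rw [passSign_even]; norm_num
  · rw [passSign_odd]; norm_num

/-- Compute the coordinates and the sorting keys for a pass. -/
def setFrame : Cmd := .block [
  .setR .psi (.add (.var .phi) (.mul (.ofInt (.div (.var .g) (.lit 2))) (.var .hp))),
  .setR .cs (.cos (.var .psi)),
  .setR .sn (.sin (.var .psi)),
  .setR .sg (.sub (.lit 1) (.mul (.lit 2)
    (.ofInt (.sub (.var .g) (.mul (.lit 2) (.div (.var .g) (.lit 2))))))),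
  .setI .c (.var .n),
  .for .i .n (.block [
    .putR .fx (.var .i) (.mul (.var .sg) (.add (.mul (.get .px (.var .i)) (.var .cs))
      (.mul (.get .py (.var .i)) (.var .sn)))),
    .putR .fy (.var .i) (.sub (.mul (.get .py (.var .i)) (.var .cs))
      (.mul (.get .px (.var .i)) (.var .sn))),
    .putR .key (.var .i) (.sub (.lit 0) (.get .fx (.var .i))),
    .putR .tie (.var .i) (.mul (.var .sg) (.get .fy (.var .i)))])]

theorem setFrame_runs {N : ℕ} {σ : Store} {n g : ℕ} {φ : ℝ} (hn : σ.iv .n = n) (hg : σ.iv .g = g)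
    (hg8 : g < 8) (hN : n + 20 < N) (hφ : σ.rv .phi = φ) (hhp : σ.rv .hp = π / 2) :
    Halts N setFrame σ (n + 1) fun τ => τ.iv .c = n ∧
      ∀ i < n, τ.pt i = frameVec (φ + (g / 2 : ℕ) * (π / 2)) (passSign g) (σ.pts i) ∧
        τ.ra .key i = -(τ.pt i).1 ∧ τ.ra .tie i = passSign g * (τ.pt i).2 := by
  simp only [setFrame, Cmd.block]
  refine Halts.seq (Halts.of_wp (Q := fun υ => υ.rv .psi = φ + (g / 2 : ℕ) * (π / 2)) (by omega) ?_)
    fun τ₁ hF₁ h₁ => ?_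
  · simp [Cmd.wp, RE.Legal, IE.Legal, RE.eval, IE.eval, Store.rv_setR, hg, hφ, hhp]; omega
  refine Halts.seq (Halts.of_wp (Q := fun υ => υ.rv .cs = cos (τ₁.rv .psi)) (by omega) ?_)
    fun τ₂ hF₂ h₂ => ?_
  · simp [Cmd.wp, RE.Legal, RE.eval, Store.rv_setR]
  refine Halts.seq (Halts.of_wp (Q := fun υ => υ.rv .sn = sin (τ₁.rv .psi)) (by omega) ?_)
    fun τ₃ hF₃ h₃ => ?_
  · simp [Cmd.wp, RE.Legal, RE.eval, Store.rv_setR, hF₂.rv .psi rfl]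
  refine Halts.seq (Halts.of_wp (Q := fun υ => υ.rv .sg = passSign g) (by omega) ?_)
    fun τ₄ hF₄ h₄ => ?_
  · have hg₃ : τ₃.iv .g = g :=
      (hF₃.iv .g rfl).trans ((hF₂.iv .g rfl).trans ((hF₁.iv .g rfl).trans hg))
    simp [Cmd.wp, RE.Legal, IE.Legal, RE.eval, IE.eval, Store.rv_setR, hg₃, passSign]; omega
  have hn₄ : τ₄.iv .n = n := (hF₄.iv .n rfl).trans
    ((hF₃.iv .n rfl).trans ((hF₂.iv .n rfl).trans ((hF₁.iv .n rfl).trans hn)))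
  refine Halts.seq (Halts.of_wp (Q := fun υ => υ.iv .c = n) (by omega) ?_) fun τ₅ hF₅ h₅ => ?_
  · simp [Cmd.wp, IE.Legal, IE.eval, Store.iv_setI, hn₄]; omega
  have hcs : τ₅.rv .cs = cos (φ + (g / 2 : ℕ) * (π / 2)) := by
    rw [hF₅.rv .cs rfl, hF₄.rv .cs rfl, hF₃.rv .cs rfl, h₂, h₁]
  have hsn : τ₅.rv .sn = sin (φ + (g / 2 : ℕ) * (π / 2)) := by
    rw [hF₅.rv .sn rfl, hF₄.rv .sn rfl, h₃, h₁]
  have hsg : τ₅.rv .sg = passSign g := by rw [hF₅.rv .sg rfl, h₄]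
  have hpx : τ₅.ra .px = σ.ra .px := by
    rw [hF₅.ra .px rfl, hF₄.ra .px rfl, hF₃.ra .px rfl, hF₂.ra .px rfl, hF₁.ra .px rfl]
  have hpy : τ₅.ra .py = σ.ra .py := by
    rw [hF₅.ra .py rfl, hF₄.ra .py rfl, hF₃.ra .py rfl, hF₂.ra .py rfl, hF₁.ra .py rfl]
  refine Halts.conseq (Halts.for (L := 1) (b := n) (M := n + 1) (v := .i) (c := .n)
    (fun k τ => ∀ i < k,
      τ.pt i = frameVec (φ + (g / 2 : ℕ) * (π / 2)) (passSign g) (σ.pts i) ∧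
        τ.ra .key i = -(τ.pt i).1 ∧ τ.ra .tie i = passSign g * (τ.pt i).2) le_rfl (by omega)
    (by simp) (by rfl) (by rfl) ((hF₅.iv .n rfl).trans hn₄) (by omega) (by simp) ?_) le_rfl
    fun τ hF h => ⟨(hF.iv .c rfl).trans h₅, h⟩
  intro k hk τ hF hv hI
  apply Halts.of_wp le_rfl
  simp only [Cmd.wp, RE.Legal, IE.Legal, RE.eval, IE.eval, Store.iv_putR, Store.rv_putR,
    Store.ra_putR, Store.ra_setI, Store.pt, reduceCtorEq, if_true, if_false, hv,
    hF.rv .cs rfl, hF.rv .sn rfl, hF.rv .sg rfl, hF.ra .px rfl, hF.ra .py rfl, hcs, hsn, hsg, hpx,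
    hpy]
  refine ⟨by omega, by simp; omega, by omega, by simp; omega, by omega, by simp; omega, by omega,
    by simp; omega, fun i hi => ?_⟩
  by_cases h : i = k
  · simp [h, frameVec, Store.pts]
  · simpa [h, Store.pt] using hI i (by omega)

/-- One pass: compute the clipped angles at all blue points for one frame. -/
def pass : Cmd := .block [setFrame, sort, sweep]

/-- The result of the pass with number `g`. -/
def PassResult (φ : ℝ) (P : ℕ → ℝ × ℝ) (k n g : ℕ) (A : ℕ → ℝ) : Prop :=
  ∀ p < n, k ≤ p → IsMaxAngle (fun i => frameVec (φ + (g / 2 : ℕ) * (π / 2)) (passSign g) (P i))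
    (-passSign g) k p (A (8 * p + g))

/-- Pass `g` writes only to indices congruent to `g` modulo 8, so the results of earlier passes
survive. -/
theorem pass_runs {N : ℕ} {σ : Store} {n k g L : ℕ} {φ : ℝ} (hn : σ.iv .n = n)
    (hkv : σ.iv .nR = k) (hk : k ≤ n) (hg : σ.iv .g = g) (hg8 : g < 8) (hL : n < 2 ^ L)
    (hN : 8 * n + 20 < N) (hφ : σ.rv .phi = φ) (hhp : σ.rv .hp = π / 2)
    (hP : ∀ i < n, ∀ j < n, σ.pts i = σ.pts j → i = j) :
    Halts N pass σ ((n + 1) * (L + 1)) fun τ => PassResult φ σ.pts k n g (τ.ra .ang) ∧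
      ∀ j, j % 8 ≠ g → τ.ra .ang j = σ.ra .ang j := by
  have hM : n + 1 ≤ (n + 1) * (L + 1) := Nat.le_mul_of_pos_right _ (by omega)
  simp only [pass, Cmd.block]
  refine Halts.seq ((setFrame_runs hn hg hg8 (by omega) hφ hhp).conseq hM fun _ _ h => h)
    fun τ₁ hF₁ h₁ => ?_
  refine Halts.seq (sort_runs h₁.1 (by omega) hL) fun τ₂ hF₂ h₂ => ?_
  have hpt : τ₂.pt = τ₁.pt := Store.pt_congr (hF₂.ra .fx rfl) (hF₂.ra .fy rfl)
  have ho : AheadOrder τ₂.pt (-passSign g) n (τ₂.ia .ord) := by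
    rw [hpt]
    refine h₂.aheadOrder (passSign_ne g) (fun i hi => (h₁.2 i hi).2.1)
      (fun i hi => (h₁.2 i hi).2.2) fun i hi j hj hij => hP i hi j hj ?_
    rw [(h₁.2 i hi).1, (h₁.2 j hj).1] at hij
    exact frameVec_inj (passSign_ne g) hij
  refine (sweep_runs ho hk hL hN ((hF₂.iv .n rfl).trans ((hF₁.iv .n rfl).trans hn))
    ((hF₂.iv .nR rfl).trans ((hF₁.iv .nR rfl).trans hkv))
    ((hF₂.iv .g rfl).trans ((hF₁.iv .g rfl).trans hg)) hg8
    ((hF₂.rv .hp rfl).trans ((hF₁.rv .hp rfl).trans hhp))).conseq le_rfl fun τ hF h =>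
    ⟨fun p hp hkp => ?_, fun j hj => ?_⟩
  · obtain ⟨h3, h4, h5⟩ := h.1 p hp hkp
    refine ⟨h3, h4, fun α hα => (h5 α hα).trans (forall₂_congr fun r hr => ?_)⟩
    rw [hpt, (h₁.2 r (by omega)).1, (h₁.2 p hp).1]
  · rw [h.2 j hj, hF₂.ra .ang rfl, hF₁.ra .ang rfl]

/-- All passes. -/
def passes : Cmd := .block [.setI .j (.lit 8), .for .g .j pass]

theorem passes_runs {N : ℕ} {σ : Store} {n k L : ℕ} {φ : ℝ} (hn : σ.iv .n = n)
    (hkv : σ.iv .nR = k) (hk : k ≤ n) (hL : n < 2 ^ L)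
    (hN : 8 * n + 20 < N) (hφ : σ.rv .phi = φ) (hhp : σ.rv .hp = π / 2)
    (hP : ∀ i < n, ∀ j < n, σ.pts i = σ.pts j → i = j) :
    Halts N passes σ (9 * ((n + 1) * (L + 1))) fun τ =>
      ∀ g < 8, PassResult φ σ.pts k n g (τ.ra .ang) := by
  have hM : 1 ≤ (n + 1) * (L + 1) := Nat.mul_pos (by omega) (by omega)
  simp only [passes, Cmd.block]
  refine Halts.seq (Halts.of_wp (Q := fun υ => υ.iv .j = 8) (by omega) ?_) fun τ₁ hF₁ h₁ => ?_
  · simp [Cmd.wp, IE.Legal, IE.eval, Store.iv_setI]; omega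
  refine Halts.for (L := (n + 1) * (L + 1)) (b := 8) (v := .g) (c := .j)
    (fun g τ => ∀ g' < g, PassResult φ σ.pts k n g' (τ.ra .ang)) hM le_rfl (by simp)
    (by rfl) (by rfl) h₁ (by omega) (by simp) ?_
  intro g hg τ hF hgv hI
  have hpts : τ.pts = σ.pts := by
    ext i <;> simp [Store.pts, hF.ra .px rfl, hF.ra .py rfl, hF₁.ra .px rfl, hF₁.ra .py rfl]
  have := pass_runs (N := N) (σ := τ) (k := k) (φ := φ)
    ((hF.iv .n rfl).trans ((hF₁.iv .n rfl).trans hn))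
    ((hF.iv .nR rfl).trans ((hF₁.iv .nR rfl).trans hkv)) hk hgv hg hL hN
    ((hF.rv .phi rfl).trans ((hF₁.rv .phi rfl).trans hφ))
    ((hF.rv .hp rfl).trans ((hF₁.rv .hp rfl).trans hhp)) (by rwa [hpts])
  refine this.conseq le_rfl fun υ _ h g' hg' => ?_
  rw [hpts] at h
  rw [Store.ra_setI]
  rcases Nat.lt_or_ge g' g with h2 | h2
  · intro p hp hkp
    rw [h.2 _ (by omega)]
    exact hI g' h2 p hp hkp
  · obtain rfl : g = g' := by omega
    exact h.1

/-! ### The complement of a union of open intervals -/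

/-- The output after `e` open intervals `(L i, R i)` in the order of their left endpoints have been
removed: the array `A` holds the endpoints of `m` closed intervals, and the endpoint `x` of the
removed part has been reached. -/
structure OutInv (L R : ℕ → ℝ) (e : ℕ) (x : ℝ) (m : ℕ) (A : ℕ → ℝ) : Prop where
  nonneg : 0 ≤ x
  count : m ≤ e
  bounds : ∀ i < m, 0 ≤ A (2 * i) ∧ A (2 * i) ≤ A (2 * i + 1) ∧ A (2 * i) < 2 * π ∧
    A (2 * i + 1) ≤ 2 * π
  sep : ∀ i, i + 1 < m → A (2 * i + 1) < A (2 * (i + 1))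
  lt : ∀ i < m, A (2 * i + 1) < x
  cover : ∀ i < m, ∃ k < e, A (2 * i + 1) ≤ L k
  right : ∀ k < e, R k ≤ x
  mem_iff : ∀ θ, 0 ≤ θ → θ < 2 * π → θ < x →
    ((∃ i < m, θ ∈ Icc (A (2 * i)) (A (2 * i + 1))) ↔ ∀ k < e, θ ∉ Ioo (L k) (R k))

namespace OutInv

variable {L R : ℕ → ℝ} {e m : ℕ} {x : ℝ} {A A' : ℕ → ℝ}

/-- The case `x = L e` is included: two abutting open intervals leave a single admissible angle
between them, which is output as a degenerate closed interval. -/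
theorem emit (h : OutInv L R e x m A) (hLR : L e < R e) (hL2 : L e ≤ 2 * π)
    (hx : x ≤ L e) (hx2 : x < 2 * π) (hA : ∀ i < 2 * m, A' i = A i) (h1 : A' (2 * m) = x)
    (h2 : A' (2 * m + 1) = L e) : OutInv L R (e + 1) (R e) (m + 1) A' := by
  have hold : ∀ i < m, A' (2 * i) = A (2 * i) ∧ A' (2 * i + 1) = A (2 * i + 1) := fun i hi =>
    ⟨hA _ (by omega), hA _ (by omega)⟩
  have hcase : ∀ i < m + 1, i < m ∨ i = m := fun i hi => by omega
  have hcase' : ∀ i < e + 1, i < e ∨ i = e := fun i hi => by omega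
  have h0 := h.nonneg
  refine ⟨by linarith, by have := h.count; omega, fun i hi => ?_, fun i hi => ?_, fun i hi => ?_,
    fun i hi => ?_, fun k hk => ?_, fun θ hθ0 hθ2 hθ => ?_⟩
  · rcases hcase i hi with hi | rfl
    · rw [(hold i hi).1, (hold i hi).2]; exact h.bounds i hi
    · rw [h1, h2]; exact ⟨h0, hx, hx2, hL2⟩
  · rw [(hold i (by omega)).2]
    rcases hcase (i + 1) hi with hi | hi
    · rw [(hold _ hi).1]; exact h.sep i hi
    · rw [hi, h1]; exact h.lt i (by omega)
  · rcases hcase i hi with hi | rfl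
    · rw [(hold i hi).2]; have := h.lt i hi; linarith
    · rw [h2]; exact hLR
  · rcases hcase i hi with hi | rfl
    · obtain ⟨k, hk, hk'⟩ := h.cover i hi
      exact ⟨k, by omega, by rwa [(hold i hi).2]⟩
    · exact ⟨e, by omega, h2.le⟩
  · rcases hcase' k hk with hk | rfl
    · have := h.right k hk; linarith
    · exact le_rfl
  · rcases lt_or_ge θ x with hlt | hge
    · have hm := h.mem_iff θ hθ0 hθ2 hlt
      constructor
      · rintro ⟨i, hi, hi'⟩ k hk
        rcases hcase i hi with hi | rfl
        · rw [(hold i hi).1, (hold i hi).2] at hi'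
          rcases hcase' k hk with hk | rfl
          · exact hm.1 ⟨i, hi, hi'⟩ k hk
          · exact fun hk' => by linarith [hk'.1]
        · rw [h1] at hi'; linarith [hi'.1]
      · intro hk
        obtain ⟨i, hi, hi'⟩ := hm.2 fun k hk' => hk k (by omega)
        exact ⟨i, by omega, by rwa [(hold i hi).1, (hold i hi).2]⟩
    · constructor
      · rintro ⟨i, hi, hi'⟩ k hk
        rcases hcase i hi with hi | rfl
        · rw [(hold i hi).1, (hold i hi).2] at hi'
          linarith [hi'.2, h.lt i hi]
        · rw [h2] at hi'
          rcases hcase' k hk with hk | rfl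
          · exact fun hk' => by linarith [hk'.2, h.right k hk]
          · exact fun hk' => by linarith [hk'.1, hi'.2]
      · intro hk
        refine ⟨m, by omega, ?_⟩
        rw [h1, h2]
        refine ⟨hge, ?_⟩
        by_contra hlt
        exact hk e (by omega) ⟨not_le.1 hlt, hθ⟩

/-- The order of the left endpoints guarantees that the new open interval meets no closed interval
already written, as each of those ends at or before some earlier left endpoint. -/
theorem skip (h : OutInv L R e x m A) (hs : ∀ k < e, L k ≤ L e) (hx : L e < x ∨ 2 * π ≤ x) :
    OutInv L R (e + 1) (max x (R e)) m A := by
  have hcase' : ∀ i < e + 1, i < e ∨ i = e := fun i hi => by omega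
  refine ⟨h.nonneg.trans (le_max_left _ _), by have := h.count; omega, h.bounds, h.sep,
    fun i hi => (h.lt i hi).trans_le (le_max_left _ _), fun i hi => ?_, fun k hk => ?_,
    fun θ hθ0 hθ2 hθ => ?_⟩
  · obtain ⟨k, hk, hk'⟩ := h.cover i hi
    exact ⟨k, by omega, hk'⟩
  · rcases hcase' k hk with hk | rfl
    · exact (h.right k hk).trans (le_max_left _ _)
    · exact le_max_right _ _
  · rcases lt_or_ge θ x with hlt | hge
    · rw [h.mem_iff θ hθ0 hθ2 hlt]
      refine ⟨fun H k hk => ?_, fun H k hk => H k (by omega)⟩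
      rcases hcase' k hk with hk | rfl
      · exact H k hk
      · obtain ⟨i, hi, hi'⟩ := (h.mem_iff θ hθ0 hθ2 hlt).2 H
        obtain ⟨k, hk, hk'⟩ := h.cover i hi
        exact fun hc => by linarith [hc.1, hi'.2, hs k hk]
    · constructor
      · rintro ⟨i, hi, hi'⟩
        linarith [hi'.2, h.lt i hi]
      · intro H
        rcases lt_max_iff.1 hθ with h3 | h3
        · linarith
        · rcases hx with hx | hx
          · exact absurd ⟨by linarith, h3⟩ (H e (by omega))
          · linarith

/-- The final output lists the complement of the open intervals in `[0, 2π)`. -/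
theorem finish (h : OutInv L R e x m A) (hx : 2 * π ≤ x) :
    (∀ i, i + 1 < m → A (2 * i + 1) < A (2 * (i + 1))) ∧
    {θ | θ ∈ Ico 0 (2 * π) ∧ ∀ k < e, θ ∉ Ioo (L k) (R k)} =
      {θ | θ ∈ Ico 0 (2 * π) ∧ ∃ i < m, θ ∈ Icc (A (2 * i)) (A (2 * i + 1))} := by
  refine ⟨h.sep, ?_⟩
  ext θ
  exact and_congr_right fun hθ => (h.mem_iff θ hθ.1 hθ.2 (by linarith [hθ.2])).symm

theorem congr (h : OutInv L R e x m A) {L' R' : ℕ → ℝ} (hL : ∀ k < e, L' k = L k)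
    (hR : ∀ k < e, R' k = R k) : OutInv L' R' e x m A := by
  refine ⟨h.nonneg, h.count, h.bounds, h.sep, h.lt, fun i hi => ?_, fun k hk => ?_,
    fun θ h0 h1 h2 => (h.mem_iff θ h0 h1 h2).trans (forall₂_congr fun k hk => ?_)⟩
  · obtain ⟨k, hk, hk'⟩ := h.cover i hi
    exact ⟨k, hk, by rwa [hL k hk]⟩
  · rw [hR k hk]; exact h.right k hk
  · rw [hL k hk, hR k hk]

/-- The final output when the interval up to `2π` remains to be added. -/
theorem finish_emit (h : OutInv L R e x m A) (hx : x < 2 * π) (hA : ∀ i < 2 * m, A' i = A i)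
    (h1 : A' (2 * m) = x) (h2 : A' (2 * m + 1) = 2 * π) :
    (∀ i < m + 1, 0 ≤ A' (2 * i) ∧ A' (2 * i) ≤ A' (2 * i + 1) ∧ A' (2 * i) < 2 * π ∧
      A' (2 * i + 1) ≤ 2 * π) ∧
    (∀ i, i + 1 < m + 1 → A' (2 * i + 1) < A' (2 * (i + 1))) ∧
    {θ | θ ∈ Ico 0 (2 * π) ∧ ∀ k < e, θ ∉ Ioo (L k) (R k)} =
      {θ | θ ∈ Ico 0 (2 * π) ∧ ∃ i < m + 1, θ ∈ Icc (A' (2 * i)) (A' (2 * i + 1))} := by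
  -- The last interval is emitted by appending the fictitious open interval `(2π, 2π + 1)`, which
  -- meets no angle under consideration.
  have hc := h.congr (L' := Function.update L e (2 * π)) (R' := Function.update R e (2 * π + 1))
    (fun k hk => Function.update_of_ne (by omega) _ _)
    (fun k hk => Function.update_of_ne (by omega) _ _)
  have := hc.emit (by simp) (by simp) (by simpa using hx.le) hx hA h1 (by simpa using h2)
  have hf := this.finish (by simp)
  refine ⟨this.bounds, hf.1, ?_⟩
  rw [← hf.2]
  ext θ
  refine and_congr_right fun hθ => ⟨fun H k hk => ?_, fun H k hk => ?_⟩
  · rcases Nat.lt_or_ge k e with hk' | hk'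
    · rw [Function.update_of_ne (by omega), Function.update_of_ne (by omega)]; exact H k hk'
    · obtain rfl : k = e := by omega
      rw [Function.update_self]
      exact fun h3 => by linarith [h3.1, hθ.2]
  · have := H k (by omega)
    rwa [Function.update_of_ne (by omega), Function.update_of_ne (by omega)] at this

theorem init (L R : ℕ → ℝ) (A : ℕ → ℝ) : OutInv L R 0 0 0 A :=
  ⟨le_rfl, le_rfl, by simp, by simp, by simp, by simp, by simp, fun θ h _ h' => by linarith⟩

end OutInv

/-- Append an interval to the output. -/
def emit (l r : RVar) : Cmd := .block [
  .putR .io (.mul (.lit 2) (.var .m)) (.var l),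
  .putR .io (.add (.mul (.lit 2) (.var .m)) (.lit 1)) (.var r),
  .setI .m (.add (.var .m) (.lit 1))]

theorem emit_runs {N : ℕ} {σ : Store} {l r : RVar} {m : ℕ} (hm : σ.iv .m = m)
    (hN : 2 * m + 2 < N) : Halts N (emit l r) σ 1 fun τ => τ.iv .m = m + 1 ∧
      (∀ i < 2 * m, τ.ra .io i = σ.ra .io i) ∧ τ.ra .io (2 * m) = σ.rv l ∧
      τ.ra .io (2 * m + 1) = σ.rv r := by
  apply Halts.of_wp le_rfl
  simp only [emit, Cmd.block, Cmd.wp, RE.Legal, IE.Legal, RE.eval, IE.eval, Store.iv_putR,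
    Store.rv_putR, Store.iv_setI, Store.ra_setI, Store.ra_putR, hm, if_true]
  refine ⟨by omega, trivial, by omega, trivial, by omega, trivial, fun i hi => ?_, ?_, trivial⟩
  · rw [if_neg (by omega), if_neg (by omega)]
  · rw [if_neg (by omega)]

/-- Process the open interval with number `e` in the sorted order. -/
def outStep : Cmd := .block [
  .setI .w (.get .ord (.var .e)),
  .setR .l (.get .key (.var .w)),
  .setR .r (.get .tie (.var .w)),
  .ite (.and (.not (.rlt (.var .l) (.var .cur))) (.rlt (.var .cur) (.var .y)))
    (emit .cur .l) .skip,
  .ite (.rlt (.var .cur) (.var .r)) (.setR .cur (.var .r)) .skip]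

/-- Output the complement of the sorted open intervals. -/
def output : Cmd := .block [
  .setI .m (.lit 0),
  .setR .cur (.lit 0),
  .setR .y (.mul (.lit 4) (.var .hp)),
  .for .e .c outStep,
  .ite (.rlt (.var .cur) (.var .y)) (emit .cur .y) .skip]

theorem outStep_runs {N : ℕ} {σ : Store} {L R : ℕ → ℝ} {e c : ℕ}
    (hI : OutInv L R e (σ.rv .cur) (σ.iv .m) (σ.ra .io)) (he : σ.iv .e = e) (hec : e < c)
    (hN : 2 * c + 2 < N) (ho : σ.ia .ord e < c) (hL : σ.ra .key (σ.ia .ord e) = L e)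
    (hR : σ.ra .tie (σ.ia .ord e) = R e) (hy : σ.rv .y = 2 * π) (hLR : L e < R e)
    (hL2 : L e ≤ 2 * π) (hs : ∀ k < e, L k ≤ L e) :
    Halts N outStep σ 1 fun τ => OutInv L R (e + 1) (τ.rv .cur) (τ.iv .m) (τ.ra .io) := by
  have hcnt := hI.count
  simp only [outStep, Cmd.block]
  refine Halts.seq (Halts.of_wp (Q := fun υ => υ.iv .w = σ.ia .ord e) le_rfl ?_) fun τ₁ hF₁ h₁ => ?_
  · simp [Cmd.wp, IE.Legal, IE.eval, Store.iv_setI, he]; omega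
  refine Halts.seq (Halts.of_wp (Q := fun υ => υ.rv .l = L e) le_rfl ?_) fun τ₂ hF₂ h₂ => ?_
  · simp [Cmd.wp, RE.Legal, IE.Legal, RE.eval, IE.eval, Store.rv_setR, h₁, hF₁.ra .key rfl, hL]
    omega
  have hw₂ : τ₂.iv .w = σ.ia .ord e := (hF₂.iv .w rfl).trans h₁
  refine Halts.seq (Halts.of_wp (Q := fun υ => υ.rv .r = R e) le_rfl ?_) fun τ₃ hF₃ h₃ => ?_
  · simp [Cmd.wp, RE.Legal, IE.Legal, RE.eval, IE.eval, Store.rv_setR, hw₂, hF₂.ra .tie rfl,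
      hF₁.ra .tie rfl, hR]
    omega
  have hl₃ : τ₃.rv .l = L e := (hF₃.rv .l rfl).trans h₂
  have hcur : τ₃.rv .cur = σ.rv .cur := by
    rw [hF₃.rv .cur rfl, hF₂.rv .cur rfl, hF₁.rv .cur rfl]
  have hm : τ₃.iv .m = σ.iv .m := by rw [hF₃.iv .m rfl, hF₂.iv .m rfl, hF₁.iv .m rfl]
  have hy₃ : τ₃.rv .y = 2 * π := by rw [hF₃.rv .y rfl, hF₂.rv .y rfl, hF₁.rv .y rfl, hy]
  have hio : τ₃.ra .io = σ.ra .io := by rw [hF₃.ra .io rfl, hF₂.ra .io rfl, hF₁.ra .io rfl]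
  refine Halts.seq (R := fun υ => υ.rv .cur = σ.rv .cur ∧ υ.rv .r = R e ∧
      OutInv L R (e + 1) (max (σ.rv .cur) (R e)) (υ.iv .m) (υ.ra .io))
    (Halts.ite le_rfl ⟨⟨trivial, trivial⟩, trivial, trivial⟩ ?_ ?_) fun τ₄ hF₄ h₄ => ?_
  · intro hc
    simp only [TE.Holds, RE.eval, hl₃, hcur, hy₃, not_lt] at hc
    refine (emit_runs (m := σ.iv .m) hm (by omega)).conseq le_rfl fun υ hF ⟨h5, h6, h7, h8⟩ =>
      ⟨(hF.rv .cur rfl).trans hcur, (hF.rv .r rfl).trans h₃, ?_⟩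
    rw [max_eq_right (hc.1.trans hLR.le), h5]
    exact hI.emit hLR hL2 hc.1 hc.2 (fun i hi => by rw [h6 i hi, hio]) (by rw [h7, hcur])
      (by rw [h8, hl₃])
  · intro hc
    simp only [TE.Holds, RE.eval, hl₃, hcur, hy₃, not_lt] at hc
    refine Halts.of_wp le_rfl ⟨hcur, h₃, ?_⟩
    rw [hm, hio]
    refine hI.skip hs ?_
    by_contra! hcon
    exact hc hcon
  · obtain ⟨h5, h6, h7⟩ := h₄
    apply Halts.of_wp le_rfl
    simp only [Cmd.wp, TE.Legal, RE.Legal, TE.Holds, RE.eval, h5, h6, Store.rv_setR, Store.iv_setR,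
      Store.ra_setR, if_true, and_self, true_and]
    constructor
    · intro h8; rwa [max_eq_right h8.le] at h7
    · intro h8; rwa [max_eq_left (not_lt.1 h8)] at h7

theorem output_runs {N : ℕ} {σ : Store} {c : ℕ} (hc : σ.iv .c = c) (hN : 2 * c + 4 < N)
    (hhp : σ.rv .hp = π / 2) (ho : Sorts (σ.ra .key) (σ.ra .tie) c (σ.ia .ord))
    (hLR : ∀ i < c, σ.ra .key i < σ.ra .tie i) (hL2 : ∀ i < c, σ.ra .key i ≤ 2 * π) :
    Halts N output σ (c + 1) fun τ => τ.iv .m ≤ c + 1 ∧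
      (∀ i < τ.iv .m, 0 ≤ τ.ra .io (2 * i) ∧ τ.ra .io (2 * i) ≤ τ.ra .io (2 * i + 1) ∧
        τ.ra .io (2 * i) < 2 * π ∧ τ.ra .io (2 * i + 1) ≤ 2 * π) ∧
      (∀ i, i + 1 < τ.iv .m → τ.ra .io (2 * i + 1) < τ.ra .io (2 * (i + 1))) ∧
      {θ | θ ∈ Ico 0 (2 * π) ∧ ∀ k < c, θ ∉ Ioo (σ.ra .key k) (σ.ra .tie k)} =
        {θ | θ ∈ Ico 0 (2 * π) ∧ ∃ i < τ.iv .m,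
          θ ∈ Icc (τ.ra .io (2 * i)) (τ.ra .io (2 * i + 1))} := by
  simp only [output, Cmd.block]
  refine Halts.seq (Halts.of_wp (Q := fun υ => υ.iv .m = 0) (by omega) ?_) fun τ₁ hF₁ h₁ => ?_
  · simp [Cmd.wp, IE.Legal, IE.eval, Store.iv_setI]; omega
  refine Halts.seq (Halts.of_wp (Q := fun υ => υ.rv .cur = 0) (by omega) ?_) fun τ₂ hF₂ h₂ => ?_
  · simp [Cmd.wp, RE.Legal, RE.eval, Store.rv_setR]
  refine Halts.seq (Halts.of_wp (Q := fun υ => υ.rv .y = 2 * π) (by omega) ?_) fun τ₃ hF₃ h₃ => ?_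
  · simp [Cmd.wp, RE.Legal, RE.eval, Store.rv_setR, hF₂.rv .hp rfl, hF₁.rv .hp rfl, hhp]; ring
  have hord : τ₃.ia .ord = σ.ia .ord := by
    rw [hF₃.ia .ord rfl, hF₂.ia .ord rfl, hF₁.ia .ord rfl]
  have hkey : τ₃.ra .key = σ.ra .key := by
    rw [hF₃.ra .key rfl, hF₂.ra .key rfl, hF₁.ra .key rfl]
  have htie : τ₃.ra .tie = σ.ra .tie := by
    rw [hF₃.ra .tie rfl, hF₂.ra .tie rfl, hF₁.ra .tie rfl]
  have hc₃ : τ₃.iv .c = c := by rw [hF₃.iv .c rfl, hF₂.iv .c rfl, hF₁.iv .c rfl, hc]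
  -- The sorting permutation is onto, so passing to sorted indices does not change the union of the
  -- open intervals.
  have hset : {θ | θ ∈ Ico 0 (2 * π) ∧ ∀ k < c, θ ∉ Ioo (σ.ra .key k) (σ.ra .tie k)} =
      {θ | θ ∈ Ico 0 (2 * π) ∧ ∀ k < c, θ ∉ Ioo (σ.ra .key (σ.ia .ord k))
        (σ.ra .tie (σ.ia .ord k))} := by
    ext θ
    refine and_congr_right fun _ => ⟨fun h k hk => h _ (ho.lt k hk), fun h k hk => ?_⟩
    obtain ⟨i, hi, rfl⟩ := ho.surj hk
    exact h i hi
  refine Halts.seq (Halts.for (L := 1) (b := c) (v := .e) (c := .c) (fun e τ =>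
    OutInv (fun k => σ.ra .key (σ.ia .ord k)) (fun k => σ.ra .tie (σ.ia .ord k)) e (τ.rv .cur)
      (τ.iv .m) (τ.ra .io)) le_rfl (by omega) (by simp) (by rfl) (by rfl) hc₃ (by omega) ?_ ?_)
    fun τ₄ hF₄ h₄ => ?_
  · rw [Store.rv_setI, Store.ra_setI, Store.iv_setI, if_neg (by simp), hF₃.rv .cur rfl, h₂,
      hF₃.iv .m rfl, hF₂.iv .m rfl, h₁]
    exact OutInv.init _ _ _
  · intro e he τ hF hev hI
    have hord' : τ.ia .ord = σ.ia .ord := (hF.ia .ord rfl).trans hord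
    have hkey' : τ.ra .key = σ.ra .key := (hF.ra .key rfl).trans hkey
    have htie' : τ.ra .tie = σ.ra .tie := (hF.ra .tie rfl).trans htie
    refine (outStep_runs hI hev he (by omega) (by rw [hord']; exact ho.lt e he)
      (by rw [hord', hkey']) (by rw [hord', htie']) ((hF.rv .y rfl).trans h₃)
      (hLR _ (ho.lt e he)) (hL2 _ (ho.lt e he)) fun k hk => ?_).conseq le_rfl fun υ hFυ h => ?_
    · have := ho.sorted k e hk he
      simp only [LexLT, not_or, not_lt] at this
      exact this.1
    · simpa [Store.iv_setI, Store.rv_setI, Store.ra_setI] using h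
  · have hy₄ : τ₄.rv .y = 2 * π := (hF₄.rv .y rfl).trans h₃
    have hcnt := h₄.count
    rw [hset]
    refine Halts.ite (by omega) ⟨trivial, trivial⟩ (fun hlt => ?_) fun hlt => ?_
    · simp only [TE.Holds, RE.eval, hy₄] at hlt
      refine (emit_runs rfl (by omega)).conseq (by omega) fun υ _ ⟨h5, h6, h7, h8⟩ => ?_
      rw [h5]
      exact ⟨by omega, h₄.finish_emit hlt h6 h7 (by rw [h8, hy₄])⟩
    · simp only [TE.Holds, RE.eval, hy₄, not_lt] at hlt
      refine Halts.of_wp (by omega) ?_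
      exact ⟨by omega, h₄.bounds, h₄.finish hlt⟩

/-! ### Gaps between periodic families of intervals -/

/-- None of the first `n` intervals continues beyond `l`. -/
def GapFree (lo hi : ℕ → ℝ) (n : ℕ) (l : ℝ) : Prop :=
  ∀ k < n, lo k ≤ hi k → ¬ (lo k ≤ l ∧ l < hi k)

open Classical in
/-- None of the first `n` intervals, continued with period `π / 2`, begins between `l` and `x`. -/
def BeforeNext (lo hi : ℕ → ℝ) (n : ℕ) (l x : ℝ) : Prop :=
  x < 10 ∧ ∀ k < n, lo k ≤ hi k → x < if l < lo k then lo k else lo k + π / 2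

/-- The number `x` is in one of the first `n` intervals, continued with period `π / 2`. -/
def InPeriodic (lo hi : ℕ → ℝ) (n : ℕ) (x : ℝ) : Prop :=
  ∃ k < n, ∃ z : ℤ, lo k ≤ x - z * (π / 2) ∧ x - z * (π / 2) ≤ hi k

theorem InPeriodic.sub_mul {lo hi : ℕ → ℝ} {n : ℕ} {x : ℝ} (h : InPeriodic lo hi n x) (w : ℤ) :
    InPeriodic lo hi n (x - w * (π / 2)) := by
  obtain ⟨k, hk, z, h1, h2⟩ := h
  refine ⟨k, hk, z - w, ?_⟩
  have e : x - w * (π / 2) - ((z - w : ℤ) : ℝ) * (π / 2) = x - z * (π / 2) := by push_cast; ring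
  rw [e]
  exact ⟨h1, h2⟩

/-- All intervals lie in one period `[0, π / 2]`. A translate containing `x` would either begin in
the period before the next `lo k` or have ended by `hi i`; the bounds on the integer shift exclude
both. -/
theorem not_inPeriodic_of_gap {lo hi : ℕ → ℝ} {n i : ℕ} (hlo : ∀ k < n, 0 ≤ lo k)
    (hhi : ∀ k < n, hi k ≤ π / 2) (hi0 : 0 ≤ hi i) {x : ℝ}
    (h1 : GapFree lo hi n (hi i)) (h2 : hi i < x) (h3 : BeforeNext lo hi n (hi i) x) :
    ¬ InPeriodic lo hi n x := by
  rintro ⟨k, hk, z, h4, h5⟩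
  have hπ := Real.pi_pos
  have hne := h4.trans h5
  have h6 := h3.2 k hk hne
  have h7 := h1 k hk hne
  have hlk := hlo k hk
  have hhk := hhi k hk
  split_ifs at h6 with h8
  · have hz : z ≤ -1 := by
      have : (z : ℝ) < 0 := by nlinarith
      have : z < 0 := by exact_mod_cast this
      omega
    have : (z : ℝ) ≤ -1 := by exact_mod_cast hz
    nlinarith
  · have h9 : hi k ≤ hi i := by
      by_contra h10
      exact h7 ⟨not_lt.1 h8, not_le.1 h10⟩
    have hz : z ≤ 0 := by
      have : (z : ℝ) < 1 := by nlinarith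
      have : z < 1 := by exact_mod_cast this
      omega
    have : (z : ℝ) ≤ 0 := by exact_mod_cast hz
    nlinarith

/-- Reduce `θ` modulo `π / 2` to `α`. The gap around `α` begins at the largest `hi i` below `α`; if
no nonempty interval ends below `α`, it begins at the largest `hi i` of the preceding period. -/
theorem exists_gap {lo hi : ℕ → ℝ} {n : ℕ} (hn : 0 < n) (hlo : ∀ k < n, 0 ≤ lo k)
    (hhi : ∀ k < n, hi k ≤ π / 2) {θ : ℝ} (h0 : 0 ≤ θ) (h2 : θ < 2 * π)
    (h : ¬ InPeriodic lo hi n θ) :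
    ∃ i < n, ∃ j < 6, GapFree lo hi n (hi i) ∧ hi i < θ - ((j : ℕ) - 2) * (π / 2) ∧
      BeforeNext lo hi n (hi i) (θ - ((j : ℕ) - 2) * (π / 2)) := by
  have hπ := Real.pi_pos
  have hπ3 := Real.pi_gt_three
  have hπ4 := Real.pi_lt_d2
  by_cases hne : ∃ k < n, lo k ≤ hi k
  swap
  · push Not at hne
    -- If all intervals are empty, every angle is in a gap. The shift by two periods back gives `π /
    -- 2 < θ + π < 3 π < 10`; this explains both the lowest shift and the cap 10.
    refine ⟨0, hn, 0, by omega, fun k hk hk' => absurd hk' (not_le.2 (hne k hk)), ?_, ?_,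
      fun k hk hk' => absurd hk' (not_le.2 (hne k hk))⟩
    · have := hhi 0 hn; push_cast; linarith
    · push_cast; linarith
  -- the position within the period
  obtain ⟨j, hj, hα0, hα1⟩ : ∃ j < 4, 0 ≤ θ - (j : ℕ) * (π / 2) ∧ θ - (j : ℕ) * (π / 2) < π / 2 := by
    have hf := Nat.floor_le (a := θ / (π / 2)) (by positivity)
    have hf' := Nat.lt_floor_add_one (θ / (π / 2))
    rw [le_div_iff₀ (by positivity)] at hf
    rw [div_lt_iff₀ (by positivity)] at hf'
    refine ⟨⌊θ / (π / 2)⌋₊, ?_, by linarith, by linarith⟩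
    rw [Nat.floor_lt (by positivity), div_lt_iff₀ (by positivity)]
    push_cast; linarith
  set α := θ - (j : ℕ) * (π / 2) with hα
  have hgood : ∀ k < n, ∀ z : ℤ, ¬ (lo k ≤ α - z * (π / 2) ∧ α - z * (π / 2) ≤ hi k) := by
    intro k hk z hz
    apply h
    refine ⟨k, hk, j + z, ?_⟩
    have e : θ - ((j + z : ℤ) : ℝ) * (π / 2) = α - z * (π / 2) := by rw [hα]; push_cast; ring
    rwa [e]
  have hgood0 : ∀ k < n, lo k ≤ α → ¬ α ≤ hi k := fun k hk h1 h2 =>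
    hgood k hk 0 (by simpa using ⟨h1, h2⟩)
  have argmax : ∀ p : ℕ → Prop, (∃ k < n, p k) → ∃ i < n, p i ∧ ∀ k < n, p k → hi k ≤ hi i := by
    classical
    rintro p ⟨k, hk, hpk⟩
    obtain ⟨i, hi', hmax⟩ := Finset.exists_max_image ((Finset.range n).filter p) hi
      ⟨k, by simp [hk, hpk]⟩
    simp only [Finset.mem_filter, Finset.mem_range] at hi' hmax
    exact ⟨i, hi'.1, hi'.2, fun k hk hpk => hmax k ⟨hk, hpk⟩⟩
  by_cases hlt : ∃ k < n, lo k ≤ hi k ∧ hi k < α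
  · obtain ⟨i, hin, ⟨hine, hilt⟩, hmax⟩ := argmax _ hlt
    -- Here the shift is 0 to 3 periods; in the case of the preceding period below it is -1 to 2.
    -- With the shift -2 above, the six values of `j` cover all cases.
    have e : θ - (((j + 2 : ℕ) : ℝ) - 2) * (π / 2) = α := by rw [hα]; push_cast; ring
    refine ⟨i, hin, j + 2, by omega, ?_, by rwa [e], ?_⟩
    · rintro k hk hk' ⟨h3, h4⟩
      refine hgood0 k hk (by linarith) ?_
      by_contra h5
      linarith [hmax k hk ⟨hk', not_le.1 h5⟩]
    · rw [e]
      refine ⟨by linarith, fun k hk hk' => ?_⟩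
      split_ifs with h3
      · by_contra h4
        refine hgood0 k hk (not_lt.1 h4) ?_
        by_contra h5
        linarith [hmax k hk ⟨hk', not_le.1 h5⟩]
      · linarith [hlo k hk]
  · push Not at hlt
    obtain ⟨i, hin, hine, hmax⟩ := argmax _ hne
    have e : θ - (((j + 1 : ℕ) : ℝ) - 2) * (π / 2) = α + π / 2 := by rw [hα]; push_cast; ring
    have hil := hhi i hin
    refine ⟨i, hin, j + 1, by omega, ?_, ?_, ?_⟩
    · rintro k hk hk' ⟨h3, h4⟩
      linarith [hmax k hk hk']
    · rw [e]
      by_contra h3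
      refine hgood i hin (-1) ?_
      push_cast
      constructor <;> linarith
    · rw [e]
      refine ⟨by linarith, fun k hk hk' => ?_⟩
      have h3 : α < lo k := by
        by_contra h4
        exact hgood0 k hk (not_lt.1 h4) (hlt k hk hk')
      -- No interval begins after the largest right endpoint, so the next beginning is `lo k + π /
      -- 2`, and this exceeds `α + π / 2`.
      rw [if_neg (by linarith [hmax k hk hk'])]
      linarith

/-- Take the `k`-th interval of the point `p` into account in the computation of a gap. -/
def gapStep : Cmd := .block [
  .setR .x (.get .ang (.add (.mul (.lit 8) (.var .p)) (.mul (.lit 2) (.var .k)))),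
  .setR .y (.sub (.var .hp)
    (.get .ang (.add (.add (.mul (.lit 8) (.var .p)) (.mul (.lit 2) (.var .k))) (.lit 1)))),
  .ite (.rlt (.var .y) (.var .x)) .skip (.block [
    .ite (.rlt (.var .l) (.var .x)) (.setR .nx (.var .x)) (.block [
      .setR .nx (.add (.var .x) (.var .hp)),
      .ite (.rlt (.var .l) (.var .y)) (.setR .ok (.lit 0)) .skip]),
    .ite (.rlt (.var .nx) (.var .r)) (.setR .r (.var .nx)) .skip])]

/-- The left endpoints of the intervals of the point `p`. -/
def lowEnd (A : ℕ → ℝ) (p k : ℕ) : ℝ := A (8 * p + 2 * k)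

/-- The right endpoints of the intervals of the point `p`. -/
noncomputable def highEnd (A : ℕ → ℝ) (p k : ℕ) : ℝ := π / 2 - A (8 * p + 2 * k + 1)

/-- The accumulator `r` is characterized by all `x` below it, so a running minimum over nonempty
intervals turns into a conjunction of conditions; the sign of `ok` likewise records a conjunction.
-/
theorem gapStep_runs {N : ℕ} {σ : Store} {p k : ℕ} {l : ℝ} {A : ℕ → ℝ}
    (hp : σ.iv .p = p) (hk : σ.iv .k = k) (hN : 8 * p + 2 * k + 20 < N) (hhp : σ.rv .hp = π / 2)
    (hl : σ.rv .l = l) (hA : σ.ra .ang = A)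
    (h1 : 0 < σ.rv .ok ↔ GapFree (lowEnd A p) (highEnd A p) k l)
    (h2 : ∀ x, x < σ.rv .r ↔ BeforeNext (lowEnd A p) (highEnd A p) k l x) :
    Halts N gapStep σ 1 fun τ =>
      (0 < τ.rv .ok ↔ GapFree (lowEnd A p) (highEnd A p) (k + 1) l) ∧
      ∀ x, x < τ.rv .r ↔ BeforeNext (lowEnd A p) (highEnd A p) (k + 1) l x := by
  set a := lowEnd A p k with ha
  set b := highEnd A p k with hb
  have hG : GapFree (lowEnd A p) (highEnd A p) (k + 1) l ↔
      GapFree (lowEnd A p) (highEnd A p) k l ∧ (a ≤ b → ¬ (a ≤ l ∧ l < b)) := by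
    simp only [GapFree, Nat.lt_succ_iff_lt_or_eq]
    constructor
    · exact fun h => ⟨fun k' hk' => h k' (.inl hk'), h k (.inr rfl)⟩
    · rintro ⟨h, h'⟩ k' (hk' | rfl)
      · exact h k' hk'
      · exact h'
  have hB : ∀ x, BeforeNext (lowEnd A p) (highEnd A p) (k + 1) l x ↔
      BeforeNext (lowEnd A p) (highEnd A p) k l x ∧
        (a ≤ b → x < if l < a then a else a + π / 2) := by
    intro x
    simp only [BeforeNext, Nat.lt_succ_iff_lt_or_eq]
    constructor
    · exact fun h => ⟨⟨h.1, fun k' hk' => h.2 k' (.inl hk')⟩, h.2 k (.inr rfl)⟩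
    · rintro ⟨h, h'⟩
      refine ⟨h.1, ?_⟩
      rintro k' (hk' | rfl)
      · exact h.2 k' hk'
      · exact h'
  simp only [hG, hB, ← h1, ← h2]
  have ea : A (8 * p + 2 * k) = a := rfl
  have eb : π / 2 - A (8 * p + 2 * k + 1) = b := rfl
  apply Halts.of_wp le_rfl
  simp only [gapStep, Cmd.block, Cmd.wp, TE.Legal, TE.Holds, RE.Legal, IE.Legal, RE.eval, IE.eval,
    Store.iv_setR, Store.rv_setR, Store.ra_setR, reduceCtorEq, if_true, if_false, hp, hk, hhp, hl,
    hA, ea, eb, and_true, true_and]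
  refine ⟨by omega, by omega, fun h3 => ?_, fun h3 => ⟨fun h4 => ⟨fun h5 => ?_, fun h5 => ?_⟩,
    fun h4 => ⟨fun h5 => ⟨fun h6 => ?_, fun h6 => ?_⟩, fun h5 => ⟨fun h6 => ?_, fun h6 => ?_⟩⟩⟩⟩
  · refine ⟨⟨fun h => ⟨h, fun h' => by linarith⟩, And.left⟩, fun x => ⟨fun h =>
      ⟨h, fun h' => by linarith⟩, And.left⟩⟩
  all_goals
    rw [not_lt] at h3
    simp only [h3, h4, true_imp_iff, if_true, if_false]
    refine ⟨⟨fun h => ?_, fun h => ?_⟩, fun x => ⟨fun h => ?_, fun h => ?_⟩⟩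
  all_goals grind

/-- Compute the gap with number `e`. -/
def gapBody : Cmd := .block [
  .setI .p (.add (.var .nR) (.div (.var .e) (.lit 24))),
  .setI .lo (.div (.sub (.var .e) (.mul (.lit 24) (.div (.var .e) (.lit 24)))) (.lit 4)),
  .setI .i (.sub (.var .e) (.mul (.lit 4) (.div (.var .e) (.lit 4)))),
  .setI .h (.lit 4),
  .setR .l (.sub (.var .hp)
    (.get .ang (.add (.add (.mul (.lit 8) (.var .p)) (.mul (.lit 2) (.var .i))) (.lit 1)))),
  .setR .r (.lit 10),
  .setR .ok (.lit 1),
  .for .k .h gapStep,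
  .setR .x (.mul (.sub (.ofInt (.var .lo)) (.lit 2)) (.var .hp)),
  .ite (.and (.rlt (.lit 0) (.var .ok)) (.rlt (.var .l) (.var .r)))
    (.block [.putR .key (.var .e) (.add (.var .l) (.var .x)),
      .putR .tie (.var .e) (.add (.var .r) (.var .x))])
    (.block [.putR .key (.var .e) (.lit (-2)), .putR .tie (.var .e) (.lit (-1))])]

/-- The interval `(K, T)` is the gap after the `i`-th interval of the point `p`, shifted by `j - 2`
periods, or an interval of negative numbers if there is no such gap. -/
def IsGap (A : ℕ → ℝ) (p i j : ℕ) (K T : ℝ) : Prop :=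
  K < T ∧ K ≤ 2 * π ∧ ∀ θ, 0 ≤ θ → (θ ∈ Ioo K T ↔
    GapFree (lowEnd A p) (highEnd A p) 4 (highEnd A p i) ∧
    highEnd A p i < θ - ((j : ℕ) - 2) * (π / 2) ∧
    BeforeNext (lowEnd A p) (highEnd A p) 4 (highEnd A p i) (θ - ((j : ℕ) - 2) * (π / 2)))

theorem gapBody_runs {N : ℕ} {σ : Store} {e n₀ p : ℕ} {A : ℕ → ℝ}
    (he : σ.iv .e = e) (hn₀ : σ.iv .nR = n₀) (hp : n₀ + e / 24 = p) (heN : e + 30 < N)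
    (hpN : 8 * p + 40 < N) (hhp : σ.rv .hp = π / 2) (hA : σ.ra .ang = A)
    (hA0 : ∀ g < 8, 0 ≤ A (8 * p + g)) :
    Halts N gapBody σ 5 fun τ => ∃ K T, IsGap A p (e % 4) (e % 24 / 4) K T ∧
      τ.ra .key = Function.update (σ.ra .key) e K ∧
      τ.ra .tie = Function.update (σ.ra .tie) e T := by
  have hπ := Real.pi_pos
  simp only [gapBody, Cmd.block]
  refine Halts.seq (Halts.of_wp (Q := fun υ => υ.iv .p = p) (by omega) ?_) fun τ₁ hF₁ h₁ => ?_
  · simp [Cmd.wp, IE.Legal, IE.eval, Store.iv_setI, he, hn₀]; omega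
  have he₁ := (hF₁.iv .e rfl).trans he
  refine Halts.seq (Halts.of_wp (Q := fun υ => υ.iv .lo = e % 24 / 4) (by omega) ?_)
    fun τ₂ hF₂ h₂ => ?_
  · simp [Cmd.wp, IE.Legal, IE.eval, Store.iv_setI, he₁]; omega
  have he₂ := (hF₂.iv .e rfl).trans he₁
  refine Halts.seq (Halts.of_wp (Q := fun υ => υ.iv .i = e % 4) (by omega) ?_)
    fun τ₃ hF₃ h₃ => ?_
  · simp [Cmd.wp, IE.Legal, IE.eval, Store.iv_setI, he₂]; omega
  have he₃ := (hF₃.iv .e rfl).trans he₂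
  have hp₃ : τ₃.iv .p = p := (hF₃.iv .p rfl).trans ((hF₂.iv .p rfl).trans h₁)
  have hhp₃ : τ₃.rv .hp = π / 2 := by rw [hF₃.rv .hp rfl, hF₂.rv .hp rfl, hF₁.rv .hp rfl, hhp]
  have hA₃ : τ₃.ra .ang = A := by rw [hF₃.ra .ang rfl, hF₂.ra .ang rfl, hF₁.ra .ang rfl, hA]
  set l := highEnd A p (e % 4) with hl
  refine Halts.seq (Halts.of_wp (Q := fun υ => υ.iv .h = 4) (by omega) ?_) fun τ₄ hF₄ h₄ => ?_
  · simp [Cmd.wp, IE.Legal, IE.eval, Store.iv_setI]; omega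
  refine Halts.seq (Halts.of_wp (Q := fun υ => υ.rv .l = l) (by omega) ?_) fun τ₅ hF₅ h₅ => ?_
  · simp [Cmd.wp, RE.Legal, IE.Legal, RE.eval, IE.eval, Store.rv_setR, hF₄.iv .i rfl,
      hF₄.iv .p rfl, hF₄.rv .hp rfl, hF₄.ra .ang rfl, h₃, hp₃, hhp₃, hA₃, hl, highEnd]
    omega
  refine Halts.seq (Halts.of_wp (Q := fun υ => υ.rv .r = 10) (by omega) ?_) fun τ₆ hF₆ h₆ => ?_
  · simp [Cmd.wp, RE.Legal, RE.eval, Store.rv_setR]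
  refine Halts.seq (Halts.of_wp (Q := fun υ => υ.rv .ok = 1) (by omega) ?_) fun τ₇ hF₇ h₇ => ?_
  · simp [Cmd.wp, RE.Legal, RE.eval, Store.rv_setR]
  have hh₇ : τ₇.iv .h = 4 := by rw [hF₇.iv .h rfl, hF₆.iv .h rfl, hF₅.iv .h rfl, h₄]
  have hr₇ : τ₇.rv .r = 10 := by rw [hF₇.rv .r rfl, h₆]
  have hl₇ : τ₇.rv .l = l := by rw [hF₇.rv .l rfl, hF₆.rv .l rfl, h₅]
  have hp₇ : τ₇.iv .p = p := by
    rw [hF₇.iv .p rfl, hF₆.iv .p rfl, hF₅.iv .p rfl, hF₄.iv .p rfl, hp₃]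
  have hlo₇ : τ₇.iv .lo = e % 24 / 4 := by
    rw [hF₇.iv .lo rfl, hF₆.iv .lo rfl, hF₅.iv .lo rfl, hF₄.iv .lo rfl, hF₃.iv .lo rfl, h₂]
  have he₇ : τ₇.iv .e = e := by
    rw [hF₇.iv .e rfl, hF₆.iv .e rfl, hF₅.iv .e rfl, hF₄.iv .e rfl, he₃]
  have hhp₇ : τ₇.rv .hp = π / 2 := by
    rw [hF₇.rv .hp rfl, hF₆.rv .hp rfl, hF₅.rv .hp rfl, hF₄.rv .hp rfl, hhp₃]
  have hA₇ : τ₇.ra .ang = A := by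
    rw [hF₇.ra .ang rfl, hF₆.ra .ang rfl, hF₅.ra .ang rfl, hF₄.ra .ang rfl, hA₃]
  have hkey₇ : τ₇.ra .key = σ.ra .key := by
    rw [hF₇.ra .key rfl, hF₆.ra .key rfl, hF₅.ra .key rfl, hF₄.ra .key rfl, hF₃.ra .key rfl,
      hF₂.ra .key rfl, hF₁.ra .key rfl]
  have htie₇ : τ₇.ra .tie = σ.ra .tie := by
    rw [hF₇.ra .tie rfl, hF₆.ra .tie rfl, hF₅.ra .tie rfl, hF₄.ra .tie rfl, hF₃.ra .tie rfl,
      hF₂.ra .tie rfl, hF₁.ra .tie rfl]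
  refine Halts.seq (Halts.for (L := 1) (b := 4) (M := 5) (v := .k) (c := .h) (fun k τ =>
    (0 < τ.rv .ok ↔ GapFree (lowEnd A p) (highEnd A p) k l) ∧
      ∀ x, x < τ.rv .r ↔ BeforeNext (lowEnd A p) (highEnd A p) k l x) le_rfl le_rfl (by simp)
    (by rfl) (by rfl) hh₇ (by omega) ?_ ?_) fun τ₈ hF₈ ⟨h₈, h₈'⟩ => ?_
  · simp [Store.rv_setI, h₇, hr₇, GapFree, BeforeNext]
  · rintro k hk τ hF hkv ⟨hI1, hI2⟩
    refine (gapStep_runs ((hF.iv .p rfl).trans hp₇) hkv (by omega) ((hF.rv .hp rfl).trans hhp₇)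
      ((hF.rv .l rfl).trans hl₇) ((hF.ra .ang rfl).trans hA₇) hI1 hI2).conseq le_rfl
      fun υ _ h => ?_
    simpa [Store.rv_setI] using h
  have hhp₈ : τ₈.rv .hp = π / 2 := (hF₈.rv .hp rfl).trans hhp₇
  have hlo₈ : τ₈.iv .lo = e % 24 / 4 := (hF₈.iv .lo rfl).trans hlo₇
  have hl₈ : τ₈.rv .l = l := (hF₈.rv .l rfl).trans hl₇
  have he₈ : τ₈.iv .e = e := (hF₈.iv .e rfl).trans he₇
  have hkey₈ : τ₈.ra .key = σ.ra .key := (hF₈.ra .key rfl).trans hkey₇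
  have htie₈ : τ₈.ra .tie = σ.ra .tie := (hF₈.ra .tie rfl).trans htie₇
  have hput : ∀ (τ : Store) (K T : ℝ), τ.ra .key = σ.ra .key → τ.ra .tie = σ.ra .tie →
      ((τ.putR .key e K).putR .tie e T).ra .key = Function.update (σ.ra .key) e K ∧
      ((τ.putR .key e K).putR .tie e T).ra .tie = Function.update (σ.ra .tie) e T := by
    intro τ K T h1 h2
    constructor <;> ext i <;> simp [Store.ra_putR, Function.update_apply, h1, h2]
  apply Halts.of_wp (by omega)
  simp only [Cmd.wp, TE.Legal, TE.Holds, RE.Legal, IE.Legal, RE.eval, IE.eval, Store.iv_setR,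
    Store.rv_setR, Store.iv_putR, Store.rv_putR, hlo₈, hhp₈, hl₈, he₈, reduceCtorEq, if_true,
    if_false, and_true, true_and, h₈, Int.cast_zero, Int.cast_ofNat]
  refine ⟨by omega, fun hc => ⟨by omega, by omega, ?_⟩, fun hc => ⟨by omega, by omega, ?_⟩⟩
  · refine ⟨_, _, ?_, hput _ _ _ hkey₈ htie₈⟩
    · refine ⟨by linarith [hc.2], ?_, fun θ hθ => ?_⟩
      · have h1 : ((e % 24 / 4 : ℕ) : ℝ) ≤ 5 := by
          have : e % 24 / 4 ≤ 5 := by omega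
          exact_mod_cast this
        have h2 : l ≤ π / 2 := by
          have := hA0 (2 * (e % 4) + 1) (by omega)
          rw [← add_assoc] at this
          rw [hl, highEnd]; linarith
        nlinarith
      · rw [mem_Ioo, ← h₈' (θ - _), ← hl]
        constructor
        · rintro ⟨h1, h2⟩; exact ⟨hc.1, by linarith, by linarith⟩
        · rintro ⟨-, h1, h2⟩; exact ⟨by linarith, by linarith⟩
  · refine ⟨_, _, ?_, hput _ _ _ hkey₈ htie₈⟩
    · refine ⟨by norm_num, by push_cast; linarith, fun θ hθ => ?_⟩
      rw [mem_Ioo, ← h₈' (θ - _), ← hl]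
      constructor
      -- A missing gap is stored as `(-2, -1)`: it is a genuine open interval, as the output scan
      -- needs, but contains no nonnegative angle.
      · rintro ⟨h1, h2⟩; push_cast at h2; linarith
      · rintro ⟨h0, h1, h2⟩; exact absurd ⟨h0, h1.trans h2⟩ hc

/-- Compute all gaps. -/
def gaps : Cmd := .block [.setI .c (.mul (.lit 24) (.var .nB)), .for .e .c gapBody]

theorem gaps_runs {N : ℕ} {σ : Store} {n₀ b : ℕ} {A : ℕ → ℝ} (hn₀ : σ.iv .nR = n₀)
    (hb : σ.iv .nB = b) (hN : 24 * b + 8 * n₀ + 60 < N) (hhp : σ.rv .hp = π / 2)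
    (hA : σ.ra .ang = A) (hA0 : ∀ q < b, ∀ g < 8, 0 ≤ A (8 * (n₀ + q) + g)) :
    Halts N gaps σ ((24 * b + 1) * 5) fun τ => τ.iv .c = 24 * b ∧ ∀ e < 24 * b,
      IsGap A (n₀ + e / 24) (e % 4) (e % 24 / 4) (τ.ra .key e) (τ.ra .tie e) := by
  simp only [gaps, Cmd.block]
  refine Halts.seq (Halts.of_wp (Q := fun υ => υ.iv .c = 24 * b) (by omega) ?_)
    fun τ₁ hF₁ h₁ => ?_
  · simp [Cmd.wp, IE.Legal, IE.eval, Store.iv_setI, hb]; omega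
  refine Halts.conseq (Halts.for (L := 5) (b := 24 * b) (v := .e) (c := .c) (fun k τ => ∀ e < k,
    IsGap A (n₀ + e / 24) (e % 4) (e % 24 / 4) (τ.ra .key e) (τ.ra .tie e)) (by omega) le_rfl
    (by simp) (by rfl) (by rfl) h₁ (by omega) (by simp) ?_) le_rfl
    fun τ hF h => ⟨(hF.iv .c rfl).trans h₁, h⟩
  intro k hk τ hF hkv hI
  refine (gapBody_runs hkv ((hF.iv .nR rfl).trans ((hF₁.iv .nR rfl).trans hn₀)) rfl (by omega)
    (by omega) ((hF.rv .hp rfl).trans ((hF₁.rv .hp rfl).trans hhp))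
    ((hF.ra .ang rfl).trans ((hF₁.ra .ang rfl).trans hA)) (hA0 _ (by omega))).conseq le_rfl ?_
  rintro υ - ⟨K, T, h1, h2, h3⟩ e he
  rw [Store.ra_setI, h2, h3, Function.update_apply, Function.update_apply]
  split_ifs with h4
  · rwa [h4]
  · exact hI e (by omega)

/-! ### Free quadrants and the rectilinear convex hull -/

theorem mem_wedge (α : ℝ) (x y : Plane) : y ∈ wedge α x ↔
    0 < (y.1 - x.1) * cos α + (y.2 - x.2) * sin α ∧
      0 < (y.2 - x.2) * cos α - (y.1 - x.1) * sin α := by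
  have h := sin_sq_add_cos_sq α
  simp only [wedge, unitDir, cos_add_pi_div_two, sin_add_pi_div_two, Set.mem_ofPred_eq]
  constructor
  · rintro ⟨s, t, hs, ht, rfl⟩
    simp only [Prod.fst_add, Prod.snd_add, Prod.smul_fst, Prod.smul_snd, smul_eq_mul]
    constructor
    · have : s = (x.1 + s * cos α + t * -sin α - x.1) * cos α +
        (x.2 + s * sin α + t * cos α - x.2) * sin α := by linear_combination -s * h
      linarith
    · have : t = (x.2 + s * sin α + t * cos α - x.2) * cos α -
        (x.1 + s * cos α + t * -sin α - x.1) * sin α := by linear_combination -t * h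
      linarith
  · rintro ⟨hs, ht⟩
    refine ⟨_, _, hs, ht, ?_⟩
    ext
    · simp only [Prod.fst_add, Prod.smul_fst, smul_eq_mul]
      linear_combination (x.1 - y.1) * h
    · simp only [Prod.snd_add, Prod.smul_snd, smul_eq_mul]
      linear_combination (x.2 - y.2) * h

theorem isOpen_wedge (α : ℝ) (x : Plane) : IsOpen (wedge α x) := by
  have : wedge α x = {y : Plane | 0 < (y.1 - x.1) * cos α + (y.2 - x.2) * sin α} ∩
      {y : Plane | 0 < (y.2 - x.2) * cos α - (y.1 - x.1) * sin α} := by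
    ext y; exact mem_wedge α x y
  rw [this]
  exact (isOpen_lt (by fun_prop) (by fun_prop)).inter (isOpen_lt (by fun_prop) (by fun_prop))

/-- Openness in the vertex, not in the point: a red point that blocks a quadrant at `b` also blocks
it at all vertices near `b`. -/
theorem isOpen_mem_wedge (α : ℝ) (y : Plane) : IsOpen {x : Plane | y ∈ wedge α x} := by
  have : {x : Plane | y ∈ wedge α x} =
      {x : Plane | 0 < (y.1 - x.1) * cos α + (y.2 - x.2) * sin α} ∩
      {x : Plane | 0 < (y.2 - x.2) * cos α - (y.1 - x.1) * sin α} := by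
    ext x; exact mem_wedge α x y
  rw [this]
  exact (isOpen_lt (by fun_prop) (by fun_prop)).inter (isOpen_lt (by fun_prop) (by fun_prop))

theorem wedge_trans {α : ℝ} {x y z : Plane} (h : y ∈ wedge α x) (h' : z ∈ wedge α y) :
    z ∈ wedge α x := by
  rw [mem_wedge] at *
  constructor
  · linarith [h.1, h'.1]
  · linarith [h.2, h'.2]

theorem vertex_mem_closure_wedge (α : ℝ) (x : Plane) : x ∈ closure (wedge α x) := by
  let f : ℝ → Plane := fun t => x + t • unitDir α + t • unitDir (α + π / 2)
  have hf : Continuous f := by fun_prop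
  have h0 : f 0 = x := by simp [f]
  have ht : Tendsto f (nhdsWithin 0 (Ioi 0)) (nhds x) := by
    have := hf.tendsto 0
    rw [h0] at this
    exact this.mono_left nhdsWithin_le_nhds
  refine mem_closure_of_tendsto ht ?_
  filter_upwards [self_mem_nhdsWithin] with t ht
  exact ⟨t, t, ht, ht, rfl⟩

/-- A set is free of the points `P` in the interior of the rectilinear convex hull of `R` if and
only if each of the points is the vertex of a quadrant without points of `R`. -/
theorem isFree_rectHull_iff (ω : ℝ) (R B : Set Plane) : IsFree B (rectHull ω R) ↔
    ∀ b ∈ B, ∃ k : Fin 4, ∀ r ∈ R, r ∉ wedge (ω + (k : ℕ) * (π / 2)) b := by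
  refine forall₂_congr fun b _ => ?_
  -- A point outside the interior of a complement is a point in the closure of the union of the free
  -- quadrants.
  rw [rectHull, interior_compl, mem_compl_iff, not_not]
  constructor
  · intro hb
    by_contra! hcon
    choose r hr hrb using hcon
    -- On this neighbourhood of `b` the four chosen red points block all four quadrants. A free
    -- quadrant reaching a point `z` of it contains the quadrant of the same direction at `z`, hence
    -- a red point.
    have ho : IsOpen (⋂ k : Fin 4, {x : Plane | r k ∈ wedge (ω + (k : ℕ) * (π / 2)) x}) :=
      isOpen_iInter_of_finite fun k => isOpen_mem_wedge _ _
    obtain ⟨z, hz, q, ⟨⟨x, k, rfl⟩, hfree⟩, hzq⟩ := mem_closure_iff.1 hb _ ho (mem_iInter.2 hrb)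
    refine hfree (r k) (hr k) ?_
    rw [(isOpen_wedge _ _).interior_eq]
    exact wedge_trans hzq (mem_iInter.1 hz k)
  · rintro ⟨k, hk⟩
    refine closure_mono ?_ (vertex_mem_closure_wedge (ω + (k : ℕ) * (π / 2)) b)
    refine subset_sUnion_of_mem ⟨⟨b, k, rfl⟩, fun r hr => ?_⟩
    rw [(isOpen_wedge _ _).interior_eq]
    exact hk r hr

theorem wedge_add_int_mul (α : ℝ) (x : Plane) (z : ℤ) :
    wedge (α + z * (2 * π)) x = wedge α x := by
  ext y
  simp only [mem_wedge, cos_add_int_mul_two_pi, sin_add_int_mul_two_pi]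

theorem mem_wedge_frame (ψ α : ℝ) (x y : Plane) : y ∈ wedge (ψ + α) x ↔
    0 < (frameVec ψ 1 y - frameVec ψ 1 x).1 * cos α +
        (frameVec ψ 1 y - frameVec ψ 1 x).2 * sin α ∧
      0 < (frameVec ψ 1 y - frameVec ψ 1 x).2 * cos α -
        (frameVec ψ 1 y - frameVec ψ 1 x).1 * sin α := by
  rw [mem_wedge, cos_add, sin_add]
  simp only [frameVec, Prod.fst_sub, Prod.snd_sub]
  refine and_congr (iff_of_eq (congrArg _ ?_)) (iff_of_eq (congrArg _ ?_)) <;> ring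

/-- A vector in the right half plane is outside the wedge from `α` to `α + π / 2` when its angle is
at most `α`, and one in the left half plane when its reflected angle is at most `π / 2 - α`. The
opposite signs in `Ahead` assign the upward vertical to the reflected pass and the downward one to
the other. -/
theorem not_mem_of_angles {d : ℝ × ℝ} {α : ℝ} (h0 : 0 ≤ α) (h1 : α ≤ π / 2)
    (h2 : Ahead (-1) d → clipAngle d ≤ α)
    (h3 : Ahead 1 (-d.1, d.2) → clipAngle (-d.1, d.2) ≤ π / 2 - α) :
    ¬ (0 < d.1 * cos α + d.2 * sin α ∧ 0 < d.2 * cos α - d.1 * sin α) := by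
  have hc : 0 ≤ cos α := cos_nonneg_of_mem_Icc ⟨by linarith, h1⟩
  have hs : 0 ≤ sin α := sin_nonneg_of_nonneg_of_le_pi h0 (by linarith [Real.pi_pos])
  rintro ⟨h4, h5⟩
  rcases lt_trichotomy d.1 0 with h | h | h
  · have h6 := h3 (.inl (by simpa using h))
    rw [clipAngle_le_iff (by simpa using h.le) (by linarith) (by linarith), cos_pi_div_two_sub,
      sin_pi_div_two_sub] at h6
    simp only at h6
    by_cases h7 : 0 < d.2
    · linarith [h6 h7]
    · nlinarith
  · rw [h] at h4 h5
    have h7 : 0 < d.2 := by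
      by_contra h7
      nlinarith
    have h6 := h3 (.inr ⟨by simpa using h, by simpa using h7⟩)
    rw [clipAngle_le_iff (by simp [h]) (by linarith) (by linarith), cos_pi_div_two_sub,
      sin_pi_div_two_sub] at h6
    simp only [h] at h6
    linarith [h6 h7]
  · have h6 := h2 (.inl h)
    rw [clipAngle_le_iff h.le h0 h1] at h6
    by_cases h7 : 0 < d.2
    · linarith [h6 h7]
    · nlinarith

/-- Strictness of `α < π / 2` is essential: at `α = π / 2` the upward vertical is on the boundary of
the wedge, hence not in it, but has reflected clipped angle `π / 2`. -/
theorem angles_of_not_mem {d : ℝ × ℝ} {α : ℝ} (h0 : 0 ≤ α) (h1 : α < π / 2)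
    (h : ¬ (0 < d.1 * cos α + d.2 * sin α ∧ 0 < d.2 * cos α - d.1 * sin α)) :
    (Ahead (-1) d → clipAngle d ≤ α) ∧
      (Ahead 1 (-d.1, d.2) → clipAngle (-d.1, d.2) ≤ π / 2 - α) := by
  have hc : 0 < cos α := cos_pos_of_mem_Ioo ⟨by linarith, h1⟩
  have hs : 0 ≤ sin α := sin_nonneg_of_nonneg_of_le_pi h0 (by linarith [Real.pi_pos])
  constructor
  · intro hA
    rw [clipAngle_le_iff hA.nonneg h0 h1.le]
    intro h2
    by_contra h3
    rw [not_le] at h3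
    have hd := hA.nonneg
    refine h ⟨?_, by linarith⟩
    rcases hA with hA | ⟨-, hA⟩
    · have := mul_pos hA hc
      have := mul_nonneg h2.le hs
      linarith
    · linarith
  · intro hA
    have hd := hA.nonneg
    rw [clipAngle_le_iff hd (by linarith) (by linarith), cos_pi_div_two_sub, sin_pi_div_two_sub]
    simp only at hd ⊢
    intro h2
    by_contra h3
    rw [not_le] at h3
    refine h ⟨by linarith, ?_⟩
    have := mul_pos h2 hc
    nlinarith

theorem frameVec_neg_one (ψ : ℝ) (x y : ℝ × ℝ) : frameVec ψ (-1) y - frameVec ψ (-1) x =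
    (-(frameVec ψ 1 y - frameVec ψ 1 x).1, (frameVec ψ 1 y - frameVec ψ 1 x).2) := by
  ext
  · simp only [frameVec, Prod.fst_sub]; ring
  · rfl

/-! ### From free quadrants to periodic intervals and their gaps -/

/-- No point with index less than `k` is in the wedge with vertex `p`. -/
def FreeAt (P : ℕ → Plane) (k p : ℕ) (ω : ℝ) : Prop := ∀ r < k, P r ∉ wedge ω (P p)

theorem FreeAt.add_int_mul {P : ℕ → Plane} {k p : ℕ} {ω : ℝ} (h : FreeAt P k p ω) (z : ℤ) :
    FreeAt P k p (ω + z * (2 * π)) := fun r hr => by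
  rw [wedge_add_int_mul]; exact h r hr

section Gaps

variable {φ : ℝ} {P : ℕ → Plane} {A : ℕ → ℝ} {n₀ n p : ℕ}

theorem isMaxAngle_low (hA : ∀ g < 8, PassResult φ P n₀ n g A) (hp : p < n) (hp₀ : n₀ ≤ p) {k : ℕ}
    (hk : k < 4) : IsMaxAngle (fun i => frameVec (φ + (k : ℕ) * (π / 2)) 1 (P i)) (-1) n₀ p
      (lowEnd A p k) := by
  have := hA (2 * k) (by omega) p hp hp₀
  rwa [passSign_even, show 2 * k / 2 = k by omega] at this

theorem isMaxAngle_high (hA : ∀ g < 8, PassResult φ P n₀ n g A) (hp : p < n) (hp₀ : n₀ ≤ p) {k : ℕ}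
    (hk : k < 4) : IsMaxAngle (fun i => frameVec (φ + (k : ℕ) * (π / 2)) (-1) (P i)) 1 n₀ p
      (π / 2 - highEnd A p k) := by
  have := hA (2 * k + 1) (by omega) p hp hp₀
  rw [passSign_odd, show (2 * k + 1) / 2 = k by omega, neg_neg, ← add_assoc] at this
  rwa [highEnd, sub_sub_cancel]

theorem lowEnd_nonneg (hA : ∀ g < 8, PassResult φ P n₀ n g A) (hp : p < n) (hp₀ : n₀ ≤ p) {k : ℕ}
    (hk : k < 4) : 0 ≤ lowEnd A p k := (isMaxAngle_low hA hp hp₀ hk).1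

theorem highEnd_le (hA : ∀ g < 8, PassResult φ P n₀ n g A) (hp : p < n) (hp₀ : n₀ ≤ p) {k : ℕ}
    (hk : k < 4) : highEnd A p k ≤ π / 2 := by
  linarith [(isMaxAngle_high hA hp hp₀ hk).1]

theorem highEnd_nonneg (hA : ∀ g < 8, PassResult φ P n₀ n g A) (hp : p < n) (hp₀ : n₀ ≤ p) {k : ℕ}
    (hk : k < 4) : 0 ≤ highEnd A p k := by
  linarith [(isMaxAngle_high hA hp hp₀ hk).2.1]

theorem freeAt_of_mem (hA : ∀ g < 8, PassResult φ P n₀ n g A) (hp : p < n) (hp₀ : n₀ ≤ p) {k : ℕ}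
    (hk : k < 4) {α : ℝ} (h1 : lowEnd A p k ≤ α) (h2 : α ≤ highEnd A p k) :
    FreeAt P n₀ p (φ + (k : ℕ) * (π / 2) + α) := by
  intro r hr
  have hlow := isMaxAngle_low hA hp hp₀ hk
  have hhigh := isMaxAngle_high hA hp hp₀ hk
  have h0 : 0 ≤ α := hlow.1.trans h1
  have h3 : α ≤ π / 2 := h2.trans (highEnd_le hA hp hp₀ hk)
  rw [mem_wedge_frame]
  refine not_mem_of_angles h0 h3 ((hlow.2.2 α h0).1 h1 r hr) ?_
  rw [← frameVec_neg_one]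
  exact (hhigh.2.2 (π / 2 - α) (by linarith)).1 (by linarith) r hr

theorem mem_of_freeAt (hA : ∀ g < 8, PassResult φ P n₀ n g A) (hp : p < n) (hp₀ : n₀ ≤ p) {k : ℕ}
    (hk : k < 4) {α : ℝ} (h0 : 0 ≤ α) (h1 : α < π / 2)
    (h : FreeAt P n₀ p (φ + (k : ℕ) * (π / 2) + α)) :
    lowEnd A p k ≤ α ∧ α ≤ highEnd A p k := by
  have key := fun r hr => angles_of_not_mem h0 h1 (mt (mem_wedge_frame _ _ _ _).2 (h r hr))
  constructor
  · exact ((isMaxAngle_low hA hp hp₀ hk).2.2 α h0).2 fun r hr => (key r hr).1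
  · have := ((isMaxAngle_high hA hp hp₀ hk).2.2 (π / 2 - α) (by linarith)).2 fun r hr => by
      rw [frameVec_neg_one]; exact (key r hr).2
    linarith

/-- Shifting by `z` quarter turns in frame `k` gives the quadrant with number `k - z`, which matters
only modulo 4 because wedges have period `2 π`. -/
theorem inPeriodic_iff (hA : ∀ g < 8, PassResult φ P n₀ n g A) (hp : p < n) (hp₀ : n₀ ≤ p)
    (θ : ℝ) : InPeriodic (lowEnd A p) (highEnd A p) 4 θ ↔
      ∃ k : Fin 4, FreeAt P n₀ p (φ + θ + (k : ℕ) * (π / 2)) := by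
  have hπ := Real.pi_pos
  constructor
  · rintro ⟨k, hk, z, h1, h2⟩
    have h := freeAt_of_mem hA hp hp₀ hk h1 h2
    obtain ⟨m, hm⟩ : ∃ m : ℕ, (m : ℤ) = (k - z) % 4 := ⟨((k - z) % 4).toNat, by omega⟩
    refine ⟨⟨m, by omega⟩, ?_⟩
    have e : (k : ℤ) - z = m + 4 * ((k - z) / 4) := by omega
    have e' : (k : ℝ) - z = m + 4 * (((k - z) / 4 : ℤ) : ℝ) := by exact_mod_cast e
    have := h.add_int_mul (-((k - z) / 4))
    rw [show φ + θ + (m : ℝ) * (π / 2) = φ + (k : ℝ) * (π / 2) + (θ - z * (π / 2)) +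
      ((-((k - z) / 4) : ℤ) : ℝ) * (2 * π) by push_cast at e' ⊢; linear_combination (-π / 2) * e']
    exact this
  · rintro ⟨k, h⟩
    -- The half-open period keeps `α` below `π / 2`, the range in which freeness determines both
    -- bounds; the angle `π / 2` is treated as 0 of the next frame.
    obtain ⟨z, hα0, hα1⟩ : ∃ z : ℤ, 0 ≤ θ - z * (π / 2) ∧ θ - z * (π / 2) < π / 2 := by
      have hf := Int.floor_le (θ / (π / 2))
      have hf' := Int.lt_floor_add_one (θ / (π / 2))
      rw [le_div_iff₀ (by positivity)] at hf
      rw [div_lt_iff₀ (by positivity)] at hf'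
      exact ⟨⌊θ / (π / 2)⌋, by linarith, by linarith⟩
    obtain ⟨m, hm⟩ : ∃ m : ℕ, (m : ℤ) = ((k : ℕ) + z) % 4 :=
      ⟨(((k : ℕ) + z) % 4).toNat, by omega⟩
    have e : ((k : ℕ) : ℤ) + z = m + 4 * (((k : ℕ) + z) / 4) := by omega
    have e' : ((k : ℕ) : ℝ) + z = m + 4 * ((((k : ℕ) + z) / 4 : ℤ) : ℝ) := by exact_mod_cast e
    have := h.add_int_mul (-(((k : ℕ) + z) / 4))
    rw [show φ + θ + ((k : ℕ) : ℝ) * (π / 2) + ((-(((k : ℕ) + z) / 4) : ℤ) : ℝ) * (2 * π) =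
      φ + (m : ℝ) * (π / 2) + (θ - z * (π / 2)) by
        push_cast at e' ⊢; linear_combination (π / 2) * e'] at this
    exact ⟨m, by omega, z, mem_of_freeAt hA hp hp₀ (by omega) hα0 hα1 this⟩

/-- The gaps of a blue point cover the angles at which no quadrant at the point is free. -/
theorem exists_mem_gap_iff (hA : ∀ g < 8, PassResult φ P n₀ n g A) (hp : p < n) (hp₀ : n₀ ≤ p)
    {K T : ℕ → ℕ → ℝ} (hKT : ∀ i < 4, ∀ j < 6, IsGap A p i j (K i j) (T i j)) {θ : ℝ}
    (h0 : 0 ≤ θ) (h2 : θ < 2 * π) : (∃ i < 4, ∃ j < 6, θ ∈ Ioo (K i j) (T i j)) ↔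
      ¬ ∃ k : Fin 4, FreeAt P n₀ p (φ + θ + (k : ℕ) * (π / 2)) := by
  rw [← inPeriodic_iff hA hp hp₀]
  have hlo : ∀ k < 4, 0 ≤ lowEnd A p k := fun k hk => lowEnd_nonneg hA hp hp₀ hk
  have hhi : ∀ k < 4, highEnd A p k ≤ π / 2 := fun k hk => highEnd_le hA hp hp₀ hk
  constructor
  · rintro ⟨i, hi, j, hj, hθ⟩ hin
    obtain ⟨h3, h4, h5⟩ := ((hKT i hi j hj).2.2 θ h0).1 hθ
    refine not_inPeriodic_of_gap hlo hhi (highEnd_nonneg hA hp hp₀ hi) h3 h4 h5 ?_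
    have := hin.sub_mul ((j : ℤ) - 2)
    push_cast at this
    exact this
  · intro h
    obtain ⟨i, hi, j, hj, h3, h4, h5⟩ := exists_gap (by norm_num) hlo hhi h0 h2 h
    exact ⟨i, hi, j, hj, ((hKT i hi j hj).2.2 θ h0).2 ⟨h3, h4, h5⟩⟩

end Gaps

/-! ### The main program -/

/-- Copy the coordinates of the points from the input. -/
def readPoints : Cmd := .for .i .n (.block [
  .putR .px (.var .i) (.get .io (.add (.mul (.lit 2) (.var .i)) (.lit 1))),
  .putR .py (.var .i) (.get .io (.add (.mul (.lit 2) (.var .i)) (.lit 2)))])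

theorem readPoints_runs {N : ℕ} {σ : Store} {n : ℕ} (hn : σ.iv .n = n) (hN : 2 * n + 4 < N) :
    Halts N readPoints σ (n + 1) fun τ =>
      ∀ i < n, τ.pts i = (σ.ra .io (2 * i + 1), σ.ra .io (2 * i + 2)) := by
  refine Halts.for (L := 1) (b := n) (v := .i) (c := .n) (fun k τ =>
    ∀ i < k, τ.pts i = (σ.ra .io (2 * i + 1), σ.ra .io (2 * i + 2))) le_rfl (by omega) (by simp)
    (by rfl) (by rfl) hn (by omega) (by simp) ?_
  intro k hk τ hF hkv hI
  have hio : τ.ra .io = σ.ra .io := hF.ra .io rfl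
  refine Halts.of_wp le_rfl ?_
  simp only [Cmd.block, Cmd.wp, IE.Legal, RE.Legal, IE.eval, RE.eval, Store.iv_putR, hkv,
    Store.ra_putR, hio, reduceCtorEq, if_false]
  refine ⟨by omega, by omega, by omega, by omega, fun i hi => ?_⟩
  have := hI i
  simp only [Store.pts, Store.ra_setI, Store.ra_putR, reduceCtorEq, if_false, if_true] at this ⊢
  split_ifs with h
  · rw [h]
  · exact this (by omega)

/-- The program that computes the angular intervals. -/
def intervals : Cmd := .block [
  .setI .nR (.var .m),
  .setI .n (.add (.var .nR) (.var .nB)),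
  .setR .phi (.get .io (.lit 0)),
  .setR .hp (.mul (.lit 2) (.arctan (.lit 1))),
  readPoints, passes, gaps, sort, output]

/-- One exponent `L` serves both the sorting of the points and that of the at most `24 (n₀ + b)`
gaps. -/
theorem intervals_runs {N : ℕ} {σ : Store} {n₀ b L : ℕ} {P : ℕ → Plane}
    (hm : σ.iv .m = n₀) (hb : σ.iv .nB = b) (hN : 100 * (n₀ + b + 1) ≤ N)
    (hL : 24 * (n₀ + b) < 2 ^ L)
    (hP : ∀ i < n₀ + b, P i = (σ.ra .io (2 * i + 1), σ.ra .io (2 * i + 2)))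
    (hinj : ∀ i < n₀ + b, ∀ j < n₀ + b, P i = P j → i = j) :
    Halts N intervals σ (200 * ((n₀ + b + 1) * (L + 1))) fun τ => τ.iv .m ≤ 24 * b + 1 ∧
      (∀ i < τ.iv .m, 0 ≤ τ.ra .io (2 * i) ∧ τ.ra .io (2 * i) ≤ τ.ra .io (2 * i + 1) ∧
        τ.ra .io (2 * i) < 2 * π ∧ τ.ra .io (2 * i + 1) ≤ 2 * π) ∧
      (∀ i, i + 1 < τ.iv .m → τ.ra .io (2 * i + 1) < τ.ra .io (2 * (i + 1))) ∧
      {θ | θ ∈ Ico 0 (2 * π) ∧ ∀ q < b, ∃ k : Fin 4,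
          FreeAt P n₀ (n₀ + q) (σ.ra .io 0 + θ + (k : ℕ) * (π / 2))} =
        {θ | θ ∈ Ico 0 (2 * π) ∧ ∃ i < τ.iv .m,
          θ ∈ Icc (τ.ra .io (2 * i)) (τ.ra .io (2 * i + 1))} := by
  have hn1 : n₀ + b + 1 ≤ (n₀ + b + 1) * (L + 1) := Nat.le_mul_of_pos_right _ (by omega)
  simp only [intervals, Cmd.block]
  refine Halts.seq (Halts.of_wp (Q := fun υ => υ.iv .nR = n₀) (by omega) ?_) fun τ₁ hF₁ h₁ => ?_
  · simp [Cmd.wp, IE.Legal, IE.eval, Store.iv_setI, hm]; omega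
  refine Halts.seq (Halts.of_wp (Q := fun υ => υ.iv .n = n₀ + b) (by omega) ?_)
    fun τ₂ hF₂ h₂ => ?_
  · simp [Cmd.wp, IE.Legal, IE.eval, Store.iv_setI, h₁, hF₁.iv .nB rfl, hb]; omega
  refine Halts.seq (Halts.of_wp (Q := fun υ => υ.rv .phi = σ.ra .io 0) (by omega) ?_)
    fun τ₃ hF₃ h₃ => ?_
  · simp [Cmd.wp, RE.Legal, IE.Legal, RE.eval, IE.eval, Store.rv_setR, hF₂.ra .io rfl,
      hF₁.ra .io rfl]
    omega
  refine Halts.seq (Halts.of_wp (Q := fun υ => υ.rv .hp = π / 2) (by omega) ?_)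
    fun τ₄ hF₄ h₄ => ?_
  · simp [Cmd.wp, RE.Legal, RE.eval, Store.rv_setR]; ring
  have hn₄ : τ₄.iv .n = n₀ + b := by rw [hF₄.iv .n rfl, hF₃.iv .n rfl, h₂]
  have hR₄ : τ₄.iv .nR = n₀ := by rw [hF₄.iv .nR rfl, hF₃.iv .nR rfl, hF₂.iv .nR rfl, h₁]
  have hB₄ : τ₄.iv .nB = b := by
    rw [hF₄.iv .nB rfl, hF₃.iv .nB rfl, hF₂.iv .nB rfl, hF₁.iv .nB rfl, hb]
  have hφ₄ : τ₄.rv .phi = σ.ra .io 0 := by rw [hF₄.rv .phi rfl, h₃]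
  have hio₄ : τ₄.ra .io = σ.ra .io := by
    rw [hF₄.ra .io rfl, hF₃.ra .io rfl, hF₂.ra .io rfl, hF₁.ra .io rfl]
  refine Halts.seq ((readPoints_runs hn₄ (by omega)).conseq (by omega) fun τ _ h => h)
    fun τ₅ hF₅ h₅ => ?_
  have hP₅ : ∀ i < n₀ + b, τ₅.pts i = P i := fun i hi => by rw [h₅ i hi, hP i hi, hio₄]
  have hR₅ : τ₅.iv .nR = n₀ := (hF₅.iv .nR rfl).trans hR₄
  have hhp₅ : τ₅.rv .hp = π / 2 := (hF₅.rv .hp rfl).trans h₄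
  refine Halts.seq ((passes_runs (L := L) ((hF₅.iv .n rfl).trans hn₄) hR₅ (by omega) (by omega)
    (by omega) ((hF₅.rv .phi rfl).trans hφ₄) hhp₅ fun i hi j hj h => hinj i hi j hj
    (by rwa [hP₅ i hi, hP₅ j hj] at h)).conseq (by omega) fun τ _ h => h) fun τ₆ hF₆ h₆ => ?_
  have hhp₆ : τ₆.rv .hp = π / 2 := (hF₆.rv .hp rfl).trans hhp₅
  refine Halts.seq ((gaps_runs (n₀ := n₀) (b := b) ((hF₆.iv .nR rfl).trans hR₅)
    ((hF₆.iv .nB rfl).trans ((hF₅.iv .nB rfl).trans hB₄)) (by omega) hhp₆ rfl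
    fun q hq g hg => (h₆ g hg (n₀ + q) (by omega) (by omega)).1).conseq (by omega)
    fun τ _ h => h) fun τ₇ hF₇ ⟨hc₇, h₇⟩ => ?_
  have hhp₇ : τ₇.rv .hp = π / 2 := (hF₇.rv .hp rfl).trans hhp₆
  have hcL : (24 * b + 1) * (L + 1) ≤ 200 * ((n₀ + b + 1) * (L + 1)) := by
    rw [← mul_assoc]; gcongr; omega
  refine Halts.seq ((sort_runs (L := L) hc₇ (by omega) (by omega)).conseq hcL fun τ _ h => h)
    fun τ₈ hF₈ h₈ => ?_
  have hkey : τ₈.ra .key = τ₇.ra .key := hF₈.ra .key rfl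
  have htie : τ₈.ra .tie = τ₇.ra .tie := hF₈.ra .tie rfl
  refine (output_runs (c := 24 * b) ((hF₈.iv .c rfl).trans hc₇) (by omega)
    ((hF₈.rv .hp rfl).trans hhp₇) (by rwa [hkey, htie])
    (fun i hi => by rw [hkey, htie]; exact (h₇ i hi).1)
    (fun i hi => by rw [hkey]; exact (h₇ i hi).2.1)).conseq (by omega) ?_
  rintro τ - ⟨hm, hbd, hsep, hset⟩
  refine ⟨hm, hbd, hsep, hset.symm ▸ ?_⟩
  rw [hkey, htie]
  ext θ
  refine and_congr_right fun hθ => ?_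
  -- The gap with number `24 q + 4 j + i` belongs to blue point `q`, shift `j` and beginning `i`.
  have hgap := fun q (hq : q < b) => exists_mem_gap_iff (p := n₀ + q) h₆ (by omega) (by omega)
    (K := fun i j => τ₇.ra .key (24 * q + 4 * j + i))
    (T := fun i j => τ₇.ra .tie (24 * q + 4 * j + i)) (fun i hi j hj => by
      have := h₇ (24 * q + 4 * j + i) (by omega)
      rwa [show (24 * q + 4 * j + i) / 24 = q by omega,
        show (24 * q + 4 * j + i) % 4 = i by omega,
        show (24 * q + 4 * j + i) % 24 / 4 = j by omega] at this) hθ.1 hθ.2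
  have hfree : ∀ q < b, ∀ ω, FreeAt τ₅.pts n₀ (n₀ + q) ω ↔ FreeAt P n₀ (n₀ + q) ω := by
    intro q hq ω
    refine forall₂_congr fun r hr => ?_
    rw [hP₅ r (by omega), hP₅ (n₀ + q) (by omega)]
  constructor
  · intro h e he hθe
    refine (hgap (e / 24) (by omega)).1 ⟨e % 4, by omega, e % 24 / 4, by omega, ?_⟩ ?_
    · rwa [show 24 * (e / 24) + 4 * (e % 24 / 4) + e % 4 = e by omega]
    · obtain ⟨k, hk⟩ := h (e / 24) (by omega)
      exact ⟨k, (hfree _ (by omega) _).2 hk⟩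
  · intro h q hq
    have : ∃ k : Fin 4, FreeAt τ₅.pts n₀ (n₀ + q) (σ.ra .io 0 + θ + (k : ℕ) * (π / 2)) := by
      by_contra hk
      obtain ⟨i, hi, j, hj, hij⟩ := (hgap q hq).2 hk
      exact h _ (by omega) hij
    obtain ⟨k, hk⟩ := this
    exact ⟨k, (hfree q hq _).1 hk⟩

/-! ### The program and its resource bounds -/

/-- The whole program: the bound for the machine is set, then the intervals are computed. -/
def program : Prog :=
  .seq (.storeInt (.lit 2)
    (.mul (.lit 100) (.add (.add (.load (.lit 0)) (.load (.lit 1))) (.lit 1)))) intervals.comp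

/-- The number of binary digits of the number of gaps. -/
def logSize (n : ℕ) : ℕ := Nat.log 2 (24 * n) + 1

/-- The time bound of the program. -/
def timeBound (n : ℕ) : ℕ :=
  20 + intervals.comp.cost * (200 * ((n + 1) * (logSize n + 1)))

theorem length_flatMap_coords (l : List Plane) :
    (l.flatMap fun p => [p.1, p.2]).length = 2 * l.length := by
  induction l with
  | nil => rfl
  | cons p l ih => simp [List.flatMap_cons, ih]; omega

theorem getD_flatMap_coords (l : List Plane) (i : ℕ) :
    ((l.flatMap fun p => [p.1, p.2]).getD (2 * i) 0,
      (l.flatMap fun p => [p.1, p.2]).getD (2 * i + 1) 0) = l.getD i 0 := by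
  induction l generalizing i with
  | nil => rfl
  | cons p l ih =>
    cases i with
    | zero => rfl
    | succ i => exact ih i

theorem length_inputReals (φ : ℝ) (r b : List Plane) :
    (inputReals φ r b).length = 2 * (r.length + b.length) + 1 := by
  simp only [inputReals, List.length_cons, length_flatMap_coords, List.length_append]

/-- With `N = 100 (n + 1)` the machine size is `20 N`. Disjointness and distinctness of the colours
enter only as absence of duplicates in the joint list, which the sweep order needs. -/
theorem program_exec (φ : ℝ) (r b : List Plane) (hnd : (r ++ b).Nodup) :
    ∃ (t : ℕ) (σ : State), Exec (2000 * (r.length + b.length + 1)) program (inputState φ r b) t σ ∧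
      t ≤ timeBound (r.length + b.length) ∧
      ReportsIntervals (2000 * (r.length + b.length + 1)) σ
        (separationAngles φ {p | p ∈ r} {p | p ∈ b}) := by
  set n := r.length + b.length with hn
  set N := 100 * (n + 1) with hN
  rw [show 2000 * (n + 1) = 20 * N by omega]
  set ρ : State := { inputState φ r b with int := Function.update (inputState φ r b).int 2 N }
    with hρ
  have hpre : Exec (20 * N) (.storeInt (.lit 2)
      (.mul (.lit 100) (.add (.add (.load (.lit 0)) (.load (.lit 1))) (.lit 1))))
      (inputState φ r b) 11 ρ := by
    have := Exec.storeInt (s := 20 * N) (inputState φ r b) (.lit 2)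
      (.mul (.lit 100) (.add (.add (.load (.lit 0)) (.load (.lit 1))) (.lit 1)))
      (by simp only [IExp.Legal]; omega)
      (by simp [IExp.Legal, IExp.eval, inputState]; omega)
    simpa [IExp.cost, IExp.eval, inputState, hρ, hN, hn] using this
  have hio : ∀ i < N, (view N ρ).ra .io i = (inputReals φ r b).getD i 0 := fun i hi => by
    simp only [view, if_true, if_pos hi]; rfl
  have hL : 24 * n < 2 ^ logSize n := Nat.lt_pow_succ_log_self (by norm_num) _
  obtain ⟨t, τ, ht, he, -, -, hm, hbd, hsep, hset⟩ :=
    intervals_runs (N := N) (σ := view N ρ) (n₀ := r.length) (b := b.length) (L := logSize n)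
      (P := fun i => (r ++ b).getD i 0) (by simp [view, IVar.code, hρ, inputState])
      (by simp [view, IVar.code, hρ, inputState]) le_rfl hL
      (fun i hi => by
        rw [hio _ (by omega), hio _ (by omega)]; exact (getD_flatMap_coords _ i).symm)
      (fun i hi j hj h => by
        rw [← List.length_append] at hi hj
        simp only [List.getD_eq_getElem _ _ hi, List.getD_eq_getElem _ _ hj] at h
        exact (hnd.getElem_inj_iff).1 h)
      (by omega) ρ (by simp [hρ]) rfl
  have hio' : ∀ i, i < N → (view N τ).ra .io i = τ.real i := fun i hi => by
    simp only [view, if_true, if_pos hi]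
  have hm' : (view N τ).iv .m = τ.int 0 := rfl
  rw [hm'] at hm hbd hsep hset
  refine ⟨11 + t, τ, .seq hpre he, by
    rw [timeBound]; exact Nat.add_le_add (by norm_num) ht, by omega, fun i hi => ?_,
    fun i hi => ?_, ?_⟩
  · have := hbd i hi
    rwa [hio' _ (by omega), hio' _ (by omega)] at this
  · have := hsep i hi
    rwa [hio' _ (by omega), hio' _ (by omega)] at this
  · have e1 : {θ | θ ∈ Ico 0 (2 * π) ∧ ∃ i < τ.int 0,
        θ ∈ Icc ((view N τ).ra .io (2 * i)) ((view N τ).ra .io (2 * i + 1))} =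
        {θ | θ ∈ Ico 0 (2 * π) ∧ ∃ i < τ.int 0, θ ∈ Icc (τ.real (2 * i)) (τ.real (2 * i + 1))} := by
      ext θ
      refine and_congr_right fun _ => exists_congr fun i => and_congr_right fun hi => ?_
      rw [hio' _ (by omega), hio' _ (by omega)]
    rw [← e1, ← hset]
    ext θ
    refine and_congr_right fun _ => ?_
    rw [isFree_rectHull_iff, hio 0 (by omega)]
    have hr : ∀ i, i < r.length → (r ++ b).getD i 0 = r.getD i 0 := fun i hi =>
      List.getD_append _ _ _ _ hi
    have hb : ∀ q, (r ++ b).getD (r.length + q) 0 = b.getD q 0 := fun q => by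
      rw [List.getD_append_right _ _ _ _ (by omega), Nat.add_sub_cancel_left]
    constructor
    · intro h q hq
      have hq' : b.getD q 0 ∈ b := by
        rw [List.getD_eq_getElem _ _ hq]; exact List.getElem_mem hq
      obtain ⟨k, hk⟩ := h _ hq'
      refine ⟨k, fun i hi => ?_⟩
      beta_reduce
      rw [hr i hi, hb]
      refine hk _ ?_
      rw [List.getD_eq_getElem _ _ hi]; exact List.getElem_mem hi
    · intro h p hp
      obtain ⟨q, hq, rfl⟩ := List.mem_iff_getElem.1 hp
      obtain ⟨k, hk⟩ := h q hq
      refine ⟨k, fun x hx => ?_⟩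
      obtain ⟨i, hi, rfl⟩ := List.mem_iff_getElem.1 hx
      have := hk i hi
      beta_reduce at this
      rw [hr i hi, hb, List.getD_eq_getElem _ _ hi, List.getD_eq_getElem _ _ hq] at this
      exact this

/-- Everything is compared with `n w`, where `w` is the binary logarithm of `n`; from `n = 2` on, `w
≥ 1` absorbs the additive constants. -/
theorem isBigO_timeBound :
    (fun n : ℕ => (timeBound n : ℝ)) =O[atTop] fun n : ℕ => (n : ℝ) * Real.log n := by
  have hl2 : 0 < Real.log 2 := Real.log_pos (by norm_num)
  set C : ℝ := ((intervals.comp.cost : ℕ) : ℝ) with hC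
  have hC0 : 0 ≤ C := Nat.cast_nonneg _
  refine IsBigO.of_bound ((20 + C * (200 * (2 * 8))) / Real.log 2) ?_
  filter_upwards [eventually_ge_atTop 2] with n hn
  have hn' : (2 : ℝ) ≤ n := by exact_mod_cast hn
  have hlog : Real.log 2 ≤ Real.log n := Real.log_le_log (by norm_num) hn'
  set w : ℝ := Real.log n / Real.log 2 with hw
  have hw1 : 1 ≤ w := (one_le_div hl2).2 hlog
  have hL : (logSize n : ℝ) + 1 ≤ 8 * w := by
    -- The 5 comes from `24 ≤ 2 ^ 5`; then `7 + w ≤ 8 w`.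
    have h1 : (Nat.log 2 (24 * n) : ℝ) ≤ 5 + w := by
      have h2 := Real.natLog_le_logb (24 * n) 2
      refine h2.trans ?_
      have h3 : Real.log (24 * n) ≤ 5 * Real.log 2 + Real.log n := by
        rw [Real.log_mul (by norm_num) (by positivity), ← Real.log_rpow (by norm_num)]
        gcongr
        norm_num
      rw [Real.logb, div_le_iff₀ (by exact_mod_cast hl2), hw, add_mul]
      push_cast
      rwa [div_mul_cancel₀ _ hl2.ne']
    rw [logSize]; push_cast; linarith
  have hmain : (timeBound n : ℝ) ≤ (20 + C * (200 * (2 * 8))) * (n * w) := by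
    rw [timeBound]
    push_cast
    rw [← hC, add_mul]
    have h1 : (1 : ℝ) ≤ n * w := by nlinarith
    have h2 : ((n : ℝ) + 1) * (logSize n + 1) ≤ (2 * n) * (8 * w) := by
      gcongr; linarith
    have h3 : C * (200 * (((n : ℝ) + 1) * (logSize n + 1))) ≤ C * (200 * ((2 * n) * (8 * w))) := by
      gcongr
    linarith
  have h0 : 0 ≤ (n : ℝ) * Real.log n := mul_nonneg (by linarith) (by linarith)
  rw [Real.norm_of_nonneg (Nat.cast_nonneg _), Real.norm_of_nonneg h0]
  refine hmain.trans_eq ?_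
  rw [hw]; ring

theorem isBigO_space :
    (fun n : ℕ => ((2000 * (n + 1) : ℕ) : ℝ)) =O[atTop] fun n : ℕ => (n : ℝ) := by
  refine IsBigO.of_bound 4000 ?_
  filter_upwards [eventually_ge_atTop 1] with n hn
  rw [Real.norm_of_nonneg (Nat.cast_nonneg _), Real.norm_of_nonneg (Nat.cast_nonneg _)]
  have : 2000 * (n + 1) ≤ 4000 * n := by omega
  exact_mod_cast this

end Structured

theorem mainTheorem1 :
    ∃ (P : RealRAM.Prog) (T S : ℕ → ℕ),
      (fun n : ℕ => (T n : ℝ)) =O[atTop] (fun n : ℕ => (n : ℝ) * Real.log n) ∧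
      (fun n : ℕ => (S n : ℝ)) =O[atTop] (fun n : ℕ => (n : ℝ)) ∧
      ∀ (φ : ℝ) (R B : Finset Plane), φ ∈ Ico 0 π → Disjoint R B →
        ∀ r b : List Plane, r.Perm R.toList → b.Perm B.toList →
          (inputReals φ r b).length ≤ S (R.card + B.card) ∧
          ∃ (t : ℕ) (σ : RealRAM.State),
            RealRAM.Exec (S (R.card + B.card)) P (inputState φ r b) t σ ∧
            t ≤ T (R.card + B.card) ∧
            ReportsIntervals (S (R.card + B.card)) σ
              (separationAngles φ (R : Set Plane) (B : Set Plane)) := by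
  refine ⟨Structured.program, Structured.timeBound, fun n => 2000 * (n + 1),
    Structured.isBigO_timeBound, Structured.isBigO_space, ?_⟩
  intro φ R B _ hRB r b hr hb
  have hr' : r.length = R.card := by rw [hr.length_eq, Finset.length_toList]
  have hb' : b.length = B.card := by rw [hb.length_eq, Finset.length_toList]
  have eR : (R : Set Plane) = {p | p ∈ r} := by ext p; simp [hr.mem_iff]
  have eB : (B : Set Plane) = {p | p ∈ b} := by ext p; simp [hb.mem_iff]
  have hnd : (r ++ b).Nodup := by
    refine List.Nodup.append (hr.nodup_iff.2 R.nodup_toList) (hb.nodup_iff.2 B.nodup_toList) ?_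
    intro p hp hp'
    exact Finset.disjoint_left.1 hRB (by simpa [hr.mem_iff] using hp)
      (by simpa [hb.mem_iff] using hp')
  rw [eR, eB, ← hr', ← hb']
  refine ⟨?_, Structured.program_exec φ r b hnd⟩
  rw [Structured.length_inputReals]
  beta_reduce
  omega
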